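/- **Setting.** Let $P_0\neq P_1$ be mutually absolutely continuous probability measures on $\mathbb R$ with densities $f_0,f_1$, let $\pi_0\in[0,1]$ and $c>0$, and put $g_0=f_0*f_0$, $g_1=f_0*f_1$, $g_2=f_1*f_1$. There are infinitely many independent sequences; each sequence $s$ has hypothesis $H^s=H_1$ with probability $\pi_0$ and $H^s=H_0$ otherwise, and given $H^s=H_i$ its samples $Y^s_1,Y^s_2,\dots$ are i.i.d. with density $f_i$. *Scanning.* At each time the observer watches a pair of sequences and observes the sum of their two samples: $Z_{k+1}=Y^{s^1}_{k+1}+Y^{s^2}_{k+1}$. Let $\mathcal F_k=\sigma(Z_1,\dots,Z_k)$. An $\mathcal F_k$-measurable switching decision $\phi_k\in\{0,1\}$ determines whether observation $k+1$ comes from the same pair ($\phi_k=0$) or from a new, never observed pair ($\phi_k=1$). Scanning ends at an $(\mathcal F_k)$-stopping time $\tau_0$. Let $p^{1,1}_k$ and $p^{mix}_k$ be the conditional probabilities given $\mathcal F_k$ that both, respectively exactly one, of the two sequences watched at time $k$ are generated by $f_1$; so $(p^{1,1}_0,p^{mix}_0)=(\pi_0^2,2\pi_0(1-\pi_0))$.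 *Refinement.* One then observes $X_j=Y^{s^1}_{\tau_0+j}$, $j\ge1$, from the first sequence of the current pair, stops at a stopping time $\tau_1$ of $\mathcal G_j=\sigma(Z_1,\dots,Z_{\tau_0},X_1,\dots,X_j)$, and claims, by a $\mathcal G_{\tau_1}$-measurable decision $\delta$, one of the two sequences of the pair. The total cost is $c\,\mathbb E[\tau_0+\tau_1]+P(H^\delta=H_0)$. *Cost functions.* For $r=(r^{1,1},r^{1,0},r^{0,1})$ let $f(x|r)=f_1(x)(r^{1,1}+r^{1,0})+f_0(x)(1-r^{1,1}-r^{1,0})$ and $r'(x)=\big(f_1(x)r^{1,1},f_1(x)r^{1,0},f_0(x)r^{0,1}\big)/f(x|r)$. Let $V_0(r)=1-\max\{r^{1,1}+r^{1,0},r^{1,1}+r^{0,1}\}$, $V_{n+1}(r)=\min\{V_0(r),\,c+\int V_n(r'(x))f(x|r)\,dx\}$, $V=\lim_n V_n$ and $v(p^{1,1},p^{mix})=V(p^{1,1},p^{mix}/2,p^{mix}/2)$. Let $$\mathcal P=\{(p^{1,1},p^{mix}):0\le p^{1,1}\le1,\;0\le p^{mix}\le1,\;0\le p^{1,1}+p^{mix}\le1\}.$$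 For $p=(p^{1,1},p^{mix})\in\mathcal P$ let $g(p,z)=(1-p^{1,1}-p^{mix})g_0(z)+p^{mix}g_1(z)+p^{1,1}g_2(z)$ and $p'(z)=\big(p^{1,1}g_2(z),p^{mix}g_1(z)\big)/g(p,z)$; for a function $W$ on $\mathcal P$ let $(\mathcal E W)(p)=\int W(p'(z))\,g(p,z)\,dz$. Let $p_0=(\pi_0^2,2\pi_0(1-\pi_0))$, $U_0=v$, $U_{n+1}(p)=\min\{v(p),\,c+\min\{(\mathcal E U_n)(p),(\mathcal E U_n)(p_0)\}\}$, $U=\lim_n U_n$, $\Phi_c=\mathcal E U$ and $\Phi_s=\Phi_c(p_0)$. **Theorem.** There are Borel sets $R_\tau,R_\phi\subseteq\mathcal P$, depending only on $f_0,f_1,\pi_0,c$, namely $R_\tau=\{p\in\mathcal P:v(p)=U(p)\}$ and $R_\phi=\{p\in\mathcal P:\Phi_c(p)>\Phi_s\}$, such that the following rules are optimal: $$\tau_0^*=\min\{k\ge0:(p^{1,1}_k,p^{mix}_k)\in R_\tau\},\qquad \phi^*_k=\begin{cases}1&\text{if }(p^{1,1}_k,p^{mix}_k)\in R_\phi,\\0&\text{otherwise.}\end{cases}$$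 Precisely: a switching rule $\phi^*$ of this form (almost surely, for all $k$) exists, and for every such rule $\tau_0^*$ is an almost surely finite stopping time; $(\tau_0^*,\phi^*)$ minimizes $\mathbb E[c\tau_0+v(p^{1,1}_{\tau_0},p^{mix}_{\tau_0})]$ over all $(\tau_0,\phi)$; and there are $\tau_1^*,\delta^*$ such that $(\tau_0^*,\phi^*,\tau_1^*,\delta^*)$ minimizes the total cost over all $(\tau_0,\phi,\tau_1,\delta)$. -/

import Mathlib

open MeasureTheory ProbabilityTheory Set
open scoped ENNReal

universe u

noncomputable section

/-- A probability density function on the real line (with respect to Lebesgue measure). -/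
structure ProbDensity where
  f : ℝ → ℝ
  measurable : Measurable f
  nonneg : ∀ x, 0 ≤ f x
  lintegral_eq_one : ∫⁻ x, ENNReal.ofReal (f x) = 1

namespace ProbDensity

/-- The probability measure with the given density. -/
def law (d : ProbDensity) : Measure ℝ := volume.withDensity fun x => ENNReal.ofReal (d.f x)

instance (d : ProbDensity) : IsProbabilityMeasure d.law :=
  ⟨by simpa [law] using d.lintegral_eq_one⟩

/-- The density of the sum of two independent samples, `d * e`. -/
def conv (d e : ProbDensity) : ℝ → ℝ :=
  convolution d.f e.f (ContinuousLinearMap.lsmul ℝ ℝ) volume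

end ProbDensity

/-! ### The optimal cost functions -/

section Values

variable (f₀ f₁ : ProbDensity) (π₀ c : ℝ)

/-- The domain of the scanning statistics `(p^{1,1}, p^{mix})`. -/
def scanDomain : Set (ℝ × ℝ) :=
  {p | 0 ≤ p.1 ∧ p.1 ≤ 1 ∧ 0 ≤ p.2 ∧ p.2 ≤ 1 ∧ 0 ≤ p.1 + p.2 ∧ p.1 + p.2 ≤ 1}

/-- The predictive density of the next refinement sample in state
`r = (r^{1,1}, r^{1,0}, r^{0,1})`; note `r^{0,1} + r^{0,0} = 1 - r^{1,1} - r^{1,0}`. -/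
def refineDensity (r : ℝ × ℝ × ℝ) (x : ℝ) : ℝ :=
  f₁.f x * (r.1 + r.2.1) + f₀.f x * (1 - r.1 - r.2.1)

/-- Bayes update of the refinement statistics after the sample `x`. -/
def refineUpdate (r : ℝ × ℝ × ℝ) (x : ℝ) : ℝ × ℝ × ℝ :=
  (f₁.f x * r.1 / refineDensity f₀ f₁ r x,
    f₁.f x * r.2.1 / refineDensity f₀ f₁ r x,
    f₀.f x * r.2.2 / refineDensity f₀ f₁ r x)

/-- The false identification probability on stopping in state `r`: `1 - max {q₁, q₂}`. -/
def refineStopCost (r : ℝ × ℝ × ℝ) : ℝ := 1 - max (r.1 + r.2.1) (r.1 + r.2.2)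

/-- The optimal refinement cost when at most `n` further samples may be taken. -/
def refineValueUpTo : ℕ → ℝ × ℝ × ℝ → ℝ
  | 0, r => refineStopCost r
  | n + 1, r => min (refineStopCost r)
      (c + ∫ x, refineValueUpTo n (refineUpdate f₀ f₁ r x) * refineDensity f₀ f₁ r x)

/-- The optimal refinement cost `V`: the limit of the non-increasing sequence of
finite-horizon costs. -/
def refineValue (r : ℝ × ℝ × ℝ) : ℝ := ⨅ n : ℕ, refineValueUpTo f₀ f₁ c n r

/-- The cost `v(p^{1,1}, p^{mix}) = V(p^{1,1}, p^{mix}/2, p^{mix}/2)` of entering the refinement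
stage in the scanning state `p`. -/
def scanStopCost (p : ℝ × ℝ) : ℝ := refineValue f₀ f₁ c (p.1, p.2 / 2, p.2 / 2)

/-- The predictive density `p^{0,0} g₀ + p^{mix} g₁ + p^{1,1} g₂` of the next mixed observation. -/
def scanDensity (p : ℝ × ℝ) (z : ℝ) : ℝ :=
  (1 - p.1 - p.2) * f₀.conv f₀ z + p.2 * f₀.conv f₁ z + p.1 * f₁.conv f₁ z

/-- Bayes update of the scanning statistics after the mixed observation `z`. -/
def scanUpdate (p : ℝ × ℝ) (z : ℝ) : ℝ × ℝ :=
  (p.1 * f₁.conv f₁ z / scanDensity f₀ f₁ p z, p.2 * f₀.conv f₁ z / scanDensity f₀ f₁ p z)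

/-- The statistics of a fresh pair of sequences. -/
def scanPrior : ℝ × ℝ := (π₀ ^ 2, 2 * π₀ * (1 - π₀))

/-- `E[W(p_{k+1}) | p_k = p]` when the next observation comes from a pair in state `p`. -/
def scanExpect (W : ℝ × ℝ → ℝ) (p : ℝ × ℝ) : ℝ :=
  ∫ z, W (scanUpdate f₀ f₁ p z) * scanDensity f₀ f₁ p z

/-- The optimal scanning cost when at most `n` further mixed observations may be taken. -/
def scanValueUpTo : ℕ → ℝ × ℝ → ℝ
  | 0, p => scanStopCost f₀ f₁ c p
  | n + 1, p => min (scanStopCost f₀ f₁ c p)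
      (c + min (scanExpect f₀ f₁ (scanValueUpTo n) p)
        (scanExpect f₀ f₁ (scanValueUpTo n) (scanPrior π₀)))

/-- The optimal scanning cost `U`: the limit of the non-increasing sequence of
finite-horizon costs. -/
def scanValue (p : ℝ × ℝ) : ℝ := ⨅ n : ℕ, scanValueUpTo f₀ f₁ π₀ c n p

/-- `Φ_c`: the expected optimal future cost when the observer keeps the current pair. -/
def continueCost (p : ℝ × ℝ) : ℝ := scanExpect f₀ f₁ (scanValue f₀ f₁ π₀ c) p

/-- `Φ_s`: the expected optimal future cost when the observer switches to a new pair. -/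
def switchCost : ℝ := scanExpect f₀ f₁ (scanValue f₀ f₁ π₀ c) (scanPrior π₀)

end Values

/-! ### The search problem -/

/-- Infinitely many independent sequences. `H s = true` means that sequence `s` is generated by
`f₁`, which has probability `π₀`; given `H s`, the samples `Y s k` are i.i.d. with density `f₁`
(if `H s = true`) or `f₀` (if `H s = false`). `Y s k` is the sample of sequence `s` at time `k`;
times start at `1`, the sample at time `0` is never observed. -/
structure SearchModel (f₀ f₁ : ProbDensity) (π₀ : ℝ) {Ω : Type u} [MeasurableSpace Ω]
    (P : Measure Ω) where
  H : ℕ → Ω → Bool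
  Y : ℕ → ℕ → Ω → ℝ
  measurable_H : ∀ s, Measurable (H s)
  measurable_Y : ∀ s k, Measurable (Y s k)
  indep : iIndepFun (fun s ω => (H s ω, fun k => Y s k ω)) P
  law : ∀ s, P.map (fun ω => (H s ω, fun k => Y s k ω)) =
    ENNReal.ofReal π₀ •
        (Measure.dirac true).prod (Measure.infinitePi fun _ : ℕ => f₁.law) +
      ENNReal.ofReal (1 - π₀) •
        (Measure.dirac false).prod (Measure.infinitePi fun _ : ℕ => f₀.law)

/-- A switching rule: on the basis of the first `k` mixed observations it decides whether
(`true`) or not (`false`) to switch to a new pair of sequences for observation `k + 1`. -/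
structure SwitchRule where
  rule : (k : ℕ) → (Fin k → ℝ) → Bool
  measurable : ∀ k, Measurable (rule k)

namespace SearchModel

variable {f₀ f₁ : ProbDensity} {π₀ : ℝ} {Ω : Type u} [mΩ : MeasurableSpace Ω] {P : Measure Ω}
  (M : SearchModel f₀ f₁ π₀ P) (φ : SwitchRule)

/-- At time `k`: the number `n` of the current pair, which consists of the sequences `2 n` and
`2 n + 1`, and the vector `(Z_1, ..., Z_k)` of mixed observations, where
`Z_{k+1} = Y_{k+1}^{2 n} + Y_{k+1}^{2 n + 1}` for the pair `n` observed at time `k + 1`. -/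
def path : (k : ℕ) → Ω → ℕ × (Fin k → ℝ)
  | 0, _ => (0, Fin.elim0)
  | k + 1, ω =>
    let h := path k ω
    let n := if φ.rule k h.2 then h.1 + 1 else h.1
    (n, Fin.snoc (α := fun _ => ℝ) h.2 (M.Y (2 * n) (k + 1) ω + M.Y (2 * n + 1) (k + 1) ω))

/-- The number of the pair under observation at time `k`. -/
def pair (k : ℕ) (ω : Ω) : ℕ := (M.path φ k ω).1

/-- The mixed observations `(Z_1, ..., Z_k)`. -/
def hist (k : ℕ) (ω : Ω) : Fin k → ℝ := (M.path φ k ω).2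

theorem measurable_Y_comp {N K : Ω → ℕ} (hN : Measurable N) (hK : Measurable K) :
    Measurable fun ω => M.Y (N ω) (K ω) ω := by
  have h : Measurable fun q : (ℕ × ℕ) × Ω => M.Y q.1.1 q.1.2 q.2 :=
    measurable_from_prod_countable_right fun i => M.measurable_Y i.1 i.2
  exact h.comp ((hN.prodMk hK).prodMk measurable_id)

theorem measurable_path (k : ℕ) : Measurable (M.path φ k) := by
  induction k with
  | zero => exact measurable_const
  | succ k ih =>
    have hn : Measurable fun ω => if φ.rule k (M.path φ k ω).2 then (M.path φ k ω).1 + 1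
        else (M.path φ k ω).1 := by
      refine Measurable.ite ?_ (ih.fst.add_const 1) ih.fst
      exact ((φ.measurable k).comp ih.snd) (measurableSet_singleton true)
    refine hn.prodMk (measurable_pi_iff.2 fun i => ?_)
    refine Fin.lastCases ?_ (fun j => ?_) i
    · simp only [Fin.snoc_last]
      exact (M.measurable_Y_comp (hn.const_mul 2) measurable_const).add
        (M.measurable_Y_comp ((hn.const_mul 2).add_const 1) measurable_const)
    · simp only [Fin.snoc_castSucc]
      exact (measurable_pi_apply j).comp ih.snd

/-- `F_k = σ(Z_1, ..., Z_k)`. -/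
def scanFiltration : Filtration ℕ mΩ where
  seq k := MeasurableSpace.comap (M.hist φ k) inferInstance
  mono' := monotone_nat_of_le_succ fun k => by
    have h : M.hist φ k =
        (fun (y : Fin (k + 1) → ℝ) (i : Fin k) => y i.castSucc) ∘ M.hist φ (k + 1) := by
      funext ω i
      simp [hist, path]
    rw [h, ← MeasurableSpace.comap_comp]
    exact MeasurableSpace.comap_mono
      (measurable_pi_iff.2 fun i => measurable_pi_apply i.castSucc).comap_le
  le' k := (M.measurable_path φ k).snd.comap_le

/-- The posterior probabilities `(p_k^{1,1}, p_k^{mix})`, given `F_k`, that both sequences,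
respectively exactly one of the two sequences, under observation at time `k` are generated by
`f₁`. -/
def posterior (k : ℕ) (ω : Ω) : ℝ × ℝ :=
  ((P[{ω | M.H (2 * M.pair φ k ω) ω = true ∧
        M.H (2 * M.pair φ k ω + 1) ω = true}.indicator (fun _ => (1 : ℝ)) |
      M.scanFiltration φ k]) ω,
    (P[{ω | M.H (2 * M.pair φ k ω) ω ≠
        M.H (2 * M.pair φ k ω + 1) ω}.indicator (fun _ => (1 : ℝ)) |
      M.scanFiltration φ k]) ω)

/-- The rule `φ` switches exactly when the posterior state lies in `R` (almost surely). -/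
def SwitchesExactlyOn (R : Set (ℝ × ℝ)) : Prop :=
  ∀ᵐ ω ∂P, ∀ k, φ.rule k (M.hist φ k ω) = true ↔ M.posterior φ k ω ∈ R

/-- The expected scanning cost `E[c τ₀ + v(p_{τ₀}^{1,1}, p_{τ₀}^{mix})]`. (The value of the
statistics at an infinite time is immaterial: the cost is then infinite.) -/
def scanCost (c : ℝ) (τ₀ : Ω → WithTop ℕ) : ℝ≥0∞ :=
  ENNReal.ofReal c * ∫⁻ ω, ENat.toENNReal (τ₀ ω) ∂P +
    ∫⁻ ω, ENNReal.ofReal (scanStopCost f₀ f₁ c (M.posterior φ ((τ₀ ω).untopD 0) ω)) ∂P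

/-- The refinement sample `X_j`: the sample at time `τ₀ + j` of the first of the two sequences
that are under observation at the end of the scanning stage. -/
def refineSample (τ₀ : Ω → WithTop ℕ) (j : ℕ) (ω : Ω) : ℝ :=
  M.Y (2 * M.pair φ ((τ₀ ω).untopD 0) ω) ((τ₀ ω).untopD 0 + j) ω

theorem measurable_untopD {τ₀ : Ω → WithTop ℕ} (hτ₀ : IsStoppingTime (M.scanFiltration φ) τ₀) :
    Measurable fun ω => (τ₀ ω).untopD 0 := by
  have h1 : ∀ n : ℕ, MeasurableSet {ω | τ₀ ω = n} := fun n =>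
    (M.scanFiltration φ).le n _ (hτ₀.measurableSet_eq n)
  refine measurable_to_countable' fun n => ?_
  have h2 : MeasurableSet {ω | τ₀ ω = ⊤} := by
    have : {ω | τ₀ ω = ⊤} = (⋃ n : ℕ, {ω | τ₀ ω = n})ᶜ := by
      ext ω
      cases h : τ₀ ω <;> simp [h]
    rw [this]
    exact (MeasurableSet.iUnion h1).compl
  have h3 : (fun ω => (τ₀ ω).untopD 0) ⁻¹' {n} =
      {ω | τ₀ ω = n} ∪ ({ω | τ₀ ω = ⊤} ∩ {_ω | n = 0}) := by
    ext ω
    cases h : τ₀ ω with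
    | top => simp [h, eq_comm]
    | coe a =>
      simp [h]
      exact Iff.rfl
  rw [h3]
  exact (h1 n).union (h2.inter (MeasurableSet.const _))

theorem measurable_refineSample {τ₀ : Ω → WithTop ℕ}
    (hτ₀ : IsStoppingTime (M.scanFiltration φ) τ₀) (j : ℕ) :
    Measurable (M.refineSample φ τ₀ j) := by
  have hτ := M.measurable_untopD φ hτ₀
  have hp : Measurable fun q : ℕ × Ω => M.pair φ q.1 q.2 :=
    measurable_from_prod_countable_right fun k => (M.measurable_path φ k).fst
  exact M.measurable_Y_comp ((hp.comp (hτ.prodMk measurable_id)).const_mul 2) (hτ.add_const j)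

/-- `G_j = σ(Z_1, ..., Z_{τ₀}, X_1, ..., X_j)`. -/
def refineFiltration {τ₀ : Ω → WithTop ℕ} (hτ₀ : IsStoppingTime (M.scanFiltration φ) τ₀) :
    Filtration ℕ mΩ where
  seq j := hτ₀.measurableSpace ⊔
    ⨆ i ∈ Set.Icc 1 j, MeasurableSpace.comap (M.refineSample φ τ₀ i) inferInstance
  mono' _ _ hij := sup_le_sup_left
    (biSup_mono fun _ hi => ⟨hi.1, hi.2.trans hij⟩) _
  le' _ := sup_le hτ₀.measurableSpace_le
    (iSup₂_le fun i _ => (M.measurable_refineSample φ hτ₀ i).comap_le)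

/-- A refinement strategy following the scanning stage `(φ, τ₀)`: the stopping time `τ₁` and the
terminal decision `δ`, which claims the first (`true`) or the second (`false`) sequence of the
pair under observation at time `τ₀`. -/
structure Refinement {τ₀ : Ω → WithTop ℕ} (hτ₀ : IsStoppingTime (M.scanFiltration φ) τ₀) where
  τ₁ : Ω → WithTop ℕ
  isStoppingTime : IsStoppingTime (M.refineFiltration φ hτ₀) τ₁
  δ : Ω → Bool
  measurable_δ : Measurable[isStoppingTime.measurableSpace] δ

/-- The total cost `c E[τ₀ + τ₁] + P(H^δ = H₀)` of a two-stage strategy. -/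
def totalCost (c : ℝ) {τ₀ : Ω → WithTop ℕ} (hτ₀ : IsStoppingTime (M.scanFiltration φ) τ₀)
    (ρ : M.Refinement φ hτ₀) : ℝ≥0∞ :=
  ENNReal.ofReal c * ∫⁻ ω, ENat.toENNReal (τ₀ ω + ρ.τ₁ ω) ∂P +
    P {ω | M.H (2 * M.pair φ ((τ₀ ω).untopD 0) ω + if ρ.δ ω then 0 else 1) ω = false}

end SearchModel

end

/-! Both stages are instances of one problem: stopping a Bayes filter optimally. The state is the
vector of posterior weights. It moves by Bayes' rule when an observation is drawn from the
predictive density, and before each observation the observer may apply a map `s` to it. For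
scanning, `s` is the constant map to the prior of a fresh pair; for refinement it is the identity.
All costs of stopping lie in [0, 1], so dominated convergence carries the finite-horizon recursion
to its limit U, which satisfies U = min {v, c + min {EU, (EU) ∘ s}} (`BayesFilter.value_eq`).

Optimality is then a supermartingale-type verification. Let u_k be U at the state at time k. Under
every strategy u_k ≤ c + E[u_{k+1} | F_k] and u_k ≤ v. Adding these up to τ leaves a remainder of at
most P(τ ≥ n), so no strategy costs less than U at the initial state
(`IsControlled.value_le_stopped`). If the strategy takes the minimizing action and stops exactly
when v = U, the one-step inequality is an equality before τ. Then c E[τ] ≤ 1, so τ is almost surely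
finite, and the cost is at most U at the initial state (`IsControlled.stopped_le_value`).

It remains to see that the posterior of the search model really is such a filter. Three facts give
this. Given all hypotheses and all samples up to time k, the next sample of a sequence has the law
of its hypothesis (`measure_inter_Y`), so a sum of two has the convolution density. A new pair is
independent of the history, because an event of F_k on which pair n is current involves only
sequences below 2n + 2 (`measurableSet_earlier`). Finally, Bayes' rule holds for densities
(`Tracks.isPosterior_update`). Random indices, such as the pair number or τ₀, are removed by
partitioning into countably many fibers.

The stages combine because refinement starts from a state whose value is v of the scanning state.
Hence the total cost of any strategy is at least its scanning cost (`scanCost_le_totalCost`), while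
optimal refinement costs no more than that (`totalCost_optimalRefinement_le`). A rule switching
exactly on a given set exists because the statistics can be computed recursively from the
observations alone (`feedbackRule`). -/

noncomputable section

open Filter Topology

/-! ### Optimal stopping of a controlled Bayes filter -/

/-- A Bayes filter with state space `X`: in the state `x` the next observation has density
`density x`, and the observation `z` moves the state to `update x z`. -/
structure BayesFilter (X : Type*) [MeasurableSpace X] where
  dom : Set X
  density : X → ℝ → ℝ
  update : X → ℝ → X
  measurable_density : Measurable (Function.uncurry density)
  measurable_update : Measurable (Function.uncurry update)
  density_nonneg : ∀ x ∈ dom, ∀ z, 0 ≤ density x z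
  lintegral_density : ∀ x ∈ dom, ∫⁻ z, ENNReal.ofReal (density x z) = 1
  update_mem : ∀ x ∈ dom, ∀ z, update x z ∈ dom

namespace BayesFilter

variable {X : Type*} [MeasurableSpace X] (B : BayesFilter X)

/-- The expected value of `W` at the next state. -/
def expect (W : X → ℝ) (x : X) : ℝ := ∫ z, W (B.update x z) * B.density x z

/-- The optimal cost with at most `n` further observations, at the cost `c` each, where the
observer may move the state by `s` before each observation, and stops at the cost `v`. -/
def valueUpTo (v : X → ℝ) (s : X → X) (c : ℝ) : ℕ → X → ℝ
  | 0, x => v x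
  | n + 1, x => min (v x) (c + min (B.expect (valueUpTo v s c n) x)
      (B.expect (valueUpTo v s c n) (s x)))

/-- The optimal cost without a bound on the number of observations. -/
def value (v : X → ℝ) (s : X → X) (c : ℝ) (x : X) : ℝ := ⨅ n : ℕ, B.valueUpTo v s c n x

theorem measurable_expect {W : X → ℝ} (hW : Measurable W) : Measurable (B.expect W) := by
  have : Measurable (Function.uncurry fun x z => W (B.update x z) * B.density x z) :=
    (hW.comp B.measurable_update).mul B.measurable_density
  exact this.stronglyMeasurable.integral_prod_right.measurable

variable {B}

theorem measurable_density_left (x : X) : Measurable (B.density x) :=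
  B.measurable_density.comp measurable_prodMk_left

theorem measurable_update_left (x : X) : Measurable (B.update x) :=
  B.measurable_update.comp measurable_prodMk_left

theorem integrable_density {x : X} (hx : x ∈ B.dom) : Integrable (B.density x) := by
  refine ⟨(measurable_density_left x).aestronglyMeasurable, ?_⟩
  rw [hasFiniteIntegral_iff_ofReal (ae_of_all _ (B.density_nonneg x hx)),
    B.lintegral_density x hx]
  exact ENNReal.one_lt_top

section Expect

variable {W W' : X → ℝ} {x : X}

theorem integrable_expect (hW : Measurable W) (h : ∀ x ∈ B.dom, W x ∈ Icc (0 : ℝ) 1)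
    (hx : x ∈ B.dom) : Integrable fun z => W (B.update x z) * B.density x z := by
  refine (integrable_density hx).mono
    ((hW.comp (measurable_update_left x)).mul
      (measurable_density_left x)).aestronglyMeasurable (ae_of_all _ fun z => ?_)
  have h1 := h _ (B.update_mem x hx z)
  rw [norm_mul, Real.norm_of_nonneg h1.1]
  exact mul_le_of_le_one_left (norm_nonneg _) h1.2

/-- Passes from the Bochner integral of the cost recursion to the Lebesgue integral in which the
transition laws are stated; the integrand is nonnegative and integrable on the domain. -/
theorem ofReal_expect (hW : Measurable W) (h : ∀ x ∈ B.dom, W x ∈ Icc (0 : ℝ) 1)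
    (hx : x ∈ B.dom) : ENNReal.ofReal (B.expect W x) =
      ∫⁻ z, ENNReal.ofReal (W (B.update x z)) * ENNReal.ofReal (B.density x z) := by
  rw [expect, ofReal_integral_eq_lintegral_ofReal (integrable_expect hW h hx)
    (ae_of_all _ fun z => mul_nonneg (h _ (B.update_mem x hx z)).1 (B.density_nonneg x hx z))]
  exact lintegral_congr fun z => ENNReal.ofReal_mul (h _ (B.update_mem x hx z)).1

theorem expect_mono (hW : Measurable W) (h : ∀ x ∈ B.dom, W x ∈ Icc (0 : ℝ) 1)
    (hW' : Measurable W') (h' : ∀ x ∈ B.dom, W' x ∈ Icc (0 : ℝ) 1)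
    (hle : ∀ x ∈ B.dom, W x ≤ W' x) (hx : x ∈ B.dom) : B.expect W x ≤ B.expect W' x :=
  integral_mono (integrable_expect hW h hx) (integrable_expect hW' h' hx) fun z =>
    mul_le_mul_of_nonneg_right (hle _ (B.update_mem x hx z)) (B.density_nonneg x hx z)

theorem expect_nonneg (h : ∀ x ∈ B.dom, 0 ≤ W x) (hx : x ∈ B.dom) : 0 ≤ B.expect W x :=
  integral_nonneg fun z => mul_nonneg (h _ (B.update_mem x hx z)) (B.density_nonneg x hx z)

/-- Dominated convergence: values in [0, 1] make the predictive density itself a dominating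
function. -/
theorem tendsto_expect {w : ℕ → X → ℝ} (hw : ∀ n, Measurable (w n))
    (h : ∀ n, ∀ x ∈ B.dom, w n x ∈ Icc (0 : ℝ) 1)
    (hlim : ∀ x ∈ B.dom, Tendsto (fun n => w n x) atTop (𝓝 (W x))) (hx : x ∈ B.dom) :
    Tendsto (fun n => B.expect (w n) x) atTop (𝓝 (B.expect W x)) := by
  refine tendsto_integral_of_dominated_convergence (B.density x)
    (fun n => (integrable_expect (hw n) (h n) hx).aestronglyMeasurable) (integrable_density hx)
    (fun n => ae_of_all _ fun z => ?_)
    (ae_of_all _ fun z => (hlim _ (B.update_mem x hx z)).mul_const _)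
  have h1 := h n _ (B.update_mem x hx z)
  rw [norm_mul, Real.norm_of_nonneg h1.1, Real.norm_of_nonneg (B.density_nonneg x hx z)]
  exact mul_le_of_le_one_left (B.density_nonneg x hx z) h1.2

end Expect

section Value

variable {v : X → ℝ} {s : X → X} {c : ℝ}

theorem measurable_valueUpTo (hv : Measurable v) (hs : Measurable s) (n : ℕ) :
    Measurable (B.valueUpTo v s c n) := by
  induction n with
  | zero => exact hv
  | succ n ih =>
    exact hv.min (measurable_const.add
      ((B.measurable_expect ih).min ((B.measurable_expect ih).comp hs)))

theorem measurable_value (hv : Measurable v) (hs : Measurable s) :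
    Measurable (B.value v s c) :=
  Measurable.iInf fun n => measurable_valueUpTo hv hs n

variable (hv : Measurable v) (hs : Measurable s) (hc : 0 ≤ c)
  (hv01 : ∀ x ∈ B.dom, v x ∈ Icc (0 : ℝ) 1) (hsd : ∀ x ∈ B.dom, s x ∈ B.dom)

include hc hv01 hsd in
theorem valueUpTo_mem (n : ℕ) : ∀ x ∈ B.dom, B.valueUpTo v s c n x ∈ Icc (0 : ℝ) 1 := by
  induction n with
  | zero => exact hv01
  | succ n ih =>
    intro x hx
    refine ⟨le_min (hv01 x hx).1 (add_nonneg hc (le_min ?_ ?_)),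
      (min_le_left _ _).trans (hv01 x hx).2⟩
    · exact expect_nonneg (fun y hy => (ih y hy).1) hx
    · exact expect_nonneg (fun y hy => (ih y hy).1) (hsd x hx)

include hv hs hc hv01 hsd in
-- One more permitted observation cannot hurt. The recursion is monotone in the function it is
-- applied to, so the trivial first inequality propagates.
theorem valueUpTo_succ_le (n : ℕ) :
    ∀ x ∈ B.dom, B.valueUpTo v s c (n + 1) x ≤ B.valueUpTo v s c n x := by
  induction n with
  | zero => exact fun x _ => min_le_left _ _
  | succ n ih =>
    intro x hx
    have hm := fun n => measurable_valueUpTo (B := B) (c := c) hv hs n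
    have hb := fun n => valueUpTo_mem (B := B) (c := c) hc hv01 hsd n
    exact min_le_min le_rfl (add_le_add le_rfl (min_le_min
      (expect_mono (hm _) (hb _) (hm _) (hb _) ih hx)
      (expect_mono (hm _) (hb _) (hm _) (hb _) ih (hsd x hx))))

include hv hs hc hv01 hsd in
theorem tendsto_valueUpTo {x : X} (hx : x ∈ B.dom) :
    Tendsto (fun n => B.valueUpTo v s c n x) atTop (𝓝 (B.value v s c x)) :=
  tendsto_atTop_ciInf (antitone_nat_of_succ_le fun n => valueUpTo_succ_le hv hs hc hv01 hsd n x hx)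
    ⟨0, by rintro _ ⟨n, rfl⟩; exact (valueUpTo_mem hc hv01 hsd n x hx).1⟩

include hv hs hc hv01 hsd in
theorem value_mem {x : X} (hx : x ∈ B.dom) : B.value v s c x ∈ Icc (0 : ℝ) 1 :=
  isClosed_Icc.mem_of_tendsto (tendsto_valueUpTo hv hs hc hv01 hsd hx)
    (Eventually.of_forall fun n => valueUpTo_mem hc hv01 hsd n x hx)

include hv hs hc hv01 hsd in
/-- The optimality equation. -/
theorem value_eq {x : X} (hx : x ∈ B.dom) : B.value v s c x = min (v x)
    (c + min (B.expect (B.value v s c) x) (B.expect (B.value v s c) (s x))) := by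
  -- The shifted sequence of finite-horizon values has the limit `value`; by the recursion it also
  -- converges to the right-hand side.
  refine tendsto_nhds_unique
    ((tendsto_add_atTop_iff_nat 1).2 (tendsto_valueUpTo hv hs hc hv01 hsd hx)) ?_
  have h : ∀ y ∈ B.dom, Tendsto (fun n => B.expect (B.valueUpTo v s c n) y) atTop
      (𝓝 (B.expect (B.value v s c) y)) := fun y hy =>
    tendsto_expect (fun n => measurable_valueUpTo hv hs n) (valueUpTo_mem hc hv01 hsd)
      (fun z hz => tendsto_valueUpTo hv hs hc hv01 hsd hz) hy
  exact tendsto_const_nhds.min (tendsto_const_nhds.add ((h x hx).min (h _ (hsd x hx))))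

end Value

end BayesFilter

/-! ### Stopped sums of expected increments -/

section Stopping

variable {Ω : Type*} [MeasurableSpace Ω] {P : Measure Ω}

/-- The tail-sum formula; it turns the cost of waiting into one charge per step, taken on the event
that τ has not yet occurred. -/
theorem lintegral_toENNReal_eq_tsum {τ : Ω → WithTop ℕ}
    (hτ : ∀ k : ℕ, MeasurableSet {ω | (k : WithTop ℕ) < τ ω}) :
    ∫⁻ ω, ENat.toENNReal (τ ω) ∂P = ∑' k : ℕ, P {ω | (k : WithTop ℕ) < τ ω} := by
  have h : ∀ ω, ENat.toENNReal (τ ω) =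
      ∑' k : ℕ, {ω | (k : WithTop ℕ) < τ ω}.indicator (fun _ => (1 : ℝ≥0∞)) ω := by
    intro ω
    have h1 : ∀ k : ℕ, {ω | (k : WithTop ℕ) < τ ω}.indicator (fun _ => (1 : ℝ≥0∞)) ω =
        {k : ℕ | (k : WithTop ℕ) < τ ω}.indicator (fun _ => (1 : ℝ≥0∞)) k := fun k => rfl
    simp_rw [h1]
    rw [← tsum_subtype, ENNReal.tsum_set_one]
    congr 1
    cases h : τ ω with
    | top =>
      have : {k : ℕ | (k : WithTop ℕ) < ⊤} = univ := by ext k; simp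
      rw [this, encard_univ, ENat.card_eq_top_of_infinite]; rfl
    | coe n =>
      have h2 : {k : ℕ | (k : WithTop ℕ) < (n : ℕ)} = Finset.Iio n := by ext k; simp
      have h3 : {k : ℕ | (k : WithTop ℕ) < (n : ℕ)}.encard = (n : ℕ∞) := by
        rw [h2, encard_coe_eq_coe_finsetCard, Nat.card_Iio]
      exact h3.symm
  simp_rw [h]
  rw [lintegral_tsum fun k => (measurable_const.indicator (hτ k)).aemeasurable]
  exact tsum_congr fun k => by rw [lintegral_indicator_const (hτ k), one_mul]

variable {τ : Ω → WithTop ℕ} (hτ : ∀ k : ℕ, MeasurableSet {ω | τ ω = k})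
  {u : ℕ → Ω → ℝ≥0∞} {C : ℝ≥0∞}

include hτ in
theorem measurableSet_lt_of_eq (k : ℕ) : MeasurableSet {ω | (k : WithTop ℕ) < τ ω} := by
  have : {ω | (k : WithTop ℕ) < τ ω} = (⋃ j ∈ Finset.range (k + 1), {ω | τ ω = (j : ℕ)})ᶜ := by
    ext ω
    cases h : τ ω with
    | top => simp [h]
    | coe n => simp only [mem_ofPred_eq, h, mem_compl_iff, mem_iUnion, Finset.mem_range]; simp
  rw [this]
  exact (Finset.measurableSet_biUnion _ fun j _ => hτ j).compl

include hτ in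
theorem measurableSet_le_of_eq (k : ℕ) : MeasurableSet {ω | (k : WithTop ℕ) ≤ τ ω} := by
  have : {ω | (k : WithTop ℕ) ≤ τ ω} = {ω | (k : WithTop ℕ) < τ ω} ∪ {ω | τ ω = k} := by
    ext ω; simp [le_iff_lt_or_eq, eq_comm]
  rw [this]
  exact (measurableSet_lt_of_eq hτ k).union (hτ k)

include hτ in
theorem setLIntegral_le_eq_add (n : ℕ) (f : Ω → ℝ≥0∞) :
    ∫⁻ ω in {ω | (n : WithTop ℕ) ≤ τ ω}, f ω ∂P =
      ∫⁻ ω in {ω | τ ω = n}, f ω ∂P + ∫⁻ ω in {ω | (n : WithTop ℕ) < τ ω}, f ω ∂P := by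
  rw [← lintegral_union (measurableSet_lt_of_eq hτ n)]
  · congr 2; ext ω; simp [le_iff_lt_or_eq, eq_comm, or_comm]
  · exact disjoint_left.2 fun ω h1 h2 => by simp_all

theorem setLIntegral_succ_le (n : ℕ) (f : Ω → ℝ≥0∞) :
    ∫⁻ ω in {ω | (n : WithTop ℕ) < τ ω}, f ω ∂P =
      ∫⁻ ω in {ω | ((n + 1 : ℕ) : WithTop ℕ) ≤ τ ω}, f ω ∂P := by
  congr 2; ext ω
  cases h : τ ω with
  | top => simp [h]
  | coe m =>
    simp only [mem_ofPred_eq, h, Nat.cast_withTop, WithTop.coe_lt_coe, WithTop.coe_le_coe]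
    exact Nat.lt_iff_add_one_le

include hτ in
-- The events {τ = k} cover almost everything, so the default index 0 used at τ = ⊤ does not matter.
theorem lintegral_stopped_add_top (f : ℕ → Ω → ℝ≥0∞) (hfin : ∀ᵐ ω ∂P, τ ω ≠ ⊤) :
    ∫⁻ ω, f ((τ ω).untopD 0) ω ∂P = ∑' k : ℕ, ∫⁻ ω in {ω | τ ω = k}, f k ω ∂P := by
  have h1 : ∀ k : ℕ, ∫⁻ ω in {ω | τ ω = k}, f k ω ∂P =
      ∫⁻ ω in {ω | τ ω = k}, f ((τ ω).untopD 0) ω ∂P := fun k =>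
    setLIntegral_congr_fun (hτ k) fun ω (hω : τ ω = k) => by
      rw [hω]; rfl
  simp_rw [h1]
  rw [← lintegral_iUnion hτ]
  · rw [← setLIntegral_univ]
    refine setLIntegral_congr ?_
    filter_upwards [hfin] with ω hω
    apply propext
    change True ↔ ω ∈ ⋃ k : ℕ, {ω | τ ω = k}
    obtain ⟨n, hn⟩ := WithTop.ne_top_iff_exists.1 hω
    simp only [mem_iUnion, mem_ofPred_eq, true_iff]
    exact ⟨n, hn.symm⟩
  · intro i j hij
    exact disjoint_left.2 fun ω (h1 : τ ω = i) (h2 : τ ω = j) => hij (by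
      rw [h1] at h2; exact_mod_cast h2)

include hτ in
-- Telescoping: the mass on {τ ≥ n} splits into {τ = n}, which is settled, and {τ > n} = {τ ≥ n +
-- 1}, to which the one-step inequality applies.
theorem stopped_partial_le
    (h : ∀ k : ℕ, ∫⁻ ω in {ω | (k : WithTop ℕ) < τ ω}, u k ω ∂P ≤
      C * P {ω | (k : WithTop ℕ) < τ ω} + ∫⁻ ω in {ω | (k : WithTop ℕ) < τ ω}, u (k + 1) ω ∂P)
    (n : ℕ) : ∫⁻ ω, u 0 ω ∂P ≤ ∑ k ∈ Finset.range n, (C * P {ω | (k : WithTop ℕ) < τ ω} +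
        ∫⁻ ω in {ω | τ ω = k}, u k ω ∂P) + ∫⁻ ω in {ω | (n : WithTop ℕ) ≤ τ ω}, u n ω ∂P := by
  induction n with
  | zero => simp
  | succ n ih =>
    refine ih.trans ?_
    rw [Finset.sum_range_succ, setLIntegral_le_eq_add hτ, ← setLIntegral_succ_le, add_assoc]
    refine add_le_add le_rfl ?_
    rw [add_comm (C * _), add_assoc]
    exact add_le_add le_rfl (h n)

include hτ in
-- The same telescoping with the inequality reversed. Here the remainder is nonnegative and can
-- simply be dropped in the limit.
theorem le_stopped_partial
    (h : ∀ k : ℕ, C * P {ω | (k : WithTop ℕ) < τ ω} +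
      ∫⁻ ω in {ω | (k : WithTop ℕ) < τ ω}, u (k + 1) ω ∂P ≤
        ∫⁻ ω in {ω | (k : WithTop ℕ) < τ ω}, u k ω ∂P)
    (n : ℕ) : ∑ k ∈ Finset.range n, (C * P {ω | (k : WithTop ℕ) < τ ω} +
        ∫⁻ ω in {ω | τ ω = k}, u k ω ∂P) + ∫⁻ ω in {ω | (n : WithTop ℕ) ≤ τ ω}, u n ω ∂P ≤
      ∫⁻ ω, u 0 ω ∂P := by
  induction n with
  | zero => simp
  | succ n ih =>
    refine le_trans ?_ ih
    rw [Finset.sum_range_succ, setLIntegral_le_eq_add hτ n, ← setLIntegral_succ_le, add_assoc]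
    refine add_le_add le_rfl ?_
    rw [add_comm (C * _), add_assoc]
    exact add_le_add le_rfl (h n)

include hτ in
theorem tsum_stopped (hfin : ∀ᵐ ω ∂P, τ ω ≠ ⊤) :
    ∑' k : ℕ, (C * P {ω | (k : WithTop ℕ) < τ ω} + ∫⁻ ω in {ω | τ ω = k}, u k ω ∂P) =
      C * ∫⁻ ω, ENat.toENNReal (τ ω) ∂P + ∫⁻ ω, u ((τ ω).untopD 0) ω ∂P := by
  rw [ENNReal.tsum_add, ENNReal.tsum_mul_left,
    lintegral_toENNReal_eq_tsum (measurableSet_lt_of_eq hτ), lintegral_stopped_add_top hτ u hfin]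

include hτ in
theorem ae_ne_top_of_lintegral_ne_top (h : ∫⁻ ω, ENat.toENNReal (τ ω) ∂P ≠ ∞) :
    ∀ᵐ ω ∂P, τ ω ≠ ⊤ := by
  -- The codomain is countable, so measurable fibers make τ measurable even for the discrete
  -- σ-algebra.
  have hm : @Measurable _ _ _ ⊤ τ := @measurable_to_countable' _ _ ⊤ _ _ τ fun x => by
    cases x with
    | coe n => exact hτ n
    | top =>
      have : τ ⁻¹' {⊤} = (⋃ k : ℕ, {ω | τ ω = k})ᶜ := by
        ext ω; cases h : τ ω <;> simp [h]
      rw [this]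
      exact (MeasurableSet.iUnion hτ).compl
  have hm' : Measurable fun ω => ENat.toENNReal (τ ω) :=
    (measurable_from_top (f := fun x : WithTop ℕ => ENat.toENNReal x)).comp hm
  filter_upwards [ae_lt_top hm' h] with ω hω hω'
  rw [hω'] at hω
  exact absurd hω (by change ¬ ENat.toENNReal ⊤ < ⊤; simp)

include hτ in
/-- If `u` decreases on average by at most `C` per step before `τ`, then the initial value of `u`
is at most the expected cost of stopping at `τ`. -/
theorem lintegral_le_stopped [IsFiniteMeasure P] (hC : C ≠ 0) (hu : ∀ k, ∀ᵐ ω ∂P, u k ω ≤ 1)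
    (h : ∀ k : ℕ, ∫⁻ ω in {ω | (k : WithTop ℕ) < τ ω}, u k ω ∂P ≤
      C * P {ω | (k : WithTop ℕ) < τ ω} +
        ∫⁻ ω in {ω | (k : WithTop ℕ) < τ ω}, u (k + 1) ω ∂P) :
    ∫⁻ ω, u 0 ω ∂P ≤
      C * ∫⁻ ω, ENat.toENNReal (τ ω) ∂P + ∫⁻ ω, u ((τ ω).untopD 0) ω ∂P := by
  -- If E[τ] is infinite, so is the right-hand side, since C ≠ 0; otherwise τ is almost surely
  -- finite.
  by_cases htop : ∫⁻ ω, ENat.toENNReal (τ ω) ∂P = ∞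
  · simp [htop, ENNReal.mul_top hC]
  have hfin := ae_ne_top_of_lintegral_ne_top hτ htop
  rw [← tsum_stopped hτ hfin]
  -- As u ≤ 1, the telescoping remainder is at most P(τ ≥ n), which tends to P(τ = ⊤) = 0.
  have hlim : Tendsto (fun n : ℕ => P {ω | (n : WithTop ℕ) ≤ τ ω}) atTop (𝓝 0) := by
    have h0 : P (⋂ n : ℕ, {ω | (n : WithTop ℕ) ≤ τ ω}) = 0 := by
      refine measure_mono_null (fun ω hω => ?_) hfin
      simp only [mem_iInter, mem_ofPred_eq] at hω
      simp only [mem_compl_iff, mem_ofPred_eq, not_not]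
      cases h : τ ω with
      | top => rfl
      | coe n =>
        have := hω (n + 1)
        rw [h, Nat.cast_withTop, WithTop.coe_le_coe] at this
        exact absurd this (by simp)
    rw [← h0]
    refine tendsto_measure_iInter_atTop
      (fun n => (measurableSet_le_of_eq hτ n).nullMeasurableSet)
      (fun i j hij ω hω => ?_) ⟨0, measure_ne_top _ _⟩
    exact le_trans (by exact_mod_cast hij) (show (j : WithTop ℕ) ≤ τ ω from hω)
  have hbd : ∀ n : ℕ, ∫⁻ ω, u 0 ω ∂P ≤ ∑' k : ℕ, (C * P {ω | (k : WithTop ℕ) < τ ω} +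
      ∫⁻ ω in {ω | τ ω = k}, u k ω ∂P) + P {ω | (n : WithTop ℕ) ≤ τ ω} := fun n => by
    refine (stopped_partial_le hτ h n).trans (add_le_add (ENNReal.sum_le_tsum _) ?_)
    calc _ ≤ ∫⁻ ω in {ω | (n : WithTop ℕ) ≤ τ ω}, 1 ∂P :=
          lintegral_mono_ae (ae_restrict_of_ae (hu n))
      _ = _ := by simp
  have := ge_of_tendsto (tendsto_const_nhds.add hlim) (Eventually.of_forall hbd)
  simpa using this

include hτ in
/-- If `u` decreases on average by at least `C` per step before `τ`, then `τ` is almost surely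
finite and the expected cost of stopping at `τ` is at most the initial value of `u`. -/
theorem stopped_le_lintegral [IsProbabilityMeasure P] (hC : C ≠ 0) (hu : ∀ᵐ ω ∂P, u 0 ω ≤ 1)
    (h : ∀ k : ℕ, C * P {ω | (k : WithTop ℕ) < τ ω} +
      ∫⁻ ω in {ω | (k : WithTop ℕ) < τ ω}, u (k + 1) ω ∂P ≤
        ∫⁻ ω in {ω | (k : WithTop ℕ) < τ ω}, u k ω ∂P) :
    (∀ᵐ ω ∂P, τ ω ≠ ⊤) ∧ C * ∫⁻ ω, ENat.toENNReal (τ ω) ∂P +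
      ∫⁻ ω, u ((τ ω).untopD 0) ω ∂P ≤ ∫⁻ ω, u 0 ω ∂P := by
  have h1 : ∑' k : ℕ, (C * P {ω | (k : WithTop ℕ) < τ ω} +
      ∫⁻ ω in {ω | τ ω = k}, u k ω ∂P) ≤ ∫⁻ ω, u 0 ω ∂P :=
    ENNReal.tsum_le_of_sum_range_le fun n => le_self_add.trans (le_stopped_partial hτ h n)
  have h2 : ∫⁻ ω, u 0 ω ∂P ≤ 1 := (lintegral_mono_ae hu).trans (by simp)
  -- The accumulated costs are at most 1, so E[τ] = ∞ would contradict C ≠ 0.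
  have hfin : ∀ᵐ ω ∂P, τ ω ≠ ⊤ := by
    refine ae_ne_top_of_lintegral_ne_top hτ fun htop => ?_
    rw [lintegral_toENNReal_eq_tsum (measurableSet_lt_of_eq hτ)] at htop
    have h3 := h1.trans h2
    rw [ENNReal.tsum_add, ENNReal.tsum_mul_left, htop, ENNReal.mul_top hC] at h3
    simp at h3
  exact ⟨hfin, (tsum_stopped hτ hfin).symm.trans_le h1⟩

end Stopping

/-! ### Posterior weights and Bayes' rule -/

section Bayes

variable {Ω E Θ : Type*}

/-- On S the observation is independent of the history, so the joint law is a product measure, which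
is determined by rectangles. -/
theorem map_prodMk_restrict_eq_withDensity [MeasurableSpace Ω] [MeasurableSpace E]
    {P : Measure Ω} [IsFiniteMeasure P] {S : Set Ω} {h : Ω → E} {x : Ω → ℝ}
    (hh : Measurable h) (hx : Measurable x)
    {w : E → ℝ≥0∞} {g : ℝ → ℝ≥0∞} (hw : Measurable w) (hg : Measurable g)
    (hg1 : ∫⁻ z, g z = 1)
    (hpost : ∀ A, MeasurableSet A → P (h ⁻¹' A ∩ S) = ∫⁻ e in A, w e ∂(P.map h))
    (hfresh : ∀ A C, MeasurableSet A → MeasurableSet C →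
      P (h ⁻¹' A ∩ S ∩ x ⁻¹' C) = P (h ⁻¹' A ∩ S) * ∫⁻ z in C, g z) :
    (P.restrict S).map (fun ω => (h ω, x ω)) =
      ((P.map h).prod volume).withDensity fun z => w z.1 * g z.2 := by
  rw [← prod_withDensity hw hg]
  have h1 : IsFiniteMeasure ((P.map h).withDensity w) := by
    refine isFiniteMeasure_withDensity ?_
    rw [← setLIntegral_univ, ← hpost univ MeasurableSet.univ]
    exact measure_ne_top _ _
  have h2 : IsFiniteMeasure ((volume : Measure ℝ).withDensity g) :=
    isFiniteMeasure_withDensity (by simp [hg1])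
  symm
  refine Measure.prod_eq fun A C hA hC => ?_
  rw [Measure.map_apply (hh.prodMk hx) (hA.prod hC), Measure.restrict_apply
    ((hh.prodMk hx) (hA.prod hC)), withDensity_apply _ hA, withDensity_apply _ hC,
    ← hpost A hA, ← hfresh A C hA hC]
  congr 1
  ext ω
  simp only [mem_inter_iff, mem_preimage, mem_prod]
  tauto

variable [Fintype Θ] [MeasurableSpace Θ] [MeasurableSingletonClass Θ]

/-- The law of total probability, over the finitely many values of θ. -/
theorem map_eq_withDensity_sum [MeasurableSpace Ω] [MeasurableSpace E] {P : Measure Ω}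
    {θ : Ω → Θ} {h : Ω → E} (hθ : Measurable θ) (hh : Measurable h) {μ : Measure E}
    {d : Θ → E → ℝ≥0∞} (hd : ∀ a, Measurable (d a))
    (H : ∀ a, (P.restrict (θ ⁻¹' {a})).map h = μ.withDensity (d a)) :
    P.map h = μ.withDensity fun e => ∑ a, d a e := by
  ext A hA
  rw [Measure.map_apply hh hA, withDensity_apply _ hA, lintegral_finsetSum _ fun a _ => hd a]
  have h1 : ∀ a, ∫⁻ e in A, d a e ∂μ = P (h ⁻¹' A ∩ θ ⁻¹' {a}) := fun a => by
    rw [← withDensity_apply _ hA, ← H a, Measure.map_apply hh hA,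
      Measure.restrict_apply (hh hA)]
  simp_rw [h1]
  rw [← measure_biUnion_finset]
  · congr 1
    ext ω
    simp
  · intro a _ b _ hab
    refine disjoint_left.2 fun ω h1 h2 => hab ?_
    exact (show θ ω = a from h1.2).symm.trans h2.2
  · exact fun a _ => (hh hA).inter (hθ (measurableSet_singleton a))

/-- `w` gives the conditional probabilities of the values of `θ` given `m`. -/
def IsPosterior (m : MeasurableSpace Ω) [MeasurableSpace Ω] (P : Measure Ω) (θ : Ω → Θ)
    (w : Ω → Θ → ℝ≥0∞) : Prop :=
  ∀ A, MeasurableSet[m] A → ∀ a, P (A ∩ θ ⁻¹' {a}) = ∫⁻ ω in A, w ω a ∂P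

/-- Given `m` and `θ`, the observation `x` has the density `g (θ ω)`. -/
def HasCondDensity (m : MeasurableSpace Ω) [MeasurableSpace Ω] (P : Measure Ω) (θ : Ω → Θ)
    (x : Ω → ℝ) (g : Θ → ℝ → ℝ≥0∞) : Prop :=
  ∀ A C, MeasurableSet[m] A → MeasurableSet C → ∀ a,
    P (A ∩ θ ⁻¹' {a} ∩ x ⁻¹' C) = P (A ∩ θ ⁻¹' {a}) * ∫⁻ z in C, g a z

/-- With m on the first factor, every event of m ⊔ σ(x) becomes the preimage of a measurable set in
a product space. Joint laws thus apply to it directly, without a monotone-class argument. -/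
theorem comap_prodMk_id (m : MeasurableSpace Ω) (x : Ω → ℝ) :
    m ⊔ MeasurableSpace.comap x inferInstance =
      MeasurableSpace.comap (fun ω => (ω, x ω)) (m.prod inferInstance) := by
  rw [MeasurableSpace.prod, MeasurableSpace.comap_sup, MeasurableSpace.comap_comp,
    MeasurableSpace.comap_comp]
  congr 1
  exact MeasurableSpace.comap_id.symm

/-- `W q` is the vector of posterior weights in the state `q` of the filter `B`, when the
observations have the densities `g`. -/
structure BayesFilter.Tracks {X : Type*} [MeasurableSpace X] (B : BayesFilter X)
    (W : X → Θ → ℝ≥0∞) (g : Θ → ℝ → ℝ≥0∞) : Prop where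
  measurable_weight : ∀ a, Measurable fun q => W q a
  measurable_g : ∀ a, Measurable (g a)
  lintegral_g : ∀ a, ∫⁻ z, g a z = 1
  sum_eq : ∀ q ∈ B.dom, ∀ z, ∑ a, W q a * g a z = ENNReal.ofReal (B.density q z)
  bayes : ∀ q ∈ B.dom, ∀ z a,
    W (B.update q z) a * ENNReal.ofReal (B.density q z) = W q a * g a z

variable {X : Type*} [MeasurableSpace X] {B : BayesFilter X} {W : X → Θ → ℝ≥0∞}
  {g : Θ → ℝ → ℝ≥0∞}

/-- On {θ = a} the joint law has density W·g; summing over a gives the predictive density. The Bayes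
identity rewrites W·g as updated weight times predictive density, so relative to the joint law the
event {θ = a} has the updated weight as its density. States of zero predictive density need no
separate treatment. -/
theorem BayesFilter.Tracks.map_prodMk [MeasurableSpace Ω] [MeasurableSpace E] (T : B.Tracks W g)
    {P : Measure Ω} [IsFiniteMeasure P] {θ : Ω → Θ} (hθ : Measurable θ) {h : Ω → E} {x : Ω → ℝ}
    (hh : Measurable h) (hx : Measurable x) {q : E → X} (hq : Measurable q)
    (hdom : ∀ e, q e ∈ B.dom)
    (hpost : ∀ A, MeasurableSet A → ∀ a,
      P (h ⁻¹' A ∩ θ ⁻¹' {a}) = ∫⁻ ω in h ⁻¹' A, W (q (h ω)) a ∂P)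
    (hfresh : ∀ A C, MeasurableSet A → MeasurableSet C → ∀ a,
      P (h ⁻¹' A ∩ θ ⁻¹' {a} ∩ x ⁻¹' C) = P (h ⁻¹' A ∩ θ ⁻¹' {a}) * ∫⁻ z in C, g a z) :
    (P.map fun ω => (h ω, x ω)) = ((P.map h).prod volume).withDensity
        (fun z => ENNReal.ofReal (B.density (q z.1) z.2)) ∧
      ∀ a, (P.restrict (θ ⁻¹' {a})).map (fun ω => (h ω, x ω)) =
        (P.map fun ω => (h ω, x ω)).withDensity fun z => W (B.update (q z.1) z.2) a := by
  have h1 : ∀ a, (P.restrict (θ ⁻¹' {a})).map (fun ω => (h ω, x ω)) =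
      ((P.map h).prod volume).withDensity fun z => W (q z.1) a * g a z.2 := fun a => by
    have hwq : Measurable fun e => W (q e) a := (T.measurable_weight a).comp hq
    have h0 : ∀ A, MeasurableSet A →
        P (h ⁻¹' A ∩ θ ⁻¹' {a}) = ∫⁻ e in A, W (q e) a ∂(P.map h) := fun A hA => by
      rw [hpost A hA a, setLIntegral_map hA hwq hh]
    exact map_prodMk_restrict_eq_withDensity (S := θ ⁻¹' {a}) (w := fun e => W (q e) a) hh hx hwq
      (T.measurable_g a) (T.lintegral_g a) h0 fun A C hA hC => hfresh A C hA hC a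
  have hw1 : ∀ a, Measurable fun z : E × ℝ => W (q z.1) a * g a z.2 := fun a =>
    ((T.measurable_weight a).comp (hq.comp measurable_fst)).mul
      ((T.measurable_g a).comp measurable_snd)
  have h2 := map_eq_withDensity_sum hθ (hh.prodMk hx) hw1 h1
  have h3 : (P.map fun ω => (h ω, x ω)) = ((P.map h).prod volume).withDensity
      (fun z => ENNReal.ofReal (B.density (q z.1) z.2)) := by
    rw [h2]
    congr 1
    funext z
    exact T.sum_eq _ (hdom _) _
  have hm : Measurable fun z : E × ℝ => (q z.1, z.2) :=
    (hq.comp measurable_fst).prodMk measurable_snd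
  refine ⟨h3, fun a => ?_⟩
  have hd : Measurable fun z : E × ℝ => ENNReal.ofReal (B.density (q z.1) z.2) :=
    (B.measurable_density.comp hm).ennreal_ofReal
  have hu : Measurable fun z : E × ℝ => W (B.update (q z.1) z.2) a :=
    (T.measurable_weight a).comp (B.measurable_update.comp hm)
  rw [h1, h3, ← withDensity_mul _ hd hu]
  congr 1
  funext z
  rw [← T.bayes _ (hdom _), mul_comm]
  rfl

/-- Fubini for the joint law. The history takes values in an arbitrary space `E`, so that it may
later be Ω with a smaller σ-algebra. -/
theorem BayesFilter.Tracks.setLIntegral_update' [MeasurableSpace Ω] [MeasurableSpace E]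
    (T : B.Tracks W g)
    {P : Measure Ω} [IsFiniteMeasure P] {θ : Ω → Θ} (hθ : Measurable θ) {h : Ω → E} {x : Ω → ℝ}
    (hh : Measurable h) (hx : Measurable x) {q : E → X} (hq : Measurable q)
    (hdom : ∀ e, q e ∈ B.dom)
    (hpost : ∀ A, MeasurableSet A → ∀ a,
      P (h ⁻¹' A ∩ θ ⁻¹' {a}) = ∫⁻ ω in h ⁻¹' A, W (q (h ω)) a ∂P)
    (hfresh : ∀ A C, MeasurableSet A → MeasurableSet C → ∀ a,
      P (h ⁻¹' A ∩ θ ⁻¹' {a} ∩ x ⁻¹' C) = P (h ⁻¹' A ∩ θ ⁻¹' {a}) * ∫⁻ z in C, g a z)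
    {f : X → ℝ≥0∞} (hf : Measurable f) {A : Set E} (hA : MeasurableSet A) :
    ∫⁻ ω in h ⁻¹' A, f (B.update (q (h ω)) (x ω)) ∂P =
      ∫⁻ ω in h ⁻¹' A, (∫⁻ z, f (B.update (q (h ω)) z) *
        ENNReal.ofReal (B.density (q (h ω)) z)) ∂P := by
  have h1 := (T.map_prodMk hθ hh hx hq hdom hpost hfresh).1
  have hqz : Measurable fun z : E × ℝ => (q z.1, z.2) :=
    (hq.comp measurable_fst).prodMk measurable_snd
  have hd : Measurable fun z : E × ℝ => ENNReal.ofReal (B.density (q z.1) z.2) :=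
    (B.measurable_density.comp hqz).ennreal_ofReal
  have hF : Measurable fun z : E × ℝ => f (B.update (q z.1) z.2) :=
    hf.comp (B.measurable_update.comp hqz)
  have h2 : ∫⁻ ω in h ⁻¹' A, f (B.update (q (h ω)) (x ω)) ∂P =
      ∫⁻ z in A ×ˢ univ, f (B.update (q z.1) z.2) ∂(P.map fun ω => (h ω, x ω)) := by
    rw [setLIntegral_map (hA.prod MeasurableSet.univ) hF (hh.prodMk hx)]
    congr 2
    ext ω
    simp
  rw [h2, h1, setLIntegral_withDensity_eq_setLIntegral_mul _ hd hF (hA.prod MeasurableSet.univ),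
    ← Measure.prod_restrict, Measure.restrict_univ, lintegral_prod _ (hd.mul hF).aemeasurable,
    setLIntegral_map hA (hd.mul hF).lintegral_prod_right' hh]
  refine lintegral_congr fun ω => lintegral_congr fun z => ?_
  rw [Pi.mul_apply, mul_comm]

theorem BayesFilter.Tracks.measure_inter_eq_setLIntegral [MeasurableSpace Ω] [MeasurableSpace E]
    (T : B.Tracks W g)
    {P : Measure Ω} [IsFiniteMeasure P] {θ : Ω → Θ} (hθ : Measurable θ) {h : Ω → E} {x : Ω → ℝ}
    (hh : Measurable h) (hx : Measurable x) {q : E → X} (hq : Measurable q)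
    (hdom : ∀ e, q e ∈ B.dom)
    (hpost : ∀ A, MeasurableSet A → ∀ a,
      P (h ⁻¹' A ∩ θ ⁻¹' {a}) = ∫⁻ ω in h ⁻¹' A, W (q (h ω)) a ∂P)
    (hfresh : ∀ A C, MeasurableSet A → MeasurableSet C → ∀ a,
      P (h ⁻¹' A ∩ θ ⁻¹' {a} ∩ x ⁻¹' C) = P (h ⁻¹' A ∩ θ ⁻¹' {a}) * ∫⁻ z in C, g a z)
    {A : Set (E × ℝ)} (hA : MeasurableSet A) (a : Θ) :
    P ((fun ω => (h ω, x ω)) ⁻¹' A ∩ θ ⁻¹' {a}) =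
      ∫⁻ ω in (fun ω => (h ω, x ω)) ⁻¹' A, W (B.update (q (h ω)) (x ω)) a ∂P := by
  have h1 := (T.map_prodMk hθ hh hx hq hdom hpost hfresh).2 a
  have hu : Measurable fun z : E × ℝ => W (B.update (q z.1) z.2) a :=
    (T.measurable_weight a).comp (B.measurable_update.comp
      ((hq.comp measurable_fst).prodMk measurable_snd))
  rw [← Measure.restrict_apply ((hh.prodMk hx) hA), ← Measure.map_apply (hh.prodMk hx) hA, h1,
    withDensity_apply _ hA, setLIntegral_map hA hu (hh.prodMk hx)]

variable {m mΩ : MeasurableSpace Ω} {P : Measure Ω} [IsFiniteMeasure P]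
  {θ : Ω → Θ} {x : Ω → ℝ} {q : Ω → X}

/-- The distribution of the next state of the filter. -/
theorem BayesFilter.Tracks.setLIntegral_update (T : B.Tracks W g) (hm : m ≤ mΩ)
    (hθ : Measurable θ) (hx : Measurable x) (hq : Measurable[m] q) (hdom : ∀ ω, q ω ∈ B.dom)
    (hpost : IsPosterior m P θ fun ω => W (q ω)) (hfresh : HasCondDensity m P θ x g)
    {f : X → ℝ≥0∞} (hf : Measurable f) {A : Set Ω} (hA : MeasurableSet[m] A) :
    ∫⁻ ω in A, f (B.update (q ω) (x ω)) ∂P =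
      ∫⁻ ω in A, (∫⁻ z, f (B.update (q ω) z) * ENNReal.ofReal (B.density (q ω) z)) ∂P :=
  -- The history is the identity map into Ω equipped with m, so its preimages are exactly the events
  -- of m.
  @BayesFilter.Tracks.setLIntegral_update' Ω Ω Θ _ _ _ X _ B W g mΩ m T P _ θ hθ id x
    (measurable_id'' hm) hx q hq hdom hpost hfresh f hf A hA

/-- Bayes' rule. -/
theorem BayesFilter.Tracks.isPosterior_update (T : B.Tracks W g) (hm : m ≤ mΩ)
    (hθ : Measurable θ) (hx : Measurable x) (hq : Measurable[m] q) (hdom : ∀ ω, q ω ∈ B.dom)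
    (hpost : IsPosterior m P θ fun ω => W (q ω)) (hfresh : HasCondDensity m P θ x g) :
    IsPosterior (m ⊔ MeasurableSpace.comap x inferInstance) P θ
      fun ω => W (B.update (q ω) (x ω)) := by
  intro A hA a
  rw [comap_prodMk_id] at hA
  obtain ⟨A, hA, rfl⟩ := hA
  exact @BayesFilter.Tracks.measure_inter_eq_setLIntegral Ω Ω Θ _ _ _ X _ B W g mΩ m T P _ θ hθ id x
    (measurable_id'' hm) hx q hq hdom hpost hfresh A hA a

end Bayes

/-! ### Verification of the optimality equation -/

namespace BayesFilter

variable {X : Type*} [MeasurableSpace X] {B : BayesFilter X} {v : X → ℝ} {s : X → X} {c : ℝ}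
  {Ω : Type*} {mΩ : MeasurableSpace Ω} {P : Measure Ω} [IsProbabilityMeasure P]
  {𝓕 : Filtration ℕ mΩ} {st q : ℕ → Ω → X} {τ : Ω → WithTop ℕ}

/-- `st` is a Markov process controlled by `q`: it moves from the state `q k` at time `k` to the
state `st (k + 1)` according to the filter `B`. -/
def IsControlled (B : BayesFilter X) (P : Measure Ω) (𝓕 : Filtration ℕ mΩ) (st q : ℕ → Ω → X) :
    Prop :=
  ∀ k (f : X → ℝ≥0∞), Measurable f → ∀ A, MeasurableSet[𝓕 k] A →
    ∫⁻ ω in A, f (st (k + 1) ω) ∂P =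
      ∫⁻ ω in A, (∫⁻ z, f (B.update (q k ω) z) * ENNReal.ofReal (B.density (q k ω) z)) ∂P

omit [IsProbabilityMeasure P] in
theorem IsControlled.setLIntegral_succ (h : B.IsControlled P 𝓕 st q)
    (hq : ∀ k ω, q k ω ∈ B.dom) {w : X → ℝ} (hw : Measurable w)
    (hw01 : ∀ x ∈ B.dom, w x ∈ Icc (0 : ℝ) 1) (k : ℕ) {A : Set Ω} (hA : MeasurableSet[𝓕 k] A) :
    ∫⁻ ω in A, ENNReal.ofReal (w (st (k + 1) ω)) ∂P =
      ∫⁻ ω in A, ENNReal.ofReal (B.expect w (q k ω)) ∂P := by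
  rw [h k _ hw.ennreal_ofReal A hA]
  exact lintegral_congr fun ω => (ofReal_expect hw hw01 (hq k ω)).symm

section

variable (hv : Measurable v) (hs : Measurable s) (hc : 0 < c)
  (hv01 : ∀ x ∈ B.dom, v x ∈ Icc (0 : ℝ) 1) (hsd : ∀ x ∈ B.dom, s x ∈ B.dom)
  (h : B.IsControlled P 𝓕 st q) (hst : ∀ k ω, st k ω ∈ B.dom) (hq : ∀ k ω, q k ω ∈ B.dom)
  (hτ : IsStoppingTime 𝓕 τ)

include hv hs hc hv01 hsd h hst hq hτ

/-- No strategy beats the value function. -/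
theorem IsControlled.value_le_stopped (hqs : ∀ k ω, q k ω = st k ω ∨ q k ω = s (st k ω)) :
    ∫⁻ ω, ENNReal.ofReal (B.value v s c (st 0 ω)) ∂P ≤
      ENNReal.ofReal c * ∫⁻ ω, ENat.toENNReal (τ ω) ∂P +
        ∫⁻ ω, ENNReal.ofReal (v (st ((τ ω).untopD 0) ω)) ∂P := by
  have hV := measurable_value (B := B) (c := c) hv hs
  have hV01 : ∀ x ∈ B.dom, B.value v s c x ∈ Icc (0 : ℝ) 1 := fun x hx =>
    value_mem hv hs hc.le hv01 hsd hx
  refine (lintegral_le_stopped (fun k => 𝓕.le k _ (hτ.measurableSet_eq k))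
    (C := ENNReal.ofReal c) (u := fun k ω => ENNReal.ofReal (B.value v s c (st k ω)))
    (by simpa using hc)
    (fun k => ae_of_all _ fun ω => ENNReal.ofReal_le_one.2 (hV01 _ (hst k ω)).2)
    fun k => ?_).trans ?_
  · have hA : MeasurableSet[𝓕 k] {ω | (k : WithTop ℕ) < τ ω} := hτ.measurableSet_gt k
    rw [h.setLIntegral_succ hq hV hV01 k hA, ← setLIntegral_const,
      ← lintegral_add_left measurable_const]
    refine lintegral_mono fun ω => ?_
    dsimp only
    rw [← ENNReal.ofReal_add hc.le (expect_nonneg (fun x hx => (hV01 x hx).1) (hq k ω))]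
    refine ENNReal.ofReal_le_ofReal ?_
    rw [value_eq hv hs hc.le hv01 hsd (hst k ω)]
    refine (min_le_right _ _).trans (add_le_add le_rfl ?_)
    rcases hqs k ω with h1 | h1 <;> rw [h1]
    exacts [min_le_left _ _, min_le_right _ _]
  · refine add_le_add le_rfl (lintegral_mono fun ω => ENNReal.ofReal_le_ofReal ?_)
    rw [value_eq hv hs hc.le hv01 hsd (hst _ ω)]
    exact min_le_left _ _

/-- A strategy that follows the optimality equation attains the value function. -/
theorem IsControlled.stopped_le_value
    (hlt : ∀ᵐ ω ∂P, ∀ k : ℕ, (k : WithTop ℕ) < τ ω →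
      B.value v s c (st k ω) = c + B.expect (B.value v s c) (q k ω))
    (heq : ∀ᵐ ω ∂P, ∀ k : ℕ, τ ω = k → v (st k ω) = B.value v s c (st k ω)) :
    (∀ᵐ ω ∂P, τ ω ≠ ⊤) ∧ ENNReal.ofReal c * ∫⁻ ω, ENat.toENNReal (τ ω) ∂P +
        ∫⁻ ω, ENNReal.ofReal (v (st ((τ ω).untopD 0) ω)) ∂P ≤
      ∫⁻ ω, ENNReal.ofReal (B.value v s c (st 0 ω)) ∂P := by
  have hV := measurable_value (B := B) (c := c) hv hs
  have hV01 : ∀ x ∈ B.dom, B.value v s c x ∈ Icc (0 : ℝ) 1 := fun x hx =>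
    value_mem hv hs hc.le hv01 hsd hx
  obtain ⟨hfin, hle⟩ := stopped_le_lintegral (P := P)
    (fun k => 𝓕.le k _ (hτ.measurableSet_eq k))
    (C := ENNReal.ofReal c) (u := fun k ω => ENNReal.ofReal (B.value v s c (st k ω)))
    (by simpa using hc)
    (ae_of_all _ fun ω => ENNReal.ofReal_le_one.2 (hV01 _ (hst 0 ω)).2) (fun k => by
      have hA : MeasurableSet[𝓕 k] {ω | (k : WithTop ℕ) < τ ω} := hτ.measurableSet_gt k
      rw [h.setLIntegral_succ hq hV hV01 k hA, ← setLIntegral_const,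
        ← lintegral_add_left measurable_const]
      refine setLIntegral_mono_ae' (𝓕.le k _ hA) ?_
      filter_upwards [hlt] with ω hω hk
      rw [← ENNReal.ofReal_add hc.le (expect_nonneg (fun x hx => (hV01 x hx).1) (hq k ω)),
        hω k hk])
  refine ⟨hfin, le_trans (add_le_add le_rfl (lintegral_mono_ae ?_)) hle⟩
  filter_upwards [hfin, heq] with ω h1 h2
  obtain ⟨n, hn⟩ := WithTop.ne_top_iff_exists.1 h1
  rw [h2 ((τ ω).untopD 0) (by rw [← hn]; rfl)]

end

end BayesFilter

/-! ### The scanning and refinement filters -/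

namespace ProbDensity

variable (d e : ProbDensity)

theorem conv_nonneg (x : ℝ) : 0 ≤ d.conv e x :=
  integral_nonneg fun t => mul_nonneg (d.nonneg t) (e.nonneg (x - t))

theorem measurable_conv : Measurable (d.conv e) := by
  have h : Measurable (Function.uncurry fun x t : ℝ => d.f t * e.f (x - t)) :=
    (d.measurable.comp measurable_snd).mul
      (e.measurable.comp (measurable_fst.sub measurable_snd))
  exact h.stronglyMeasurable.integral_prod_right.measurable

/-- The density of the sum of two independent samples is the convolution. -/
theorem law_conv_law : d.law.conv e.law =
    volume.withDensity fun x => ENNReal.ofReal (d.conv e x) := by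
  have hd := d.measurable.ennreal_ofReal
  have he := e.measurable.ennreal_ofReal
  have h1 : d.law.conv e.law = _ := conv_withDensity_eq_lconvolution hd he
  have hm := measurable_lconvolution (volume : Measure ℝ) hd he
  have hfin : ∫⁻ x, lconvolution (fun x => ENNReal.ofReal (d.f x))
      (fun x => ENNReal.ofReal (e.f x)) volume x ≠ ∞ := by
    rw [← setLIntegral_univ, ← withDensity_apply _ MeasurableSet.univ, ← h1]
    exact measure_ne_top _ _
  rw [h1]
  refine withDensity_congr_ae ?_
  -- The Bochner convolution agrees with the Lebesgue one wherever the latter is finite. This is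
  -- almost everywhere, because its total mass is finite.
  filter_upwards [ae_lt_top hm hfin] with x hx
  have h2 : d.conv e x = (lconvolution (fun x => ENNReal.ofReal (d.f x))
      (fun x => ENNReal.ofReal (e.f x)) volume x).toReal := by
    change ∫ t, d.f t * e.f (x - t) = _
    rw [integral_eq_lintegral_of_nonneg_ae
      (ae_of_all _ fun t => mul_nonneg (d.nonneg t) (e.nonneg (x - t)))
      (d.measurable.mul (e.measurable.comp
        (measurable_const.sub measurable_id))).aestronglyMeasurable]
    congr 1
    refine lintegral_congr fun t => ?_
    rw [ENNReal.ofReal_mul (d.nonneg t), neg_add_eq_sub]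
  rw [h2, ENNReal.ofReal_toReal hx.ne]

theorem lintegral_conv : ∫⁻ x, ENNReal.ofReal (d.conv e x) = 1 := by
  rw [← setLIntegral_univ, ← withDensity_apply _ MeasurableSet.univ, ← law_conv_law]
  exact measure_univ

end ProbDensity

section Filters

variable (f₀ f₁ : ProbDensity)

/-- The density of the samples of a sequence, depending on the hypothesis. -/
def hypDensity (a : Bool) : ProbDensity := if a then f₁ else f₀

/-- The posterior weights of the hypotheses of a pair in the scanning state `p`. -/
def scanWeight (p : ℝ × ℝ) : Bool × Bool → ℝ≥0∞
  | (true, true) => ENNReal.ofReal p.1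
  | (true, false) => ENNReal.ofReal (p.2 / 2)
  | (false, true) => ENNReal.ofReal (p.2 / 2)
  | (false, false) => ENNReal.ofReal (1 - p.1 - p.2)

/-- The density of the mixed observations, depending on the hypotheses of the pair. -/
def mixedDensity : Bool × Bool → ℝ → ℝ
  | (true, true) => f₁.conv f₁
  | (true, false) => f₀.conv f₁
  | (false, true) => f₀.conv f₁
  | (false, false) => f₀.conv f₀

theorem setLIntegral_mixedDensity (a : Bool × Bool) {C : Set ℝ} (hC : MeasurableSet C) :
    ∫⁻ z in C, ENNReal.ofReal (mixedDensity f₀ f₁ a z) =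
      ((hypDensity f₀ f₁ a.1).law.conv (hypDensity f₀ f₁ a.2).law) C := by
  rcases a with ⟨_ | _, _ | _⟩ <;> simp only [hypDensity, mixedDensity, Bool.false_eq_true,
    if_true, if_false]
  · rw [ProbDensity.law_conv_law, withDensity_apply _ hC]
  · rw [ProbDensity.law_conv_law, withDensity_apply _ hC]
  -- Case (true, false): the laws come in the order f₁, f₀, but the density is written f₀ * f₁.
  · rw [Measure.conv_comm, ProbDensity.law_conv_law, withDensity_apply _ hC]
  · rw [ProbDensity.law_conv_law, withDensity_apply _ hC]

theorem scanDensity_nonneg {p : ℝ × ℝ} (hp : p ∈ scanDomain) (z : ℝ) :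
    0 ≤ scanDensity f₀ f₁ p z := by
  obtain ⟨h1, -, h2, -, -, h3⟩ := hp
  exact add_nonneg (add_nonneg (mul_nonneg (by linarith) (ProbDensity.conv_nonneg _ _ _))
    (mul_nonneg h2 (ProbDensity.conv_nonneg _ _ _))) (mul_nonneg h1 (ProbDensity.conv_nonneg _ _ _))

theorem mem_scanDomain_iff {p : ℝ × ℝ} :
    p ∈ scanDomain ↔ 0 ≤ p.1 ∧ 0 ≤ p.2 ∧ p.1 + p.2 ≤ 1 := by
  constructor
  · rintro ⟨h1, -, h2, -, -, h3⟩
    exact ⟨h1, h2, h3⟩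
  · rintro ⟨h1, h2, h3⟩
    exact ⟨h1, by linarith, h2, by linarith, by linarith, h3⟩

/-- Each numerator is a summand of the denominator. If the denominator vanishes, division by zero
yields the state (0, 0), which also lies in the domain. -/
theorem scanUpdate_mem {p : ℝ × ℝ} (hp : p ∈ scanDomain) (z : ℝ) :
    scanUpdate f₀ f₁ p z ∈ scanDomain := by
  have hd := scanDensity_nonneg f₀ f₁ hp z
  obtain ⟨h1, h2, h3⟩ := mem_scanDomain_iff.1 hp
  have g0 := f₀.conv_nonneg f₀ z
  have g1 := f₀.conv_nonneg f₁ z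
  have g2 := f₁.conv_nonneg f₁ z
  refine mem_scanDomain_iff.2 ⟨div_nonneg (mul_nonneg h1 g2) hd,
    div_nonneg (mul_nonneg h2 g1) hd, ?_⟩
  simp only [scanUpdate]
  rw [← add_div]
  refine div_le_one_of_le₀ ?_ hd
  rw [scanDensity]
  nlinarith [mul_nonneg (show 0 ≤ 1 - p.1 - p.2 by linarith) g0]

theorem measurable_scanDensity :
    Measurable (Function.uncurry (scanDensity f₀ f₁)) := by
  have h0 := f₀.measurable_conv f₀
  have h1 := f₀.measurable_conv f₁
  have h2 := f₁.measurable_conv f₁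
  unfold Function.uncurry scanDensity
  fun_prop

theorem measurable_scanUpdate :
    Measurable (Function.uncurry (scanUpdate f₀ f₁)) := by
  have h0 : Measurable fun a : (ℝ × ℝ) × ℝ => scanDensity f₀ f₁ a.1 a.2 :=
    measurable_scanDensity f₀ f₁
  have h1 := f₀.measurable_conv f₁
  have h2 := f₁.measurable_conv f₁
  unfold Function.uncurry scanUpdate
  fun_prop

theorem ofReal_scanDensity {p : ℝ × ℝ} (hp : p ∈ scanDomain) (z : ℝ) :
    ENNReal.ofReal (scanDensity f₀ f₁ p z) =
      ∑ a, scanWeight p a * ENNReal.ofReal (mixedDensity f₀ f₁ a z) := by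
  obtain ⟨h1, h2, h3⟩ := mem_scanDomain_iff.1 hp
  have h4 : 0 ≤ 1 - p.1 - p.2 := by linarith
  have g0 := f₀.conv_nonneg f₀ z
  have g1 := f₀.conv_nonneg f₁ z
  have g2 := f₁.conv_nonneg f₁ z
  simp only [Fintype.sum_prod_type, Fintype.sum_bool, scanWeight, mixedDensity]
  rw [← ENNReal.ofReal_mul h1, ← ENNReal.ofReal_mul (by linarith), ← ENNReal.ofReal_mul h4,
    ← ENNReal.ofReal_add (by positivity) (by positivity),
    ← ENNReal.ofReal_add (by positivity) (by positivity),
    ← ENNReal.ofReal_add (by positivity) (by positivity)]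
  congr 1
  rw [scanDensity]
  ring

/-- The filter of the scanning stage. -/
def scanFilter : BayesFilter (ℝ × ℝ) where
  dom := scanDomain
  density := scanDensity f₀ f₁
  update := scanUpdate f₀ f₁
  measurable_density := measurable_scanDensity f₀ f₁
  measurable_update := measurable_scanUpdate f₀ f₁
  density_nonneg _ hp := scanDensity_nonneg f₀ f₁ hp
  lintegral_density p hp := by
    obtain ⟨h1, h2, h3⟩ := mem_scanDomain_iff.1 hp
    simp_rw [ofReal_scanDensity f₀ f₁ hp, Fintype.sum_prod_type, Fintype.sum_bool, scanWeight,
      mixedDensity]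
    have h0 := (f₀.measurable_conv f₀).ennreal_ofReal
    have h1 := (f₀.measurable_conv f₁).ennreal_ofReal
    have h2 := (f₁.measurable_conv f₁).ennreal_ofReal
    rw [lintegral_add_left (by fun_prop), lintegral_add_left (by fun_prop),
      lintegral_add_left (by fun_prop), lintegral_const_mul _ h0, lintegral_const_mul _ h1,
      lintegral_const_mul _ h2]
    simp only [ProbDensity.lintegral_conv, mul_one]
    rw [← ENNReal.ofReal_add (by linarith) (by linarith),
      ← ENNReal.ofReal_add (by linarith) (by linarith),
      ← ENNReal.ofReal_add (by linarith) (by linarith), ← ENNReal.ofReal_one]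
    congr 1
    ring
  update_mem _ hp := scanUpdate_mem f₀ f₁ hp

theorem scanFilter_tracks : (scanFilter f₀ f₁).Tracks scanWeight
    (fun a z => ENNReal.ofReal (mixedDensity f₀ f₁ a z)) where
  measurable_weight a := by
    rcases a with ⟨_ | _, _ | _⟩ <;> simp only [scanWeight] <;> fun_prop
  measurable_g a := by
    rcases a with ⟨_ | _, _ | _⟩ <;> exact (ProbDensity.measurable_conv _ _).ennreal_ofReal
  lintegral_g a := by
    rcases a with ⟨_ | _, _ | _⟩ <;> exact ProbDensity.lintegral_conv _ _
  sum_eq p hp z := (ofReal_scanDensity f₀ f₁ hp z).symm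
  bayes p hp z a := by
    change scanWeight (scanUpdate f₀ f₁ p z) a * ENNReal.ofReal (scanDensity f₀ f₁ p z) = _
    have hd := scanDensity_nonneg f₀ f₁ hp z
    -- A vanishing predictive density is a vanishing sum of nonnegative terms, so every weight times
    -- density is zero and Bayes' identity reads 0 = 0.
    by_cases h0 : scanDensity f₀ f₁ p z = 0
    · have h1 := ofReal_scanDensity f₀ f₁ hp z
      rw [h0, ENNReal.ofReal_zero, eq_comm, Finset.sum_eq_zero_iff] at h1
      rw [h0, ENNReal.ofReal_zero, mul_zero, h1 a (Finset.mem_univ a)]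
    · obtain ⟨h1, h2, h3⟩ := mem_scanDomain_iff.1 hp
      rcases a with ⟨_ | _, _ | _⟩ <;> simp only [scanWeight, mixedDensity] <;>
        rw [← ENNReal.ofReal_mul' hd, ← ENNReal.ofReal_mul (by linarith)] <;> congr 1 <;>
        simp only [scanUpdate] <;> field_simp
      -- Only (false, false) is left: its weight is a complement, so the full predictive density has
      -- to be expanded.
      rw [scanDensity]
      ring

/-! The refinement filter -/

/-- The posterior weights of the hypotheses of a pair in the refinement state `r`. -/
def refineWeight (r : ℝ × ℝ × ℝ) : Bool × Bool → ℝ≥0∞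
  | (true, true) => ENNReal.ofReal r.1
  | (true, false) => ENNReal.ofReal r.2.1
  | (false, true) => ENNReal.ofReal r.2.2
  | (false, false) => ENNReal.ofReal (1 - r.1 - r.2.1 - r.2.2)

/-- The domain of the refinement statistics. -/
def refineDomain : Set (ℝ × ℝ × ℝ) :=
  {r | 0 ≤ r.1 ∧ 0 ≤ r.2.1 ∧ 0 ≤ r.2.2 ∧ r.1 + r.2.1 + r.2.2 ≤ 1}

theorem refineDensity_nonneg {r : ℝ × ℝ × ℝ} (hr : r ∈ refineDomain) (x : ℝ) :
    0 ≤ refineDensity f₀ f₁ r x := by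
  obtain ⟨h1, h2, h3, h4⟩ := hr
  exact add_nonneg (mul_nonneg (f₁.nonneg x) (by linarith))
    (mul_nonneg (f₀.nonneg x) (by linarith))

theorem refineUpdate_mem {r : ℝ × ℝ × ℝ} (hr : r ∈ refineDomain) (x : ℝ) :
    refineUpdate f₀ f₁ r x ∈ refineDomain := by
  have hd := refineDensity_nonneg f₀ f₁ hr x
  obtain ⟨h1, h2, h3, h4⟩ := hr
  have g0 := f₀.nonneg x
  have g1 := f₁.nonneg x
  refine ⟨div_nonneg (mul_nonneg g1 h1) hd, div_nonneg (mul_nonneg g1 h2) hd,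
    div_nonneg (mul_nonneg g0 h3) hd, ?_⟩
  simp only [refineUpdate]
  rw [← add_div, ← add_div]
  refine div_le_one_of_le₀ ?_ hd
  rw [refineDensity]
  nlinarith [mul_nonneg (show 0 ≤ 1 - r.1 - r.2.1 - r.2.2 by linarith) g0]

theorem measurable_refineDensity : Measurable (Function.uncurry (refineDensity f₀ f₁)) := by
  have h0 := f₀.measurable
  have h1 := f₁.measurable
  unfold Function.uncurry refineDensity
  fun_prop

theorem measurable_refineUpdate : Measurable (Function.uncurry (refineUpdate f₀ f₁)) := by
  have h : Measurable fun a : (ℝ × ℝ × ℝ) × ℝ => refineDensity f₀ f₁ a.1 a.2 :=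
    measurable_refineDensity f₀ f₁
  have h0 := f₀.measurable
  have h1 := f₁.measurable
  unfold Function.uncurry refineUpdate
  fun_prop

theorem ofReal_refineDensity {r : ℝ × ℝ × ℝ} (hr : r ∈ refineDomain) (x : ℝ) :
    ENNReal.ofReal (refineDensity f₀ f₁ r x) =
      ∑ a, refineWeight r a * ENNReal.ofReal ((hypDensity f₀ f₁ a.1).f x) := by
  obtain ⟨h1, h2, h3, h4⟩ := hr
  have h5 : 0 ≤ 1 - r.1 - r.2.1 - r.2.2 := by linarith
  have g0 := f₀.nonneg x
  have g1 := f₁.nonneg x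
  simp only [Fintype.sum_prod_type, Fintype.sum_bool, refineWeight, hypDensity,
    Bool.false_eq_true, if_true, if_false]
  rw [← ENNReal.ofReal_mul h1, ← ENNReal.ofReal_mul h2, ← ENNReal.ofReal_mul h3,
    ← ENNReal.ofReal_mul h5,
    ← ENNReal.ofReal_add (by positivity) (by positivity),
    ← ENNReal.ofReal_add (by positivity) (by positivity),
    ← ENNReal.ofReal_add (by positivity) (by positivity)]
  congr 1
  rw [refineDensity]
  ring

/-- The filter of the refinement stage. -/
def refineFilter : BayesFilter (ℝ × ℝ × ℝ) where
  dom := refineDomain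
  density := refineDensity f₀ f₁
  update := refineUpdate f₀ f₁
  measurable_density := measurable_refineDensity f₀ f₁
  measurable_update := measurable_refineUpdate f₀ f₁
  density_nonneg _ hr := refineDensity_nonneg f₀ f₁ hr
  lintegral_density r hr := by
    have h0 := f₀.measurable.ennreal_ofReal
    have h1 := f₁.measurable.ennreal_ofReal
    simp_rw [ofReal_refineDensity f₀ f₁ hr, Fintype.sum_prod_type, Fintype.sum_bool,
      refineWeight, hypDensity, Bool.false_eq_true, if_true, if_false]
    obtain ⟨h1, h2, h3, h4⟩ := hr
    rw [lintegral_add_left (by fun_prop), lintegral_add_left (by fun_prop),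
      lintegral_add_left (by fun_prop)]
    simp only [lintegral_const_mul _ h0, lintegral_const_mul _ f₁.measurable.ennreal_ofReal,
      ProbDensity.lintegral_eq_one, mul_one]
    rw [← ENNReal.ofReal_add (by linarith) (by linarith),
      ← ENNReal.ofReal_add (by linarith) (by linarith),
      ← ENNReal.ofReal_add (by linarith) (by linarith), ← ENNReal.ofReal_one]
    congr 1
    ring
  update_mem _ hr := refineUpdate_mem f₀ f₁ hr

theorem refineFilter_tracks : (refineFilter f₀ f₁).Tracks refineWeight
    (fun a z => ENNReal.ofReal ((hypDensity f₀ f₁ a.1).f z)) where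
  measurable_weight a := by
    rcases a with ⟨_ | _, _ | _⟩ <;> simp only [refineWeight] <;> fun_prop
  measurable_g a := (ProbDensity.measurable _).ennreal_ofReal
  lintegral_g a := ProbDensity.lintegral_eq_one _
  sum_eq r hr x := (ofReal_refineDensity f₀ f₁ hr x).symm
  bayes r hr x a := by
    change refineWeight (refineUpdate f₀ f₁ r x) a * ENNReal.ofReal (refineDensity f₀ f₁ r x) = _
    have hd := refineDensity_nonneg f₀ f₁ hr x
    by_cases h0 : refineDensity f₀ f₁ r x = 0
    · have h1 := ofReal_refineDensity f₀ f₁ hr x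
      rw [h0, ENNReal.ofReal_zero, eq_comm, Finset.sum_eq_zero_iff] at h1
      rw [h0, ENNReal.ofReal_zero, mul_zero, h1 a (Finset.mem_univ a)]
    · obtain ⟨h1, h2, h3, h4⟩ := hr
      rcases a with ⟨_ | _, _ | _⟩ <;> simp only [refineWeight, hypDensity,
        Bool.false_eq_true, if_true, if_false] <;>
        rw [← ENNReal.ofReal_mul' hd, ← ENNReal.ofReal_mul (by linarith)] <;> congr 1 <;>
        simp only [refineUpdate] <;> field_simp
      rw [refineDensity]
      ring

variable (π₀ c : ℝ)

/-- Refinement offers no switch; with `s = id` the two options of the general recursion coincide. -/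
theorem refineValueUpTo_eq (n : ℕ) : refineValueUpTo f₀ f₁ c n =
    (refineFilter f₀ f₁).valueUpTo refineStopCost id c n := by
  induction n with
  | zero => rfl
  | succ n ih =>
    funext r
    simp only [refineValueUpTo, BayesFilter.valueUpTo, id, min_self, ih]
    rfl

theorem refineValue_eq : refineValue f₀ f₁ c =
    (refineFilter f₀ f₁).value refineStopCost id c := by
  funext r
  simp only [refineValue, BayesFilter.value, refineValueUpTo_eq]

theorem scanValueUpTo_eq (n : ℕ) : scanValueUpTo f₀ f₁ π₀ c n =
    (scanFilter f₀ f₁).valueUpTo (scanStopCost f₀ f₁ c) (fun _ => scanPrior π₀) c n := by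
  induction n with
  | zero => rfl
  | succ n ih =>
    funext r
    simp only [scanValueUpTo, BayesFilter.valueUpTo, ih]
    rfl

theorem scanValue_eq : scanValue f₀ f₁ π₀ c =
    (scanFilter f₀ f₁).value (scanStopCost f₀ f₁ c) (fun _ => scanPrior π₀) c := by
  funext r
  simp only [scanValue, BayesFilter.value, scanValueUpTo_eq]

theorem measurable_refineStopCost : Measurable refineStopCost := by
  unfold refineStopCost
  fun_prop

theorem refineStopCost_mem {r : ℝ × ℝ × ℝ} (hr : r ∈ refineDomain) :
    refineStopCost r ∈ Icc (0 : ℝ) 1 := by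
  obtain ⟨h1, h2, h3, h4⟩ := hr
  refine ⟨sub_nonneg.2 (max_le (by linarith) (by linarith)), ?_⟩
  have : 0 ≤ max (r.1 + r.2.1) (r.1 + r.2.2) := le_max_of_le_left (by linarith)
  unfold refineStopCost
  linarith

theorem measurable_refineValue : Measurable (refineValue f₀ f₁ c) := by
  rw [refineValue_eq]
  exact BayesFilter.measurable_value measurable_refineStopCost measurable_id

/-- The refinement state on entering the refinement stage in the scanning state `p`. -/
def refineStart (p : ℝ × ℝ) : ℝ × ℝ × ℝ := (p.1, p.2 / 2, p.2 / 2)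

theorem refineStart_mem {p : ℝ × ℝ} (hp : p ∈ scanDomain) : refineStart p ∈ refineDomain := by
  obtain ⟨h1, h2, h3⟩ := mem_scanDomain_iff.1 hp
  refine ⟨h1, ?_, ?_, ?_⟩ <;> simp only [refineStart] <;> linarith

theorem measurable_refineStart : Measurable refineStart := by
  unfold refineStart
  fun_prop

/-- The posterior of the pair is handed over unchanged between the stages: the mixed mass splits
equally because a sum does not tell which sequence is which. -/
theorem refineWeight_refineStart (p : ℝ × ℝ) : refineWeight (refineStart p) = scanWeight p := by
  funext a
  rcases a with ⟨_ | _, _ | _⟩ <;> simp only [refineWeight, refineStart, scanWeight]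
  congr 1
  ring

theorem measurable_scanStopCost : Measurable (scanStopCost f₀ f₁ c) :=
  (measurable_refineValue f₀ f₁ c).comp measurable_refineStart

theorem scanPrior_mem {π₀ : ℝ} (hπ : π₀ ∈ Icc (0 : ℝ) 1) : scanPrior π₀ ∈ scanDomain := by
  obtain ⟨h0, h1⟩ := hπ
  refine mem_scanDomain_iff.2 ⟨sq_nonneg _, ?_, ?_⟩ <;> simp only [scanPrior] <;> nlinarith

variable {c}

theorem scanStopCost_mem (hc : 0 < c) {p : ℝ × ℝ} (hp : p ∈ scanDomain) :
    scanStopCost f₀ f₁ c p ∈ Icc (0 : ℝ) 1 := by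
  unfold scanStopCost
  rw [refineValue_eq]
  exact BayesFilter.value_mem measurable_refineStopCost measurable_id hc.le
    (fun _ => refineStopCost_mem) (fun _ h => h) (refineStart_mem hp)

end Filters

/-! ### Measures on generated σ-algebras and countable partitions -/

section Partition

theorem comap_prodMk_pi_le {Ω ι : Type*} {m : MeasurableSpace Ω} {h : Ω → Bool} {y : ι → Ω → ℝ}
    (hh : Measurable h) (hy : ∀ i, Measurable (y i)) :
    MeasurableSpace.comap (fun ω => (h ω, fun i => y i ω)) inferInstance ≤ m :=
  (hh.prodMk (measurable_pi_iff.2 hy)).comap_le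

/-- The intersections A ∩ B form a π-system generating the join. -/
theorem measure_eq_of_sup {Ω : Type*} {m₁ m₂ mΩ : MeasurableSpace Ω} (h₁ : m₁ ≤ mΩ) (h₂ : m₂ ≤ mΩ)
    {μ ν : Measure Ω} [IsFiniteMeasure μ]
    (h : ∀ A B, MeasurableSet[m₁] A → MeasurableSet[m₂] B → μ (A ∩ B) = ν (A ∩ B))
    {A : Set Ω} (hA : MeasurableSet[m₁ ⊔ m₂] A) : μ A = ν A := by
  refine ext_on_measurableSpace_of_generate_finite mΩ (μ := μ) (ν := ν)
    (image2 (· ∩ ·) {A | MeasurableSet[m₁] A} {B | MeasurableSet[m₂] B}) ?_ (sup_le h₁ h₂)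
    (le_antisymm (sup_le ?_ ?_) (MeasurableSpace.generateFrom_le ?_)) ?_ ?_ hA
  · rintro _ ⟨A, hA, B, hB, rfl⟩
    exact h A B hA hB
  · exact fun A hA => MeasurableSpace.measurableSet_generateFrom
      ⟨A, hA, univ, MeasurableSet.univ, inter_univ A⟩
  · exact fun A hA => MeasurableSpace.measurableSet_generateFrom
      ⟨univ, MeasurableSet.univ, A, hA, univ_inter A⟩
  · rintro _ ⟨A, hA, B, hB, rfl⟩
    exact MeasurableSet.inter (le_sup_left (a := m₁) (b := m₂) A hA)
      (le_sup_right (a := m₁) (b := m₂) B hB)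
  · rintro _ ⟨A, hA, B, hB, rfl⟩ _ ⟨A', hA', B', hB', rfl⟩ _
    refine ⟨A ∩ A', hA.inter hA', B ∩ B', hB.inter hB', ?_⟩
    simp only [inter_assoc, inter_left_comm]
  · simpa using h univ univ MeasurableSet.univ MeasurableSet.univ

variable {Ω ι : Type*} {mΩ : MeasurableSpace Ω} {P : Measure Ω}

variable [Countable ι] {N : Ω → ι} (hN : ∀ i, MeasurableSet (N ⁻¹' {i}))

include hN in
theorem lintegral_eq_tsum_fiber (f : Ω → ℝ≥0∞) {A : Set Ω} (hA : MeasurableSet A) :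
    ∫⁻ ω in A, f ω ∂P = ∑' i, ∫⁻ ω in A ∩ N ⁻¹' {i}, f ω ∂P := by
  rw [← lintegral_iUnion (fun i => hA.inter (hN i))]
  · congr 2
    ext ω
    simp
  · intro i j hij
    refine disjoint_left.2 fun ω h1 h2 => hij ?_
    exact (show N ω = i from h1.2).symm.trans h2.2

include hN in
theorem measure_eq_tsum_fiber {A : Set Ω} (hA : MeasurableSet A) :
    P A = ∑' i, P (A ∩ N ⁻¹' {i}) := by
  have h := lintegral_eq_tsum_fiber (P := P) hN (fun _ => 1) hA
  simpa only [lintegral_const, one_mul, Measure.restrict_apply MeasurableSet.univ,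
    univ_inter] using h

include hN in
-- Reduces a statement about a random index (pair number, stopping time) to fixed indices; the
-- factor κ must not depend on the index.
theorem measure_eq_mul_of_fiber {S T : Set Ω} (hS : MeasurableSet S) (hT : MeasurableSet T)
    {κ : ℝ≥0∞} (h : ∀ i, P (S ∩ N ⁻¹' {i}) = P (T ∩ N ⁻¹' {i}) * κ) : P S = P T * κ := by
  rw [measure_eq_tsum_fiber hN hS, measure_eq_tsum_fiber hN hT, ← ENNReal.tsum_mul_right]
  exact tsum_congr h

end Partition

/-! ### The path of a switching rule -/

/-- The pair number and the mixed observations, as a function of the samples. -/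
def SwitchRule.pathOf (φ : SwitchRule) (y : ℕ → ℕ → ℝ) : (k : ℕ) → ℕ × (Fin k → ℝ)
  | 0 => (0, Fin.elim0)
  | k + 1 =>
    let h := φ.pathOf y k
    let n := if φ.rule k h.2 then h.1 + 1 else h.1
    (n, Fin.snoc (α := fun _ => ℝ) h.2 (y (2 * n) (k + 1) + y (2 * n + 1) (k + 1)))

theorem SwitchRule.measurable_pathOf (φ : SwitchRule) {Ω : Type*} {m : MeasurableSpace Ω}
    {y : ℕ → ℕ → Ω → ℝ} (k : ℕ) (hy : ∀ s, ∀ i ≤ k, Measurable (y s i)) :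
    Measurable fun ω => φ.pathOf (fun s i => y s i ω) k := by
  induction k with
  | zero => exact measurable_const
  | succ k ih =>
    have ih := ih fun s i hi => hy s i (hi.trans k.le_succ)
    have hn : Measurable fun ω => if φ.rule k (φ.pathOf (fun s i => y s i ω) k).2 then
        (φ.pathOf (fun s i => y s i ω) k).1 + 1 else (φ.pathOf (fun s i => y s i ω) k).1 := by
      refine Measurable.ite ?_ (ih.fst.add_const 1) ih.fst
      exact ((φ.measurable k).comp ih.snd) (measurableSet_singleton true)
    have hY : ∀ {N : Ω → ℕ}, Measurable N → Measurable fun ω => y (N ω) (k + 1) ω := fun hN => by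
      have h : Measurable fun z : ℕ × Ω => y z.1 (k + 1) z.2 :=
        measurable_from_prod_countable_right fun i => hy i (k + 1) le_rfl
      exact h.comp (hN.prodMk measurable_id)
    refine hn.prodMk (measurable_pi_iff.2 fun i => ?_)
    refine Fin.lastCases ?_ (fun j => ?_) i
    · simp only [Fin.snoc_last]
      exact (hY (hn.const_mul 2)).add (hY ((hn.const_mul 2).add_const 1))
    · simp only [Fin.snoc_castSucc]
      exact (measurable_pi_apply j).comp ih.snd

/-- The pair number never decreases. A path that is still at a pair ≤ n has therefore read only
sequences below 2n + 2. -/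
theorem SwitchRule.pathOf_congr (φ : SwitchRule) {y y' : ℕ → ℕ → ℝ} {n : ℕ}
    (h : ∀ s < 2 * n + 2, ∀ i, y s i = y' s i) (k : ℕ) (hk : (φ.pathOf y k).1 ≤ n) :
    φ.pathOf y k = φ.pathOf y' k := by
  induction k with
  | zero => rfl
  | succ k ih =>
    simp only [pathOf] at hk ⊢
    have h1 : (φ.pathOf y k).1 ≤ n := by
      split_ifs at hk <;> omega
    rw [ih h1] at hk ⊢
    rw [h _ (by omega), h _ (by omega)]

namespace SearchModel

variable {f₀ f₁ : ProbDensity} {π₀ : ℝ} {Ω : Type u} [mΩ : MeasurableSpace Ω] {P : Measure Ω}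
  (M : SearchModel f₀ f₁ π₀ P) (φ : SwitchRule)

theorem path_eq_pathOf (k : ℕ) (ω : Ω) :
    M.path φ k ω = φ.pathOf (fun s i => M.Y s i ω) k := by
  induction k with
  | zero => rfl
  | succ k ih => simp only [path, SwitchRule.pathOf, ih]

/-! ### σ-algebras of the sequences -/

/-- The hypothesis and the samples of a sequence. -/
def sequence (s : ℕ) (ω : Ω) : Bool × (ℕ → ℝ) := (M.H s ω, fun k => M.Y s k ω)

theorem measurable_sequence (s : ℕ) : Measurable (M.sequence s) :=
  (M.measurable_H s).prodMk (measurable_pi_iff.2 (M.measurable_Y s))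

/-- The information in the sequence `s`. -/
abbrev sequenceSpace (s : ℕ) : MeasurableSpace Ω := MeasurableSpace.comap (M.sequence s) inferInstance

theorem sequenceSpace_le (s : ℕ) : M.sequenceSpace s ≤ mΩ := (M.measurable_sequence s).comap_le

theorem measurable_H_sequenceSpace (s : ℕ) : Measurable[M.sequenceSpace s] (M.H s) :=
  measurable_fst.comp (comap_measurable (M.sequence s))

theorem measurable_Y_sequenceSpace (s k : ℕ) : Measurable[M.sequenceSpace s] (M.Y s k) :=
  (measurable_pi_apply k).comp (measurable_snd.comp (comap_measurable (M.sequence s)))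

/-- The information in all sequences except `s`. -/
abbrev othersSpace (s : ℕ) : MeasurableSpace Ω := ⨆ i ∈ ({s}ᶜ : Set ℕ), M.sequenceSpace i

theorem sequenceSpace_le_othersSpace {s i : ℕ} (h : i ≠ s) :
    M.sequenceSpace i ≤ M.othersSpace s :=
  le_iSup₂_of_le i (by simpa using h) le_rfl

theorem othersSpace_le (s : ℕ) : M.othersSpace s ≤ mΩ := iSup₂_le fun i _ => M.sequenceSpace_le i

theorem indep_sequenceSpace_othersSpace (s : ℕ) :
    Indep (M.sequenceSpace s) (M.othersSpace s) P := by
  have h : Indep (⨆ i ∈ ({s} : Set ℕ), M.sequenceSpace i) (M.othersSpace s) P :=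
    indep_iSup_of_disjoint (S := {s}) (T := {s}ᶜ) M.sequenceSpace_le M.indep
    disjoint_compl_right
  rwa [iSup_singleton] at h

/-- The hypothesis of the sequence `s` and its samples up to time `k`. -/
abbrev pastSpace (s k : ℕ) : MeasurableSpace Ω :=
  MeasurableSpace.comap (fun ω => (M.H s ω, fun i : Finset.Iic k => M.Y s i ω)) inferInstance

theorem measurable_H_pastSpace (s k : ℕ) : Measurable[M.pastSpace s k] (M.H s) :=
  measurable_fst.comp (comap_measurable fun ω => (M.H s ω, fun i : Finset.Iic k => M.Y s i ω))

theorem measurable_Y_pastSpace (s : ℕ) {i k : ℕ} (h : i ≤ k) :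
    Measurable[M.pastSpace s k] (M.Y s i) :=
  (measurable_pi_apply (⟨i, Finset.mem_Iic.2 h⟩ : Finset.Iic k)).comp
    (measurable_snd.comp
      (comap_measurable fun ω => (M.H s ω, fun i : Finset.Iic k => M.Y s i ω)))

theorem pastSpace_le_sequenceSpace (s k : ℕ) : M.pastSpace s k ≤ M.sequenceSpace s :=
  
  comap_prodMk_pi_le (M.measurable_H_sequenceSpace s) fun i => M.measurable_Y_sequenceSpace s i

/-- All hypotheses and all samples up to time `k`. -/
def fullFiltration : Filtration ℕ mΩ where
  seq k := ⨆ s, M.pastSpace s k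
  mono' _ j hij := iSup_mono fun s => comap_prodMk_pi_le (M.measurable_H_pastSpace s j)
    fun l => M.measurable_Y_pastSpace s ((Finset.mem_Iic.1 l.2).trans hij)
  le' k := iSup_le fun s => (M.pastSpace_le_sequenceSpace s k).trans (M.sequenceSpace_le s)

theorem measurable_H_full (s k : ℕ) : Measurable[M.fullFiltration k] (M.H s) :=
  (M.measurable_H_pastSpace s k).mono (le_iSup (fun s => M.pastSpace s k) s) le_rfl

theorem measurable_Y_full (s : ℕ) {i k : ℕ} (h : i ≤ k) :
    Measurable[M.fullFiltration k] (M.Y s i) :=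
  (M.measurable_Y_pastSpace s h).mono (le_iSup (fun s => M.pastSpace s k) s) le_rfl

/-- Singles out one sequence: the others are replaced by their complete, independent trajectories,
which only enlarges the conditioning. -/
theorem fullFiltration_le (s k : ℕ) :
    M.fullFiltration k ≤ M.pastSpace s k ⊔ M.othersSpace s := by
  refine iSup_le fun i => ?_
  by_cases h : i = s
  · rw [h]; exact le_sup_left
  · exact ((M.pastSpace_le_sequenceSpace i k).trans
      (M.sequenceSpace_le_othersSpace h)).trans le_sup_right

theorem measurable_path_full (k : ℕ) : Measurable[M.fullFiltration k] (M.path φ k) := by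
  have h := φ.measurable_pathOf (m := M.fullFiltration k) (y := M.Y) k
    fun s i hi => M.measurable_Y_full s hi
  simpa only [← M.path_eq_pathOf φ] using h

theorem scanFiltration_le_full (k : ℕ) : M.scanFiltration φ k ≤ M.fullFiltration k :=
  (measurable_snd.comp (M.measurable_path_full φ k)).comap_le

/-! ### Conditional laws given the past -/

/-- The prior probability of a hypothesis. -/
def _root_.hypWeight (π₀ : ℝ) (a : Bool) : ℝ≥0∞ :=
  if a then ENNReal.ofReal π₀ else ENNReal.ofReal (1 - π₀)

/-- Fixing the hypothesis selects one component of the mixture law. -/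
theorem measure_sequence_preimage_inter {T : Set (Bool × (ℕ → ℝ))} (hT : MeasurableSet T) (s : ℕ)
    (a : Bool) : P (M.sequence s ⁻¹' T ∩ M.H s ⁻¹' {a}) = hypWeight π₀ a *
      (Measure.infinitePi fun _ : ℕ => (hypDensity f₀ f₁ a).law) (Prod.mk a ⁻¹' T) := by
  have hT' : MeasurableSet (T ∩ Prod.fst ⁻¹' {a}) :=
    hT.inter (measurable_fst (measurableSet_singleton a))
  have h1 : M.sequence s ⁻¹' T ∩ M.H s ⁻¹' {a} = M.sequence s ⁻¹' (T ∩ Prod.fst ⁻¹' {a}) := rfl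
  rw [h1, ← Measure.map_apply (M.measurable_sequence s) hT']
  have h2 : P.map (M.sequence s) = _ := M.law s
  rw [h2, Measure.dirac_prod, Measure.dirac_prod, Measure.add_apply, Measure.smul_apply,
    Measure.smul_apply, Measure.map_apply measurable_prodMk_left hT',
    Measure.map_apply measurable_prodMk_left hT']
  cases a <;> simp [hypWeight, hypDensity, preimage_preimage]

theorem measure_past_inter {s k : ℕ} {A : Set Ω} (hA : MeasurableSet[M.pastSpace s k] A) (a : Bool)
    {C : Set ℝ} (hC : MeasurableSet C) :
    P (A ∩ M.H s ⁻¹' {a} ∩ M.Y s (k + 1) ⁻¹' C) =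
      P (A ∩ M.H s ⁻¹' {a}) * (hypDensity f₀ f₁ a).law C := by
  obtain ⟨A, hA, rfl⟩ := hA
  let r : (ℕ → ℝ) → (Finset.Iic k → ℝ) := fun y i => y i
  have hr : Measurable r := measurable_pi_iff.2 fun i => measurable_pi_apply _
  have hrT : Measurable fun z : Bool × (ℕ → ℝ) => (z.1, r z.2) :=
    measurable_fst.prodMk (hr.comp measurable_snd)
  have hC' : MeasurableSet ((fun z : Bool × (ℕ → ℝ) => z.2 (k + 1)) ⁻¹' C) :=
    ((measurable_pi_apply (k + 1)).comp measurable_snd) hC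
  have h1 := M.measure_sequence_preimage_inter (hrT hA) s a
  have h2 := M.measure_sequence_preimage_inter ((hrT hA).inter hC') s a
  -- Under a fixed hypothesis the samples are coordinates of a product measure, so the blocks {0,
  -- ..., k} and {k + 1} are independent.
  have hind := (iIndepFun_infinitePi (P := fun _ : ℕ => (hypDensity f₀ f₁ a).law)
    (X := fun _ x => x) (fun _ => measurable_id)).indepFun_finset (Finset.Iic k) {k + 1}
    (by simp) (fun i => measurable_pi_apply i)
  have hψ : Measurable fun z : ({k + 1} : Finset ℕ) → ℝ => z ⟨k + 1, by simp⟩ :=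
    measurable_pi_apply _
  have hind' := hind.comp measurable_id hψ
  have hA' : MeasurableSet (Prod.mk a ⁻¹' A) := measurable_prodMk_left hA
  have h3 := hind'.measure_inter_preimage_eq_mul _ _ hA' hC
  have h4 : (Measure.infinitePi fun _ : ℕ => (hypDensity f₀ f₁ a).law)
      ((fun y : ℕ → ℝ => y (k + 1)) ⁻¹' C) = (hypDensity f₀ f₁ a).law C := by
    have hev : Measurable fun y : ℕ → ℝ => y (k + 1) := measurable_pi_apply _
    rw [← Measure.map_apply hev hC]
    exact congrArg (fun μ : Measure ℝ => μ C) (Measure.infinitePi_map_eval _ (k + 1))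
  have h5 : (fun ω => (M.H s ω, fun i : Finset.Iic k => M.Y s i ω)) ⁻¹' A ∩ M.H s ⁻¹' {a} ∩
      M.Y s (k + 1) ⁻¹' C = M.sequence s ⁻¹' ((fun z => (z.1, r z.2)) ⁻¹' A ∩
        (fun z : Bool × (ℕ → ℝ) => z.2 (k + 1)) ⁻¹' C) ∩ M.H s ⁻¹' {a} :=
    inter_right_comm _ _ _
  rw [h5, h2]
  refine (congrArg (hypWeight π₀ a * ·) h3).trans ?_
  rw [← mul_assoc, ← h4]
  exact congrArg (· * _) h1.symm

variable [IsProbabilityMeasure P]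

/-- Given the hypotheses, the past and the other sequences, the next sample of the sequence `s`
has the law determined by its hypothesis. -/
theorem measure_inter_Y {s k : ℕ} {A : Set Ω}
    (hA : MeasurableSet[M.pastSpace s k ⊔ M.othersSpace s] A) (a : Bool)
    {C : Set ℝ} (hC : MeasurableSet C) :
    P (A ∩ M.H s ⁻¹' {a} ∩ M.Y s (k + 1) ⁻¹' C) =
      P (A ∩ M.H s ⁻¹' {a}) * (hypDensity f₀ f₁ a).law C := by
  have hle := (M.pastSpace_le_sequenceSpace s k).trans (M.sequenceSpace_le s)
  have hH : MeasurableSet[M.sequenceSpace s] (M.H s ⁻¹' {a}) :=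
    M.measurable_H_sequenceSpace s (measurableSet_singleton a)
  have hY : MeasurableSet[M.sequenceSpace s] (M.Y s (k + 1) ⁻¹' C) :=
    M.measurable_Y_sequenceSpace s (k + 1) hC
  have hind := (Indep_iff _ _ _).1 (M.indep_sequenceSpace_othersSpace s)
  -- Both sides are measures in A, so it suffices to take intersections of an event of the past of s
  -- with an event of the other sequences; independence factors out the latter.
  have h := measure_eq_of_sup hle (M.othersSpace_le s)
    (μ := P.restrict (M.H s ⁻¹' {a} ∩ M.Y s (k + 1) ⁻¹' C))
    (ν := (hypDensity f₀ f₁ a).law C • P.restrict (M.H s ⁻¹' {a})) (fun A B hA hB => by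
      have hA' := M.pastSpace_le_sequenceSpace s k _ hA
      have hAB := (hle _ hA).inter (M.othersSpace_le s _ hB)
      rw [Measure.smul_apply, Measure.restrict_apply hAB, Measure.restrict_apply hAB, smul_eq_mul,
        show A ∩ B ∩ (M.H s ⁻¹' {a} ∩ M.Y s (k + 1) ⁻¹' C) =
          (A ∩ M.H s ⁻¹' {a} ∩ M.Y s (k + 1) ⁻¹' C) ∩ B by
            ext; simp only [mem_inter_iff]; tauto,
        show A ∩ B ∩ M.H s ⁻¹' {a} = A ∩ M.H s ⁻¹' {a} ∩ B by
            ext; simp only [mem_inter_iff]; tauto,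
        hind _ _ (MeasurableSet.inter (MeasurableSet.inter hA' hH) hY) hB,
        hind _ _ (MeasurableSet.inter hA' hH) hB, M.measure_past_inter hA a hC]
      ring) hA
  have hA' := sup_le hle (M.othersSpace_le s) _ hA
  rw [Measure.smul_apply, Measure.restrict_apply hA', Measure.restrict_apply hA', smul_eq_mul,
    ← inter_assoc, mul_comm] at h
  exact h

theorem measure_full_inter_Y {s k : ℕ} {A : Set Ω} (hA : MeasurableSet[M.fullFiltration k] A)
    (a : Bool) {C : Set ℝ} (hC : MeasurableSet C) :
    P (A ∩ M.H s ⁻¹' {a} ∩ M.Y s (k + 1) ⁻¹' C) =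
      P (A ∩ M.H s ⁻¹' {a}) * (hypDensity f₀ f₁ a).law C :=
  M.measure_inter_Y (M.fullFiltration_le s k _ hA) a hC

/-- Given the hypotheses and the past, the sum of the next samples of two sequences has the
convolution of their laws. -/
theorem measure_full_inter_add {s t k : ℕ} (hst : s ≠ t) {A : Set Ω}
    (hA : MeasurableSet[M.fullFiltration k] A) (a b : Bool) {C : Set ℝ} (hC : MeasurableSet C) :
    P (A ∩ (M.H s ⁻¹' {a} ∩ M.H t ⁻¹' {b}) ∩ (fun ω => M.Y s (k + 1) ω + M.Y t (k + 1) ω) ⁻¹' C) =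
      P (A ∩ (M.H s ⁻¹' {a} ∩ M.H t ⁻¹' {b})) *
        ((hypDensity f₀ f₁ a).law.conv (hypDensity f₀ f₁ b).law) C := by
  set S := A ∩ (M.H s ⁻¹' {a} ∩ M.H t ⁻¹' {b}) with hS
  have hSf : MeasurableSet[M.fullFiltration k] S :=
    MeasurableSet.inter hA (MeasurableSet.inter
      (M.measurable_H_full s k (measurableSet_singleton a))
      (M.measurable_H_full t k (measurableSet_singleton b)))
  have hSm := (M.fullFiltration).le k _ hSf
  have hY := (M.measurable_Y s (k + 1)).prodMk (M.measurable_Y t (k + 1))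
  -- On S the two next samples are independent with the laws of their hypotheses.
  have key : (P.restrict S).map (fun ω => (M.Y s (k + 1) ω, M.Y t (k + 1) ω)) =
      (P S • (hypDensity f₀ f₁ a).law).prod (hypDensity f₀ f₁ b).law := by
    have : IsFiniteMeasure (P S • (hypDensity f₀ f₁ a).law) :=
      Measure.smul_finite _ (measure_ne_top _ _)
    symm
    refine Measure.prod_eq fun C D hC hD => ?_
    rw [Measure.map_apply hY (hC.prod hD), Measure.restrict_apply (hY (hC.prod hD)),
      Measure.smul_apply, smul_eq_mul]
    have hSs : S ∩ M.H s ⁻¹' {a} = S := inter_eq_left.2 fun ω h => h.2.1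
    have hSt : S ∩ M.H t ⁻¹' {b} = S := inter_eq_left.2 fun ω h => h.2.2
    have h1 := M.measure_full_inter_Y (s := s) hSf a hC
    -- Seen from t, the sample k + 1 of s belongs to another sequence and may join the conditioning
    -- event.
    have hSY : MeasurableSet[M.pastSpace t k ⊔ M.othersSpace t] (S ∩ M.Y s (k + 1) ⁻¹' C) :=
      MeasurableSet.inter (M.fullFiltration_le t k _ hSf) (le_sup_right (a := M.pastSpace t k) _
        (M.sequenceSpace_le_othersSpace hst _ (M.measurable_Y_sequenceSpace s (k + 1) hC)))
    have h2 := M.measure_inter_Y hSY b hD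
    rw [hSs] at h1
    rw [inter_right_comm S _ (M.H t ⁻¹' {b}), hSt, h1] at h2
    rw [← h2]
    congr 1
    ext
    simp only [mem_inter_iff, mem_preimage, mem_prod]
    tauto
  have hadd : Measurable fun z : ℝ × ℝ => z.1 + z.2 := measurable_fst.add measurable_snd
  have h1 : P (S ∩ (fun ω => M.Y s (k + 1) ω + M.Y t (k + 1) ω) ⁻¹' C) =
      ((P.restrict S).map (fun ω => (M.Y s (k + 1) ω, M.Y t (k + 1) ω)))
        ((fun z : ℝ × ℝ => z.1 + z.2) ⁻¹' C) := by
    rw [Measure.map_apply hY (hadd hC), Measure.restrict_apply (hY (hadd hC)), inter_comm]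
    rfl
  rw [h1, key, Measure.prod_smul_left, Measure.smul_apply, smul_eq_mul, Measure.conv,
    Measure.map_apply hadd hC]

/-! ### New pairs -/

/-- The information in the sequences before `s`. -/
abbrev earlierSpace (s : ℕ) : MeasurableSpace Ω := ⨆ i ∈ Iio s, M.sequenceSpace i

omit [IsProbabilityMeasure P] in
theorem sequenceSpace_le_earlierSpace {s i : ℕ} (h : i < s) :
    M.sequenceSpace i ≤ M.earlierSpace s := le_iSup₂_of_le i h le_rfl

omit [IsProbabilityMeasure P] in
theorem earlierSpace_le_othersSpace {s t : ℕ} (h : s ≤ t) :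
    M.earlierSpace s ≤ M.othersSpace t :=
  iSup₂_le fun _ hi => M.sequenceSpace_le_othersSpace (ne_of_lt (lt_of_lt_of_le hi h))

omit [IsProbabilityMeasure P] in
theorem measure_H (s : ℕ) (a : Bool) : P (M.H s ⁻¹' {a}) = hypWeight π₀ a := by
  have h := M.measure_sequence_preimage_inter MeasurableSet.univ s a
  simpa using h

omit [IsProbabilityMeasure P] in
theorem measure_inter_H {s : ℕ} {A : Set Ω} (hA : MeasurableSet[M.othersSpace s] A) (a : Bool) :
    P (A ∩ M.H s ⁻¹' {a}) = P A * hypWeight π₀ a := by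
  rw [inter_comm, (Indep_iff _ _ _).1 (M.indep_sequenceSpace_othersSpace s) _ _
    (M.measurable_H_sequenceSpace s (measurableSet_singleton a)) hA, M.measure_H, mul_comm]

omit [IsProbabilityMeasure P] in
theorem measure_earlier_inter {s : ℕ} {A : Set Ω} (hA : MeasurableSet[M.earlierSpace s] A)
    (a b : Bool) : P (A ∩ (M.H s ⁻¹' {a} ∩ M.H (s + 1) ⁻¹' {b})) =
      P A * (hypWeight π₀ a * hypWeight π₀ b) := by
  rw [← inter_assoc, M.measure_inter_H (MeasurableSet.inter
    (M.earlierSpace_le_othersSpace s.le_succ _ hA)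
    (M.sequenceSpace_le_othersSpace (Nat.lt_succ_self s).ne _
      (M.measurable_H_sequenceSpace s (measurableSet_singleton a)))),
    M.measure_inter_H (M.earlierSpace_le_othersSpace le_rfl _ hA), mul_assoc]

omit [IsProbabilityMeasure P] in
-- This makes a new pair fresh: on {pair = n} the history is determined by sequences below 2n + 2,
-- hence independent of the pair n + 1.
theorem measurableSet_earlier {k : ℕ} {A : Set Ω} (hA : MeasurableSet[M.scanFiltration φ k] A)
    (n : ℕ) : MeasurableSet[M.earlierSpace (2 * n + 2)] (A ∩ M.pair φ k ⁻¹' {n}) := by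
  obtain ⟨A, hA, rfl⟩ := hA
  -- Erasing the later sequences leaves the path unchanged on {pair = n} and makes it measurable for
  -- the earlier ones.
  let y : ℕ → ℕ → Ω → ℝ := fun s i => if s < 2 * n + 2 then M.Y s i else 0
  have hy : ∀ s i, Measurable[M.earlierSpace (2 * n + 2)] (y s i) := fun s i => by
    by_cases h : s < 2 * n + 2
    · simp only [y, h, if_true]
      exact (M.measurable_Y_sequenceSpace s i).mono (M.sequenceSpace_le_earlierSpace h) le_rfl
    · simp only [y, h, if_false]
      exact measurable_const
  have hm := φ.measurable_pathOf (m := M.earlierSpace (2 * n + 2)) k fun s i _ => hy s i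
  have hset : M.hist φ k ⁻¹' A ∩ M.pair φ k ⁻¹' {n} =
      (fun ω => φ.pathOf (fun s i => y s i ω) k) ⁻¹' ({n} ×ˢ A) := by
    ext ω
    have hc : ∀ s < 2 * n + 2, ∀ i, M.Y s i ω = y s i ω := fun s hs i => by simp [y, hs]
    simp only [mem_inter_iff, mem_preimage, mem_singleton_iff, mem_prod, hist, pair,
      M.path_eq_pathOf]
    constructor
    · rintro ⟨h1, h2⟩
      rw [← φ.pathOf_congr hc k h2.le]
      exact ⟨h2, h1⟩
    · rintro ⟨h2, h1⟩
      rw [← φ.pathOf_congr (fun s hs i => (hc s hs i).symm) k h2.le]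
      exact ⟨h1, h2⟩
  rw [hset]
  exact hm ((measurableSet_singleton n).prod hA)

end SearchModel

/-! ### Conditional probabilities from posterior weights -/

theorem condExp_indicator_eq {Ω : Type*} {m mΩ : MeasurableSpace Ω} {P : Measure Ω}
    [IsProbabilityMeasure P] (hm : m ≤ mΩ) {S : Set Ω} (hS : MeasurableSet S) {w : Ω → ℝ}
    (hw : Measurable[m] w) (hw01 : ∀ ω, w ω ∈ Icc (0 : ℝ) 1)
    (h : ∀ A, MeasurableSet[m] A → P (A ∩ S) = ∫⁻ ω in A, ENNReal.ofReal (w ω) ∂P) :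
    P[S.indicator (fun _ => (1 : ℝ)) | m] =ᵐ[P] w := by
  have hwi : Integrable w P := Integrable.of_bound (hw.mono hm le_rfl).aestronglyMeasurable 1
    (ae_of_all _ fun ω => by rw [Real.norm_of_nonneg (hw01 ω).1]; exact (hw01 ω).2)
  refine (ae_eq_condExp_of_forall_setIntegral_eq hm ((integrable_const 1).indicator hS)
    (fun A _ _ => hwi.integrableOn) (fun A hA _ => ?_)
    hw.stronglyMeasurable.aestronglyMeasurable).symm
  rw [integral_eq_lintegral_of_nonneg_ae (ae_of_all _ fun ω => (hw01 ω).1)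
    (hw.mono hm le_rfl).aestronglyMeasurable, ← h A hA, setIntegral_indicator hS]
  simp [Measure.real]

theorem measurable_snoc {Ω : Type*} {m : MeasurableSpace Ω} {k : ℕ} {h : Ω → Fin k → ℝ} {x : Ω → ℝ}
    (hh : Measurable h) (hx : Measurable x) :
    Measurable fun ω => (Fin.snoc (α := fun _ => ℝ) (h ω) (x ω) : Fin (k + 1) → ℝ) := by
  refine measurable_pi_iff.2 fun i => ?_
  refine Fin.lastCases ?_ (fun j => ?_) i
  · simpa only [Fin.snoc_last] using hx
  · simp only [Fin.snoc_castSucc]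
    exact (measurable_pi_apply j).comp hh

namespace SearchModel

variable {f₀ f₁ : ProbDensity} {π₀ : ℝ} {Ω : Type u} [mΩ : MeasurableSpace Ω] {P : Measure Ω}
  (M : SearchModel f₀ f₁ π₀ P) (φ : SwitchRule)

/-! ### The scanning statistics -/

/-- The mixed observation at time `k`. -/
def mixedObs (k : ℕ) (ω : Ω) : ℝ :=
  M.Y (2 * M.pair φ k ω) k ω + M.Y (2 * M.pair φ k ω + 1) k ω

/-- The hypotheses of the pair under observation at time `k`. -/
def status (k : ℕ) (ω : Ω) : Bool × Bool :=
  (M.H (2 * M.pair φ k ω) ω, M.H (2 * M.pair φ k ω + 1) ω)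

theorem hist_succ (k : ℕ) (ω : Ω) : M.hist φ (k + 1) ω =
    Fin.snoc (α := fun _ => ℝ) (M.hist φ k ω) (M.mixedObs φ (k + 1) ω) := rfl

theorem pair_succ (k : ℕ) (ω : Ω) : M.pair φ (k + 1) ω =
    if φ.rule k (M.hist φ k ω) then M.pair φ k ω + 1 else M.pair φ k ω := rfl

theorem measurable_hist (k : ℕ) : Measurable[M.scanFiltration φ k] (M.hist φ k) :=
  comap_measurable _

theorem measurable_pair (k : ℕ) : Measurable (M.pair φ k) := (M.measurable_path φ k).fst

theorem measurable_pair_full (k : ℕ) : Measurable[M.fullFiltration k] (M.pair φ k) :=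
  measurable_fst.comp (M.measurable_path_full φ k)

theorem measurable_mixedObs (k : ℕ) : Measurable (M.mixedObs φ k) :=
  (M.measurable_Y_comp ((M.measurable_pair φ k).const_mul 2) measurable_const).add
    (M.measurable_Y_comp (((M.measurable_pair φ k).const_mul 2).add_const 1) measurable_const)

theorem measurable_H_comp {N : Ω → ℕ} (hN : Measurable N) : Measurable fun ω => M.H (N ω) ω := by
  have h : Measurable fun q : ℕ × Ω => M.H q.1 q.2 :=
    measurable_from_prod_countable_right fun i => M.measurable_H i
  exact h.comp (hN.prodMk measurable_id)

theorem measurable_status (k : ℕ) : Measurable (M.status φ k) :=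
  (M.measurable_H_comp ((M.measurable_pair φ k).const_mul 2)).prodMk
    (M.measurable_H_comp (((M.measurable_pair φ k).const_mul 2).add_const 1))

theorem measurable_mixedObs_scan (k : ℕ) :
    Measurable[M.scanFiltration φ (k + 1)] (M.mixedObs φ (k + 1)) := by
  have h := (measurable_pi_apply (Fin.last k)).comp (M.measurable_hist φ (k + 1))
  have h2 : (fun y : Fin (k + 1) → ℝ => y (Fin.last k)) ∘ M.hist φ (k + 1) =
      M.mixedObs φ (k + 1) := by
    funext ω
    simp [hist_succ]
  rwa [h2] at h

theorem scanFiltration_succ_le (k : ℕ) : M.scanFiltration φ (k + 1) ≤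
    M.scanFiltration φ k ⊔ MeasurableSpace.comap (M.mixedObs φ (k + 1)) inferInstance :=
  Measurable.comap_le <| @measurable_snoc Ω (M.scanFiltration φ k ⊔
      MeasurableSpace.comap (M.mixedObs φ (k + 1)) inferInstance) k _ _
    ((M.measurable_hist φ k).mono le_sup_left le_rfl)
    ((comap_measurable (M.mixedObs φ (k + 1))).mono le_sup_right le_rfl)

/-- The scanning statistics, computed recursively from the observations. -/
def stat : ℕ → Ω → ℝ × ℝ
  | 0, _ => scanPrior π₀
  | k + 1, ω => scanUpdate f₀ f₁
      (if φ.rule k (M.hist φ k ω) then scanPrior π₀ else stat k ω) (M.mixedObs φ (k + 1) ω)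

/-- The scanning statistics of the pair that is observed next. -/
def nextStat (k : ℕ) (ω : Ω) : ℝ × ℝ :=
  if φ.rule k (M.hist φ k ω) then scanPrior π₀ else M.stat φ k ω

theorem stat_succ (k : ℕ) (ω : Ω) : M.stat φ (k + 1) ω =
    scanUpdate f₀ f₁ (M.nextStat φ k ω) (M.mixedObs φ (k + 1) ω) := rfl

theorem measurableSet_rule (k : ℕ) :
    MeasurableSet[M.scanFiltration φ k] {ω | φ.rule k (M.hist φ k ω) = true} :=
  ((φ.measurable k).comp (M.measurable_hist φ k)) (measurableSet_singleton true)

theorem measurable_nextStat_of {k : ℕ} (h : Measurable[M.scanFiltration φ k] (M.stat φ k)) :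
    Measurable[M.scanFiltration φ k] (M.nextStat φ k) :=
  Measurable.ite (M.measurableSet_rule φ k) measurable_const h

theorem measurable_stat (k : ℕ) : Measurable[M.scanFiltration φ k] (M.stat φ k) := by
  induction k with
  | zero => exact measurable_const
  | succ k ih =>
    exact (measurable_scanUpdate f₀ f₁).comp
      (((M.measurable_nextStat_of φ ih).mono ((M.scanFiltration φ).mono k.le_succ) le_rfl).prodMk
        (M.measurable_mixedObs_scan φ k))

theorem measurable_nextStat (k : ℕ) : Measurable[M.scanFiltration φ k] (M.nextStat φ k) :=
  M.measurable_nextStat_of φ (M.measurable_stat φ k)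

section Domain

variable (hπ : π₀ ∈ Icc (0 : ℝ) 1)
include hπ

theorem stat_mem (k : ℕ) (ω : Ω) : M.stat φ k ω ∈ scanDomain := by
  induction k with
  | zero => exact scanPrior_mem hπ
  | succ k ih =>
    refine scanUpdate_mem f₀ f₁ ?_ _
    split_ifs
    exacts [scanPrior_mem hπ, ih]

theorem nextStat_mem (k : ℕ) (ω : Ω) : M.nextStat φ k ω ∈ scanDomain := by
  unfold nextStat
  split_ifs
  exacts [scanPrior_mem hπ, M.stat_mem φ hπ k ω]

end Domain

/-- The hypotheses of a fresh pair are independent, so the prior weights are products. -/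
theorem _root_.scanWeight_scanPrior {π₀ : ℝ} (hπ : π₀ ∈ Icc (0 : ℝ) 1) (a : Bool × Bool) :
    scanWeight (scanPrior π₀) a = hypWeight π₀ a.1 * hypWeight π₀ a.2 := by
  obtain ⟨h0, h1⟩ := hπ
  rcases a with ⟨_ | _, _ | _⟩ <;>
    simp only [scanWeight, scanPrior, hypWeight, Bool.false_eq_true, if_true, if_false] <;>
    rw [← ENNReal.ofReal_mul (by linarith)] <;> congr 1 <;> ring

variable [IsProbabilityMeasure P]

/-- Given the hypotheses of the observed pair, the next mixed observation has the density
`mixedDensity`. -/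
theorem hasCondDensity_mixedObs (k : ℕ) :
    HasCondDensity (M.scanFiltration φ k) P (M.status φ (k + 1)) (M.mixedObs φ (k + 1))
      (fun a z => ENNReal.ofReal (mixedDensity f₀ f₁ a z)) := by
  intro A C hA hC a
  rw [setLIntegral_mixedDensity f₀ f₁ a hC]
  have hAm := (M.scanFiltration φ).le k _ hA
  have hSm := hAm.inter (M.measurable_status φ (k + 1) (measurableSet_singleton a))
  -- The pair watched at time k + 1 is already fixed at time k, since the switching decision uses
  -- only the first k observations.
  have hpair : Measurable[M.fullFiltration k] (M.pair φ (k + 1)) := by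
    have h := M.measurable_pair_full φ k
    exact Measurable.ite (M.scanFiltration_le_full φ k _ (M.measurableSet_rule φ k))
      (h.add_const 1) h
  refine measure_eq_mul_of_fiber
    (fun n => M.measurable_pair φ (k + 1) (measurableSet_singleton n))
    (hSm.inter (M.measurable_mixedObs φ (k + 1) hC)) hSm fun n => ?_
  have hB : MeasurableSet[M.fullFiltration k] (A ∩ M.pair φ (k + 1) ⁻¹' {n}) :=
    MeasurableSet.inter (M.scanFiltration_le_full φ k _ hA) (hpair (measurableSet_singleton n))
  have h1 : A ∩ M.status φ (k + 1) ⁻¹' {a} ∩ M.pair φ (k + 1) ⁻¹' {n} =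
      A ∩ M.pair φ (k + 1) ⁻¹' {n} ∩ (M.H (2 * n) ⁻¹' {a.1} ∩ M.H (2 * n + 1) ⁻¹' {a.2}) := by
    ext ω
    simp only [mem_inter_iff, mem_preimage, mem_singleton_iff, status, Prod.ext_iff]
    constructor
    · rintro ⟨⟨h1, h2, h3⟩, h4⟩
      exact ⟨⟨h1, h4⟩, h4 ▸ h2, h4 ▸ h3⟩
    · rintro ⟨⟨h1, h4⟩, h2, h3⟩
      exact ⟨⟨h1, h4 ▸ h2, h4 ▸ h3⟩, h4⟩
  have h2 : A ∩ M.status φ (k + 1) ⁻¹' {a} ∩ M.mixedObs φ (k + 1) ⁻¹' C ∩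
      M.pair φ (k + 1) ⁻¹' {n} =
      A ∩ M.pair φ (k + 1) ⁻¹' {n} ∩ (M.H (2 * n) ⁻¹' {a.1} ∩ M.H (2 * n + 1) ⁻¹' {a.2}) ∩
        (fun ω => M.Y (2 * n) (k + 1) ω + M.Y (2 * n + 1) (k + 1) ω) ⁻¹' C := by
    rw [inter_right_comm _ _ (M.pair φ (k + 1) ⁻¹' {n}), h1]
    ext ω
    simp only [mem_inter_iff, mem_preimage, mem_singleton_iff, mixedObs]
    constructor
    · rintro ⟨⟨⟨h1, h4⟩, h2⟩, h3⟩
      exact ⟨⟨⟨h1, h4⟩, h2⟩, h4 ▸ h3⟩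
    · rintro ⟨⟨⟨h1, h4⟩, h2⟩, h3⟩
      exact ⟨⟨⟨h1, h4⟩, h2⟩, h4 ▸ h3⟩
  rw [h1, h2, M.measure_full_inter_add (by omega) hB a.1 a.2 hC]

variable (hπ : π₀ ∈ Icc (0 : ℝ) 1)
include hπ

omit [IsProbabilityMeasure P] in
/-- The posterior weights of the next pair, before it is observed. -/
theorem isPosterior_nextStat {k : ℕ}
    (h : IsPosterior (M.scanFiltration φ k) P (M.status φ k) fun ω => scanWeight (M.stat φ k ω)) :
    IsPosterior (M.scanFiltration φ k) P (M.status φ (k + 1))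
      fun ω => scanWeight (M.nextStat φ k ω) := by
  intro A hA a
  set R : Set Ω := {ω | φ.rule k (M.hist φ k ω) = true} with hR
  have hRf : MeasurableSet[M.scanFiltration φ k] R := M.measurableSet_rule φ k
  have hRm := (M.scanFiltration φ).le k _ hRf
  have hAR : MeasurableSet[M.scanFiltration φ k] (A ∩ R) := MeasurableSet.inter hA hRf
  have hAR' : MeasurableSet[M.scanFiltration φ k] (A \ R) := MeasurableSet.diff hA hRf
  have hARm := (M.scanFiltration φ).le k _ hAR
  have hAR'm := (M.scanFiltration φ).le k _ hAR'
  have hst := M.measurable_status φ (k + 1) (measurableSet_singleton a)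
  -- After a switch from pair n, the hypotheses are those of the untouched pair n + 1, independent
  -- of the event.
  have h1 : P (A ∩ R ∩ M.status φ (k + 1) ⁻¹' {a}) =
      ∫⁻ ω in A ∩ R, scanWeight (M.nextStat φ k ω) a ∂P := by
    rw [setLIntegral_congr_fun (g := fun _ => scanWeight (scanPrior π₀) a) hARm fun ω hω => by
      have : φ.rule k (M.hist φ k ω) = true := hω.2
      simp [nextStat, this], setLIntegral_const, scanWeight_scanPrior hπ, mul_comm]
    refine measure_eq_mul_of_fiber
      (fun n => M.measurable_pair φ k (measurableSet_singleton n)) (hARm.inter hst) hARm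
      fun n => ?_
    rw [← M.measure_earlier_inter (M.measurableSet_earlier φ hAR n) a.1 a.2]
    congr 1
    ext ω
    simp only [mem_inter_iff, mem_preimage, mem_singleton_iff, status, Prod.ext_iff]
    constructor
    · rintro ⟨⟨⟨h1, h2⟩, h3⟩, h4⟩
      have h5 : M.pair φ (k + 1) ω = n + 1 := by
        rw [pair_succ, if_pos (show φ.rule k (M.hist φ k ω) = true from h2), h4]
      rw [h5] at h3
      exact ⟨⟨⟨h1, h2⟩, h4⟩, h3⟩
    · rintro ⟨⟨⟨h1, h2⟩, h4⟩, h3⟩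
      have h5 : M.pair φ (k + 1) ω = n + 1 := by
        rw [pair_succ, if_pos (show φ.rule k (M.hist φ k ω) = true from h2), h4]
      rw [h5]
      exact ⟨⟨⟨h1, h2⟩, h3⟩, h4⟩
  have h2 : P (A \ R ∩ M.status φ (k + 1) ⁻¹' {a}) =
      ∫⁻ ω in A \ R, scanWeight (M.nextStat φ k ω) a ∂P := by
    have h3 : A \ R ∩ M.status φ (k + 1) ⁻¹' {a} = A \ R ∩ M.status φ k ⁻¹' {a} := by
      ext ω
      simp only [mem_inter_iff, mem_preimage, mem_singleton_iff, status, and_congr_right_iff]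
      intro hω
      have : φ.rule k (M.hist φ k ω) ≠ true := hω.2
      rw [pair_succ, if_neg this]
    rw [h3, h _ hAR' a]
    refine setLIntegral_congr_fun hAR'm fun ω hω => ?_
    have : φ.rule k (M.hist φ k ω) ≠ true := hω.2
    simp [nextStat, this]
  rw [← measure_inter_add_sdiff (A ∩ M.status φ (k + 1) ⁻¹' {a}) hRm,
    ← lintegral_inter_add_sdiff _ _ hRm, ← h1, ← h2]
  congr 2
  · rw [inter_right_comm]
  · ext ω; simp only [mem_inter_iff, Set.mem_sdiff]; tauto

/-- The scanning statistics give the posterior weights of the observed pair. -/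
theorem isPosterior_stat (k : ℕ) : IsPosterior (M.scanFiltration φ k) P (M.status φ k)
    fun ω => scanWeight (M.stat φ k ω) := by
  induction k with
  | zero =>
    intro A hA a
    -- The empty history takes values in a one-point space, so F₀ is trivial.
    have hA' : MeasurableSet[M.earlierSpace 0] A := by
      have h : M.scanFiltration φ 0 ≤ M.earlierSpace 0 :=
        (@measurable_of_subsingleton_codomain _ _ (M.earlierSpace 0) _ _ (M.hist φ 0)).comap_le
      exact h _ hA
    have h1 := M.measure_earlier_inter hA' a.1 a.2
    have h2 : ∫⁻ ω in A, scanWeight (M.stat φ 0 ω) a ∂P =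
        ∫⁻ _ in A, scanWeight (scanPrior π₀) a ∂P := rfl
    rw [h2, setLIntegral_const, scanWeight_scanPrior hπ, mul_comm, ← h1]
    congr 2
    ext ω
    simp [status, pair, path, Prod.ext_iff]
  | succ k ih =>
    intro A hA a
    exact (scanFilter_tracks f₀ f₁).isPosterior_update ((M.scanFiltration φ).le k)
      (M.measurable_status φ (k + 1)) (M.measurable_mixedObs φ (k + 1)) (M.measurable_nextStat φ k)
      (M.nextStat_mem φ hπ k) (M.isPosterior_nextStat φ hπ ih) (M.hasCondDensity_mixedObs φ k)
      A (M.scanFiltration_succ_le φ k _ hA) a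

theorem isControlled_stat : (scanFilter f₀ f₁).IsControlled P (M.scanFiltration φ) (M.stat φ)
    (M.nextStat φ) := fun k _ hf _ hA =>
  (scanFilter_tracks f₀ f₁).setLIntegral_update ((M.scanFiltration φ).le k)
    (M.measurable_status φ (k + 1)) (M.measurable_mixedObs φ (k + 1)) (M.measurable_nextStat φ k)
    (M.nextStat_mem φ hπ k) (M.isPosterior_nextStat φ hπ (M.isPosterior_stat φ hπ k))
    (M.hasCondDensity_mixedObs φ k) hf hA

/-- The recursive statistics are the posterior probabilities. -/
theorem posterior_ae_eq : ∀ᵐ ω ∂P, ∀ k, M.posterior φ k ω = M.stat φ k ω := by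
  refine ae_all_iff.2 fun k => ?_
  have hm := (M.scanFiltration φ).le k
  have hp := M.isPosterior_stat φ hπ k
  have hst := M.measurable_status φ k
  have h1 := condExp_indicator_eq (P := P) hm (S := M.status φ k ⁻¹' {(true, true)})
    (w := fun ω => (M.stat φ k ω).1) (hst (measurableSet_singleton _))
    (measurable_fst.comp (M.measurable_stat φ k)) (fun ω => by
      obtain ⟨h1, h2, -⟩ := M.stat_mem φ hπ k ω
      exact ⟨h1, h2⟩) fun A hA => hp A hA _
  have h2 := condExp_indicator_eq (P := P) hm
    (S := M.status φ k ⁻¹' {(true, false)} ∪ M.status φ k ⁻¹' {(false, true)})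
    (w := fun ω => (M.stat φ k ω).2)
    ((hst (measurableSet_singleton _)).union (hst (measurableSet_singleton _)))
    (measurable_snd.comp (M.measurable_stat φ k)) (fun ω => by
      obtain ⟨-, -, h1, h2, -⟩ := M.stat_mem φ hπ k ω
      exact ⟨h1, h2⟩) fun A hA => by
        have hw : Measurable fun ω => scanWeight (M.stat φ k ω) (true, false) :=
          ((scanFilter_tracks f₀ f₁).measurable_weight (true, false)).comp
            ((M.measurable_stat φ k).mono hm le_rfl)
        -- Each of the two disjoint mixed assignments carries half of p^mix.
        rw [inter_union_distrib_left, measure_union, hp A hA, hp A hA, ← lintegral_add_left hw]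
        · refine lintegral_congr fun ω => ?_
          have h0 := (mem_scanDomain_iff.1 (M.stat_mem φ hπ k ω)).2.1
          simp only [scanWeight]
          rw [← ENNReal.ofReal_add (by linarith) (by linarith), add_halves]
        · refine disjoint_left.2 fun ω hω hω' => ?_
          have h3 : M.status φ k ω = (true, false) := hω.2
          have h4 : M.status φ k ω = (false, true) := hω'.2
          rw [h3] at h4
          simp at h4
        · exact (hm _ hA).inter (hst (measurableSet_singleton _))
  have h3 : {ω | M.H (2 * M.pair φ k ω) ω = true ∧ M.H (2 * M.pair φ k ω + 1) ω = true} =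
      M.status φ k ⁻¹' {(true, true)} := by
    ext ω
    simp [status]
  have h4 : {ω | M.H (2 * M.pair φ k ω) ω ≠ M.H (2 * M.pair φ k ω + 1) ω} =
      M.status φ k ⁻¹' {(true, false)} ∪ M.status φ k ⁻¹' {(false, true)} := by
    ext ω
    simp only [status, mem_union, mem_preimage, mem_singleton_iff, Prod.ext_iff, mem_ofPred_eq]
    cases M.H (2 * M.pair φ k ω) ω <;> cases M.H (2 * M.pair φ k ω + 1) ω <;> simp
  filter_upwards [h1, h2] with ω h1 h2
  rw [posterior, h3, h4, h1, h2]

end SearchModel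

/-! ### The rule that switches on a given set of states -/

section FeedbackRule

variable (f₀ f₁ : ProbDensity) (π₀ : ℝ) (R : Set (ℝ × ℝ))

open Classical in
/-- The scanning statistics as a function of the observations, when the observer switches in the
states in `R`. -/
def feedbackStat : (k : ℕ) → (Fin k → ℝ) → ℝ × ℝ
  | 0, _ => scanPrior π₀
  | k + 1, z => scanUpdate f₀ f₁
      (if feedbackStat k (Fin.init z) ∈ R then scanPrior π₀ else feedbackStat k (Fin.init z))
      (z (Fin.last k))

theorem measurable_feedbackStat (hR : MeasurableSet R) (k : ℕ) :
    Measurable (feedbackStat f₀ f₁ π₀ R k) := by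
  induction k with
  | zero => exact measurable_const
  | succ k ih =>
    have hi : Measurable fun z : Fin (k + 1) → ℝ => (Fin.init z : Fin k → ℝ) :=
      measurable_pi_iff.2 fun i => measurable_pi_apply i.castSucc
    exact (measurable_scanUpdate f₀ f₁).comp
      ((Measurable.ite ((ih.comp hi) hR) measurable_const (ih.comp hi)).prodMk
        (measurable_pi_apply (Fin.last k)))

open Classical in
/-- The rule that switches in the states in `R`. -/
def feedbackRule (hR : MeasurableSet R) : SwitchRule where
  rule k z := decide (feedbackStat f₀ f₁ π₀ R k z ∈ R)
  measurable k := by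
    refine measurable_to_bool ?_
    have h : (fun z => decide (feedbackStat f₀ f₁ π₀ R k z ∈ R)) ⁻¹' {true} =
        feedbackStat f₀ f₁ π₀ R k ⁻¹' R := by
      ext z
      simp
    rw [h]
    exact measurable_feedbackStat f₀ f₁ π₀ R hR k hR

variable {f₀ f₁ π₀ R} {Ω : Type u} [mΩ : MeasurableSpace Ω] {P : Measure Ω}
  (M : SearchModel f₀ f₁ π₀ P)

open Classical in
-- Resolves the circularity between rule and statistics: each decision depends only on earlier
-- observations, so the recursion on observation vectors reproduces the statistics under the rule it
-- defines.
theorem SearchModel.stat_feedbackRule (hR : MeasurableSet R) (k : ℕ) (ω : Ω) :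
    M.stat (feedbackRule f₀ f₁ π₀ R hR) k ω =
      feedbackStat f₀ f₁ π₀ R k (M.hist (feedbackRule f₀ f₁ π₀ R hR) k ω) := by
  induction k with
  | zero => rfl
  | succ k ih =>
    rw [M.stat_succ, M.hist_succ, feedbackStat, Fin.init_snoc, Fin.snoc_last, nextStat, ih]
    by_cases h : feedbackStat f₀ f₁ π₀ R k (M.hist (feedbackRule f₀ f₁ π₀ R hR) k ω) ∈ R
    · rw [if_pos h, if_pos (show (feedbackRule f₀ f₁ π₀ R hR).rule k _ = true from decide_eq_true h)]
    · rw [if_neg h, if_neg (by simpa [feedbackRule] using h)]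

theorem SearchModel.switchesExactlyOn_feedbackRule [IsProbabilityMeasure P]
    (hπ : π₀ ∈ Icc (0 : ℝ) 1) (hR : MeasurableSet R) :
    M.SwitchesExactlyOn (feedbackRule f₀ f₁ π₀ R hR) R := by
  filter_upwards [M.posterior_ae_eq (feedbackRule f₀ f₁ π₀ R hR) hπ] with ω hω k
  rw [hω k, M.stat_feedbackRule hR]
  simp [feedbackRule]

end FeedbackRule

/-! ### Processes at stopping times -/

section Stopped

variable {Ω X : Type*} {mΩ : MeasurableSpace Ω} [MeasurableSpace X] {f : Filtration ℕ mΩ}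
  {τ : Ω → WithTop ℕ}

/-- At τ = ⊤ stopped processes are read at index 0, so events of the initial σ-algebra must be
admitted there. -/
theorem measurableSet_inter_eq_top (hτ : IsStoppingTime f τ) {A : Set Ω}
    (hA : MeasurableSet[f 0] A) : MeasurableSet[hτ.measurableSpace] (A ∩ {ω | τ ω = ⊤}) := by
  have h1 : {ω | τ ω = ⊤} = (⋃ n : ℕ, {ω | τ ω = n})ᶜ := by
    ext ω
    cases h : τ ω <;> simp [h]
  have h2 : MeasurableSet[⨆ t, f t] {ω | τ ω = ⊤} := by
    rw [h1]
    exact MeasurableSet.compl (MeasurableSet.iUnion fun n =>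
      le_iSup (fun t => f t) n _ (hτ.measurableSet_eq n))
  refine (hτ.measurableSet _).2 ⟨MeasurableSet.inter (le_iSup (fun t => f t) 0 _ hA) h2,
    fun i => ?_⟩
  have h3 : A ∩ {ω | τ ω = ⊤} ∩ {ω | τ ω ≤ i} = ∅ := by
    ext ω
    simp only [mem_inter_iff, mem_ofPred_eq, mem_empty_iff_false, iff_false]
    rintro ⟨⟨-, h4⟩, h5⟩
    rw [h4] at h5
    exact absurd h5 (by simp)
  exact (congrArg (@MeasurableSet Ω (f i)) h3).mpr (@MeasurableSet.empty Ω (f i))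

theorem measurable_stopped (hτ : IsStoppingTime f τ) {u : ℕ → Ω → X}
    (hu : ∀ k, Measurable[f k] (u k)) :
    Measurable[hτ.measurableSpace] fun ω => u ((τ ω).untopD 0) ω := by
  intro C hC
  have h : (fun ω => u ((τ ω).untopD 0) ω) ⁻¹' C =
      (⋃ n : ℕ, u n ⁻¹' C ∩ {ω | τ ω = (n : WithTop ℕ)}) ∪ (u 0 ⁻¹' C ∩ {ω | τ ω = ⊤}) := by
    ext ω
    simp only [mem_preimage, mem_union, mem_iUnion, mem_inter_iff, mem_ofPred_eq]
    cases h : τ ω with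
    | top => simp
    | coe n =>
      simp
      exact Iff.rfl
  rw [h]
  exact MeasurableSet.union (MeasurableSet.iUnion fun n =>
    (hτ.measurableSet_inter_eq_iff _ n).2 (MeasurableSet.inter (hu n hC) (hτ.measurableSet_eq n)))
    (measurableSet_inter_eq_top hτ (hu 0 hC))

theorem measurableSet_fiber (hτ : IsStoppingTime f τ) (t : WithTop ℕ) :
    MeasurableSet {ω | τ ω = t} := by
  cases t with
  | coe n => exact f.le n _ (hτ.measurableSet_eq n)
  | top =>
    have h := hτ.measurableSpace_le _ (measurableSet_inter_eq_top hτ MeasurableSet.univ)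
    rwa [univ_inter] at h

/-- The events that belong to `g t` on `{τ = t}`. -/
abbrev fiberSpace {Ω : Type*} (τ : Ω → WithTop ℕ) (g : ℕ → MeasurableSpace Ω)
    (hg : ∀ t : ℕ, MeasurableSet[g t] {ω | τ ω = (t : WithTop ℕ)}) : MeasurableSpace Ω where
  MeasurableSet' A := ∀ t : ℕ, MeasurableSet[g t] (A ∩ {ω | τ ω = (t : WithTop ℕ)})
  measurableSet_empty t := by rw [empty_inter]; exact @MeasurableSet.empty Ω (g t)
  measurableSet_compl A hA t := by
    have h : Aᶜ ∩ {ω | τ ω = (t : WithTop ℕ)} =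
        {ω | τ ω = (t : WithTop ℕ)} \ (A ∩ {ω | τ ω = (t : WithTop ℕ)}) := by
      ext ω
      simp only [mem_inter_iff, mem_compl_iff, Set.mem_sdiff]
      tauto
    rw [h]
    exact @MeasurableSet.diff Ω (g t) _ _ (hg t) (hA t)
  measurableSet_iUnion A hA t := by
    rw [iUnion_inter]
    exact @MeasurableSet.iUnion Ω _ (g t) _ _ fun i => hA i t

variable {P : Measure Ω} {σ : Ω → WithTop ℕ}

theorem ae_ne_top_of_isStoppingTime (hτ : IsStoppingTime f τ)
    (h : ∫⁻ ω, ENat.toENNReal (τ ω) ∂P ≠ ∞) : ∀ᵐ ω ∂P, τ ω ≠ ⊤ :=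
  ae_ne_top_of_lintegral_ne_top (fun k => f.le k _ (hτ.measurableSet_eq k)) h

theorem lintegral_toENNReal_add (hτ : IsStoppingTime f τ) :
    ∫⁻ ω, ENat.toENNReal (τ ω + σ ω) ∂P =
      ∫⁻ ω, ENat.toENNReal (τ ω) ∂P + ∫⁻ ω, ENat.toENNReal (σ ω) ∂P := by
  have hm : @Measurable _ _ _ ⊤ τ := @measurable_to_countable' _ _ ⊤ _ _ τ fun t =>
    measurableSet_fiber hτ t
  have hm' : Measurable fun ω => ENat.toENNReal (τ ω) :=
    (measurable_from_top (f := fun x : WithTop ℕ => ENat.toENNReal x)).comp hm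
  rw [← lintegral_add_left hm']
  exact lintegral_congr fun ω => ENat.toENNReal_add _ _

end Stopped

namespace SearchModel

variable {f₀ f₁ : ProbDensity} {π₀ : ℝ} {Ω : Type u} [mΩ : MeasurableSpace Ω] {P : Measure Ω}
  (M : SearchModel f₀ f₁ π₀ P) (φ : SwitchRule) {τ₀ : Ω → WithTop ℕ}

/-! ### The refinement statistics -/

/-- The hypotheses of the pair under observation at the end of the scanning stage. -/
def stoppedStatus (τ₀ : Ω → WithTop ℕ) (ω : Ω) : Bool × Bool :=
  M.status φ ((τ₀ ω).untopD 0) ω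

/-- The pair under observation at the end of the scanning stage. -/
def stoppedPair (τ₀ : Ω → WithTop ℕ) (ω : Ω) : ℕ := M.pair φ ((τ₀ ω).untopD 0) ω

/-- The refinement statistics, computed recursively from the observations. -/
def refineStat (τ₀ : Ω → WithTop ℕ) : ℕ → Ω → ℝ × ℝ × ℝ
  | 0, ω => refineStart (M.stat φ ((τ₀ ω).untopD 0) ω)
  | j + 1, ω => refineUpdate f₀ f₁ (refineStat τ₀ j ω) (M.refineSample φ τ₀ (j + 1) ω)

theorem refineStat_mem (hπ : π₀ ∈ Icc (0 : ℝ) 1) (j : ℕ) (ω : Ω) :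
    M.refineStat φ τ₀ j ω ∈ refineDomain := by
  induction j with
  | zero => exact refineStart_mem (M.stat_mem φ hπ _ ω)
  | succ j ih => exact refineUpdate_mem f₀ f₁ ih _

variable (hτ₀ : IsStoppingTime (M.scanFiltration φ) τ₀)

include hτ₀ in
theorem measurable_stoppedStatus : Measurable (M.stoppedStatus φ τ₀) := by
  have h : Measurable fun q : ℕ × Ω => M.status φ q.1 q.2 :=
    measurable_from_prod_countable_right fun k => M.measurable_status φ k
  exact h.comp ((M.measurable_untopD φ hτ₀).prodMk measurable_id)

include hτ₀ in
theorem measurable_stoppedPair : Measurable (M.stoppedPair φ τ₀) := by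
  have h : Measurable fun q : ℕ × Ω => M.pair φ q.1 q.2 :=
    measurable_from_prod_countable_right fun k => M.measurable_pair φ k
  exact h.comp ((M.measurable_untopD φ hτ₀).prodMk measurable_id)

theorem stopped_le_refineFiltration (j : ℕ) :
    hτ₀.measurableSpace ≤ M.refineFiltration φ hτ₀ j := le_sup_left

theorem measurable_refineSample_refine {i j : ℕ} (h1 : 1 ≤ i) (hij : i ≤ j) :
    Measurable[M.refineFiltration φ hτ₀ j] (M.refineSample φ τ₀ i) :=
  (comap_measurable _).mono
    (le_sup_of_le_right (le_iSup₂_of_le i (show i ∈ Icc 1 j from ⟨h1, hij⟩) le_rfl)) le_rfl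

theorem refineFiltration_zero_le : M.refineFiltration φ hτ₀ 0 ≤ hτ₀.measurableSpace :=
  sup_le le_rfl (iSup₂_le fun i hi => absurd (hi.1.trans hi.2) (by norm_num))

theorem refineFiltration_succ_le (j : ℕ) : M.refineFiltration φ hτ₀ (j + 1) ≤
    M.refineFiltration φ hτ₀ j ⊔
      MeasurableSpace.comap (M.refineSample φ τ₀ (j + 1)) inferInstance := by
  refine sup_le ((M.stopped_le_refineFiltration φ hτ₀ j).trans le_sup_left)
    (iSup₂_le fun i hi => ?_)
  rcases hi.2.lt_or_eq with h | h
  · exact (M.measurable_refineSample_refine φ hτ₀ hi.1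
      (Nat.lt_succ_iff.1 h)).comap_le.trans le_sup_left
  · rw [h]; exact le_sup_right

theorem measurable_refineStat (j : ℕ) :
    Measurable[M.refineFiltration φ hτ₀ j] (M.refineStat φ τ₀ j) := by
  induction j with
  | zero =>
    exact (measurable_refineStart.comp (measurable_stopped hτ₀ (M.measurable_stat φ))).mono
      (M.stopped_le_refineFiltration φ hτ₀ 0) le_rfl
  | succ j ih =>
    exact (measurable_refineUpdate f₀ f₁).comp
      ((ih.mono ((M.refineFiltration φ hτ₀).mono j.le_succ) le_rfl).prodMk
        (M.measurable_refineSample_refine φ hτ₀ (Nat.le_add_left 1 j) le_rfl))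

/-- On {τ₀ = t} the information G_j is available at time t + j, which reduces refinement to a fixed
time. -/
theorem measurableSet_refine_inter {j : ℕ} {A : Set Ω}
    (hA : MeasurableSet[M.refineFiltration φ hτ₀ j] A) (t : ℕ) :
    MeasurableSet[M.fullFiltration (t + j)] (A ∩ {ω | τ₀ ω = (t : WithTop ℕ)}) := by
  have hle : ∀ t, M.scanFiltration φ t ≤ M.fullFiltration (t + j) := fun t =>
    (M.scanFiltration_le_full φ t).trans (M.fullFiltration.mono (Nat.le_add_right t j))
  have hg : ∀ t : ℕ, MeasurableSet[M.fullFiltration (t + j)] {ω | τ₀ ω = (t : WithTop ℕ)} :=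
    fun t => hle t _ (hτ₀.measurableSet_eq t)
  -- The sets with the required property form a σ-algebra, so only the generators of G_j need
  -- checking.
  have h : M.refineFiltration φ hτ₀ j ≤ fiberSpace τ₀ (fun t => M.fullFiltration (t + j)) hg := by
    refine sup_le (fun B hB t => ?_) (iSup₂_le fun i hi => ?_)
    · refine hle t _ ((hτ₀.measurableSet_inter_eq_iff B t).1 ?_)
      exact MeasurableSet.inter hB ((hτ₀.measurableSet_eq' t))
    · rintro _ ⟨C, hC, rfl⟩ t
      have hY : Measurable[M.fullFiltration (t + j)]
          fun ω => M.Y (2 * M.pair φ t ω) (t + i) ω := by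
        have hq : @Measurable (ℕ × Ω) ℝ (@Prod.instMeasurableSpace _ _ _
            (M.fullFiltration (t + j))) _ fun q => M.Y q.1 (t + i) q.2 :=
          @measurable_from_prod_countable_right ℕ Ω ℝ _ (M.fullFiltration (t + j)) _ _ _ _
            fun s => M.measurable_Y_full s (Nat.add_le_add_left hi.2 t)
        have hp : Measurable[M.fullFiltration (t + j)] fun ω => 2 * M.pair φ t ω :=
          ((M.measurable_pair_full φ t).mono (M.fullFiltration.mono (Nat.le_add_right t j))
            le_rfl).const_mul 2
        exact hq.comp (@Measurable.prodMk Ω (M.fullFiltration (t + j)) ℕ Ω _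
          (M.fullFiltration (t + j)) _ _ hp (@measurable_id _ (M.fullFiltration (t + j))))
      have hset : M.refineSample φ τ₀ i ⁻¹' C ∩ {ω | τ₀ ω = (t : WithTop ℕ)} =
          (fun ω => M.Y (2 * M.pair φ t ω) (t + i) ω) ⁻¹' C ∩ {ω | τ₀ ω = (t : WithTop ℕ)} := by
        ext ω
        simp only [mem_inter_iff, mem_preimage, mem_ofPred_eq, refineSample, and_congr_left_iff]
        intro h
        rw [h]
        rfl
      rw [hset]
      exact MeasurableSet.inter (hY hC) (hg t)
  exact h A hA t

variable [IsProbabilityMeasure P] (hfin : ∀ᵐ ω ∂P, τ₀ ω ≠ ⊤)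

include hfin in
/-- Given the hypotheses of the pair, the next refinement sample has the density determined by the
first of them. -/
theorem hasCondDensity_refineSample (j : ℕ) :
    HasCondDensity (M.refineFiltration φ hτ₀ j) P (M.stoppedStatus φ τ₀)
      (M.refineSample φ τ₀ (j + 1)) (fun a z => ENNReal.ofReal ((hypDensity f₀ f₁ a.1).f z)) := by
  intro A C hA hC a
  have hκ : ∫⁻ z in C, ENNReal.ofReal ((hypDensity f₀ f₁ a.1).f z) =
      (hypDensity f₀ f₁ a.1).law C := (withDensity_apply _ hC).symm
  have hAm := (M.refineFiltration φ hτ₀).le j _ hA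
  have hSm := hAm.inter (M.measurable_stoppedStatus φ hτ₀ (measurableSet_singleton a))
  have hpair := M.measurable_stoppedPair φ hτ₀
  have hN : ∀ i : WithTop ℕ × ℕ,
      (fun ω => (τ₀ ω, M.stoppedPair φ τ₀ ω)) ⁻¹' {i} =
        {ω | τ₀ ω = i.1} ∩ M.stoppedPair φ τ₀ ⁻¹' {i.2} := fun i => by
    ext ω
    simp [Prod.ext_iff]
  rw [hκ]
  refine measure_eq_mul_of_fiber (ι := WithTop ℕ × ℕ)
    (N := fun ω => (τ₀ ω, M.stoppedPair φ τ₀ ω))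
    (fun i => by
      rw [hN]
      exact (measurableSet_fiber hτ₀ i.1).inter (hpair (measurableSet_singleton i.2)))
    (hSm.inter (M.measurable_refineSample φ hτ₀ (j + 1) hC)) hSm ?_
  rintro ⟨t, n⟩
  rw [hN]
  dsimp only
  cases t with
  | top =>
    have h0 : ∀ S : Set Ω, P (S ∩ ({ω | τ₀ ω = ⊤} ∩ M.stoppedPair φ τ₀ ⁻¹' {n})) = 0 :=
      fun S => measure_mono_null (fun ω hω => not_not.2 hω.2.1) hfin
    rw [h0, h0, zero_mul]
  | coe t =>
    -- Only the first sequence is sampled; the hypothesis of the second is counted among the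
    -- conditioning events.
    have hB : MeasurableSet[M.fullFiltration (t + j)]
        (A ∩ {ω | τ₀ ω = (t : WithTop ℕ)} ∩ (M.pair φ t ⁻¹' {n} ∩ M.H (2 * n + 1) ⁻¹' {a.2})) :=
      MeasurableSet.inter (M.measurableSet_refine_inter φ hτ₀ hA t)
        (MeasurableSet.inter (M.fullFiltration.mono (Nat.le_add_right t j) _
          (M.measurable_pair_full φ t (measurableSet_singleton n)))
          (M.measurable_H_full _ _ (measurableSet_singleton a.2)))
    have h1 : A ∩ M.stoppedStatus φ τ₀ ⁻¹' {a} ∩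
        ({ω | τ₀ ω = (t : WithTop ℕ)} ∩ M.stoppedPair φ τ₀ ⁻¹' {n}) =
        A ∩ {ω | τ₀ ω = (t : WithTop ℕ)} ∩ (M.pair φ t ⁻¹' {n} ∩ M.H (2 * n + 1) ⁻¹' {a.2}) ∩
          M.H (2 * n) ⁻¹' {a.1} := by
      ext ω
      simp only [mem_inter_iff, mem_preimage, mem_singleton_iff, mem_ofPred_eq, stoppedStatus,
        status, stoppedPair, Prod.ext_iff]
      constructor
      · rintro ⟨⟨h1, h2, h3⟩, h4, h5⟩
        rw [h4] at h2 h3 h5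
        change M.pair φ t ω = n at h5
        change M.H (2 * M.pair φ t ω) ω = _ at h2
        change M.H (2 * M.pair φ t ω + 1) ω = _ at h3
        rw [h5] at h2 h3
        exact ⟨⟨⟨h1, h4⟩, h5, h3⟩, h2⟩
      · rintro ⟨⟨⟨h1, h4⟩, h5, h3⟩, h2⟩
        rw [h4]
        change (_ ∧ M.H (2 * M.pair φ t ω) ω = _ ∧ M.H (2 * M.pair φ t ω + 1) ω = _) ∧ _ ∧
          M.pair φ t ω = n
        rw [h5]
        exact ⟨⟨h1, h2, h3⟩, rfl, rfl⟩
    have h2 : A ∩ M.stoppedStatus φ τ₀ ⁻¹' {a} ∩ M.refineSample φ τ₀ (j + 1) ⁻¹' C ∩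
        ({ω | τ₀ ω = (t : WithTop ℕ)} ∩ M.stoppedPair φ τ₀ ⁻¹' {n}) =
        A ∩ {ω | τ₀ ω = (t : WithTop ℕ)} ∩ (M.pair φ t ⁻¹' {n} ∩ M.H (2 * n + 1) ⁻¹' {a.2}) ∩
          M.H (2 * n) ⁻¹' {a.1} ∩ M.Y (2 * n) (t + j + 1) ⁻¹' C := by
      rw [inter_right_comm _ (M.refineSample φ τ₀ (j + 1) ⁻¹' C), h1]
      ext ω
      simp only [mem_inter_iff, mem_preimage, mem_singleton_iff, mem_ofPred_eq,
        and_congr_right_iff, refineSample]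
      rintro ⟨⟨⟨-, h4⟩, h5, -⟩, -⟩
      rw [h4]
      change M.Y (2 * M.pair φ t ω) (t + (j + 1)) ω ∈ C ↔ _
      rw [h5, add_assoc]
    exact (congrArg P h2).trans ((M.measure_full_inter_Y hB a.1 hC).trans
      (congrArg (fun S => P S * (hypDensity f₀ f₁ a.1).law C) h1.symm))

variable (hπ : π₀ ∈ Icc (0 : ℝ) 1)
include hfin hπ

/-- On {τ₀ = t} an event of the stopped σ-algebra belongs to F_t, where the fixed-time posterior
applies. -/
theorem isPosterior_stopped : IsPosterior hτ₀.measurableSpace P (M.stoppedStatus φ τ₀)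
    fun ω => scanWeight (M.stat φ ((τ₀ ω).untopD 0) ω) := by
  intro A hA a
  have hAm := hτ₀.measurableSpace_le _ hA
  have hst := M.measurable_stoppedStatus φ hτ₀ (measurableSet_singleton a)
  rw [measure_eq_tsum_fiber (N := τ₀) (measurableSet_fiber hτ₀) (hAm.inter hst),
    lintegral_eq_tsum_fiber (N := τ₀) (measurableSet_fiber hτ₀) _ hAm]
  refine tsum_congr fun t => ?_
  cases t with
  | top =>
    have h0 : ∀ S : Set Ω, P (S ∩ τ₀ ⁻¹' {⊤}) = 0 :=
      fun S => measure_mono_null (fun ω hω => not_not.2 hω.2) hfin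
    rw [h0, setLIntegral_measure_zero _ _ (h0 A)]
  | coe t =>
    have hAt : MeasurableSet[M.scanFiltration φ t] (A ∩ {ω | τ₀ ω = (t : WithTop ℕ)}) :=
      (hτ₀.measurableSet_inter_eq_iff A t).1 (MeasurableSet.inter hA (hτ₀.measurableSet_eq' t))
    have h1 := M.isPosterior_stat φ hπ t _ hAt a
    have h2 : A ∩ M.stoppedStatus φ τ₀ ⁻¹' {a} ∩ τ₀ ⁻¹' {(t : WithTop ℕ)} =
        A ∩ {ω | τ₀ ω = (t : WithTop ℕ)} ∩ M.status φ t ⁻¹' {a} := by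
      ext ω
      simp only [mem_inter_iff, mem_preimage, mem_singleton_iff, mem_ofPred_eq, stoppedStatus]
      constructor
      · rintro ⟨⟨h1, h2⟩, h3⟩
        rw [h3] at h2
        exact ⟨⟨h1, h3⟩, h2⟩
      · rintro ⟨⟨h1, h3⟩, h2⟩
        rw [h3]
        exact ⟨⟨h1, h2⟩, rfl⟩
    refine (congrArg P h2).trans (h1.trans ?_)
    refine setLIntegral_congr_fun ((M.scanFiltration φ).le t _ hAt) fun ω hω => ?_
    have h3 : τ₀ ω = (t : WithTop ℕ) := hω.2
    simp only [h3]
    rfl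

/-- The refinement statistics give the posterior weights of the pair. -/
theorem isPosterior_refineStat (j : ℕ) : IsPosterior (M.refineFiltration φ hτ₀ j) P
    (M.stoppedStatus φ τ₀) fun ω => refineWeight (M.refineStat φ τ₀ j ω) := by
  induction j with
  | zero =>
    intro A hA a
    simp only [refineStat, refineWeight_refineStart]
    exact M.isPosterior_stopped φ hτ₀ hfin hπ A (M.refineFiltration_zero_le φ hτ₀ _ hA) a
  | succ j ih =>
    intro A hA a
    exact (refineFilter_tracks f₀ f₁).isPosterior_update ((M.refineFiltration φ hτ₀).le j)
      (M.measurable_stoppedStatus φ hτ₀) (M.measurable_refineSample φ hτ₀ (j + 1))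
      (M.measurable_refineStat φ hτ₀ j) (M.refineStat_mem φ hπ j) ih
      (M.hasCondDensity_refineSample φ hτ₀ hfin j) A (M.refineFiltration_succ_le φ hτ₀ j _ hA) a

theorem isControlled_refineStat : (refineFilter f₀ f₁).IsControlled P (M.refineFiltration φ hτ₀)
    (M.refineStat φ τ₀) (M.refineStat φ τ₀) := fun j _ hf _ hA =>
  (refineFilter_tracks f₀ f₁).setLIntegral_update ((M.refineFiltration φ hτ₀).le j)
    (M.measurable_stoppedStatus φ hτ₀) (M.measurable_refineSample φ hτ₀ (j + 1))
    (M.measurable_refineStat φ hτ₀ j) (M.refineStat_mem φ hπ j)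
    (M.isPosterior_refineStat φ hτ₀ hfin hπ j) (M.hasCondDensity_refineSample φ hτ₀ hfin j) hf hA

/-! ### The terminal decision -/

/-- The posterior probability that the claimed sequence is generated by `f₁`. -/
def _root_.claimProb (b : Bool) (r : ℝ × ℝ × ℝ) : ℝ := r.1 + if b then r.2.1 else r.2.2

omit hfin hπ in
theorem _root_.refineStopCost_le_claim (b : Bool) (r : ℝ × ℝ × ℝ) :
    refineStopCost r ≤ 1 - claimProb b r := by
  unfold refineStopCost claimProb
  cases b
  · simpa using sub_le_sub_left (le_max_right (r.1 + r.2.1) (r.1 + r.2.2)) 1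
  · simpa using sub_le_sub_left (le_max_left (r.1 + r.2.1) (r.1 + r.2.2)) 1

omit hfin hπ in
theorem _root_.refineStopCost_eq_claim (r : ℝ × ℝ × ℝ) :
    refineStopCost r = 1 - claimProb (decide (r.2.2 ≤ r.2.1)) r := by
  unfold refineStopCost claimProb
  by_cases h : r.2.2 ≤ r.2.1
  · simp [h]
  · simpa [h] using (not_le.1 h).le

omit hfin hπ [IsProbabilityMeasure P] in
theorem wrong_claim_eq (b : Bool) :
    {ω | M.H (2 * M.stoppedPair φ τ₀ ω + if b then 0 else 1) ω = false} =
      M.stoppedStatus φ τ₀ ⁻¹' {(!b, b)} ∪ M.stoppedStatus φ τ₀ ⁻¹' {(false, false)} := by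
  ext ω
  simp only [mem_ofPred_eq, mem_union, mem_preimage, mem_singleton_iff, stoppedStatus, status,
    Prod.ext_iff, stoppedPair]
  cases b <;> simp <;>
    cases M.H (2 * M.pair φ ((τ₀ ω).untopD 0) ω) ω <;>
    cases M.H (2 * M.pair φ ((τ₀ ω).untopD 0) ω + 1) ω <;> simp

/-- A claim is wrong under two disjoint assignments, whose posterior weights add up to the
complement of `claimProb`. -/
theorem measure_wrong_claim (b : Bool) {j : ℕ} {A : Set Ω}
    (hA : MeasurableSet[M.refineFiltration φ hτ₀ j] A) :
    P (A ∩ {ω | M.H (2 * M.stoppedPair φ τ₀ ω + if b then 0 else 1) ω = false}) =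
      ∫⁻ ω in A, ENNReal.ofReal (1 - claimProb b (M.refineStat φ τ₀ j ω)) ∂P := by
  have hle := (M.refineFiltration φ hτ₀).le j
  have hst := M.measurable_stoppedStatus φ hτ₀
  have hp := M.isPosterior_refineStat φ hτ₀ hfin hπ j A hA
  have hw : Measurable fun ω => refineWeight (M.refineStat φ τ₀ j ω) (!b, b) :=
    ((refineFilter_tracks f₀ f₁).measurable_weight (!b, b)).comp
      ((M.measurable_refineStat φ hτ₀ j).mono hle le_rfl)
  rw [wrong_claim_eq, inter_union_distrib_left, measure_union, hp, hp, ← lintegral_add_left hw]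
  · refine lintegral_congr fun ω => ?_
    obtain ⟨h1, h2, h3, h4⟩ := M.refineStat_mem φ (τ₀ := τ₀) hπ j ω
    cases b
    · simp only [refineWeight, claimProb, Bool.not_false, Bool.false_eq_true, if_false]
      rw [← ENNReal.ofReal_add (by linarith) (by linarith)]
      congr 1
      ring
    · simp only [refineWeight, claimProb, Bool.not_true, if_true]
      rw [← ENNReal.ofReal_add (by linarith) (by linarith)]
      congr 1
      ring
  · refine disjoint_left.2 fun ω hω hω' => ?_
    have h3 : M.stoppedStatus φ τ₀ ω = (!b, b) := hω.2
    have h4 : M.stoppedStatus φ τ₀ ω = (false, false) := hω'.2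
    rw [h3] at h4
    revert h4
    cases b <;> simp
  · exact (hle _ hA).inter (hst (measurableSet_singleton _))

/-- The false identification probability of a refinement strategy. -/
theorem measure_error_eq (ρ : M.Refinement φ hτ₀) (hfin₁ : ∀ᵐ ω ∂P, ρ.τ₁ ω ≠ ⊤) :
    P {ω | M.H (2 * M.pair φ ((τ₀ ω).untopD 0) ω + if ρ.δ ω then 0 else 1) ω = false} =
      ∫⁻ ω, ENNReal.ofReal
        (1 - claimProb (ρ.δ ω) (M.refineStat φ τ₀ ((ρ.τ₁ ω).untopD 0) ω)) ∂P := by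
  set E := {ω | M.H (2 * M.pair φ ((τ₀ ω).untopD 0) ω + if ρ.δ ω then 0 else 1) ω = false} with hE
  have hδ : Measurable ρ.δ := ρ.measurable_δ.mono ρ.isStoppingTime.measurableSpace_le le_rfl
  have hEm : MeasurableSet E := by
    have hn : Measurable fun ω => 2 * M.stoppedPair φ τ₀ ω + if ρ.δ ω then 0 else 1 :=
      ((M.measurable_stoppedPair φ hτ₀).const_mul 2).add
        (Measurable.ite (hδ (measurableSet_singleton true)) measurable_const measurable_const)
    exact M.measurable_H_comp hn (measurableSet_singleton false)
  have hN : ∀ i : WithTop ℕ × Bool, (fun ω => (ρ.τ₁ ω, ρ.δ ω)) ⁻¹' {i} =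
      {ω | ρ.τ₁ ω = i.1} ∩ ρ.δ ⁻¹' {i.2} := fun i => by
    ext ω
    simp [Prod.ext_iff]
  have hNm : ∀ i : WithTop ℕ × Bool, MeasurableSet ((fun ω => (ρ.τ₁ ω, ρ.δ ω)) ⁻¹' {i}) :=
    fun i => by
      rw [hN]
      exact (measurableSet_fiber ρ.isStoppingTime i.1).inter (hδ (measurableSet_singleton i.2))
  -- On each fiber of (τ₁, δ) the time and the claim are constants, and the fiber belongs to G_j for
  -- j = τ₁.
  rw [measure_eq_tsum_fiber hNm hEm, ← setLIntegral_univ,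
    lintegral_eq_tsum_fiber hNm _ MeasurableSet.univ]
  refine tsum_congr ?_
  rintro ⟨t, b⟩
  rw [hN, univ_inter]
  dsimp only
  cases t with
  | top =>
    have h0 : P ({ω | ρ.τ₁ ω = ⊤} ∩ ρ.δ ⁻¹' {b}) = 0 :=
      measure_mono_null (fun ω hω => not_not.2 hω.1) hfin₁
    rw [setLIntegral_measure_zero _ _ h0, measure_mono_null inter_subset_right h0]
  | coe j =>
    have hA : MeasurableSet[M.refineFiltration φ hτ₀ j]
        ({ω | ρ.τ₁ ω = (j : WithTop ℕ)} ∩ ρ.δ ⁻¹' {b}) := by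
      rw [inter_comm]
      exact (ρ.isStoppingTime.measurableSet_inter_eq_iff _ j).1
        (MeasurableSet.inter (ρ.measurable_δ (measurableSet_singleton b))
          (ρ.isStoppingTime.measurableSet_eq' j))
    have h1 := M.measure_wrong_claim φ hτ₀ hfin hπ b hA
    have h2 : E ∩ ({ω | ρ.τ₁ ω = (j : WithTop ℕ)} ∩ ρ.δ ⁻¹' {b}) =
        {ω | ρ.τ₁ ω = (j : WithTop ℕ)} ∩ ρ.δ ⁻¹' {b} ∩
          {ω | M.H (2 * M.stoppedPair φ τ₀ ω + if b then 0 else 1) ω = false} := by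
      rw [inter_comm]
      ext ω
      simp only [mem_inter_iff, mem_ofPred_eq, mem_preimage, mem_singleton_iff,
        and_congr_right_iff, hE, stoppedPair]
      rintro ⟨-, h⟩
      rw [h]
    refine (congrArg P h2).trans (h1.trans ?_)
    refine setLIntegral_congr_fun ((M.refineFiltration φ hτ₀).le j _ hA) fun ω hω => ?_
    have h3 : ρ.τ₁ ω = (j : WithTop ℕ) := hω.1
    have h4 : ρ.δ ω = b := hω.2
    simp only [h3, h4]
    rfl

end SearchModel

/-! ### Hitting times and the stopping and switching regions -/

theorem mem_of_hittingAfter_eq {Ω X : Type*} {u : ℕ → Ω → X} {s : Set X} {ω : Ω} {k : ℕ}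
    (h : hittingAfter u s 0 ω = (k : WithTop ℕ)) : u k ω ∈ s := by
  have h1 := hittingAfter_mem_set_of_ne_top (u := u) (s := s) (n := 0) (ω := ω)
    (by rw [h]; exact WithTop.coe_ne_top)
  rw [h] at h1
  exact h1

theorem measurableSet_scanDomain : MeasurableSet scanDomain := by
  have h : scanDomain = {p : ℝ × ℝ | 0 ≤ p.1} ∩ {p | 0 ≤ p.2} ∩ {p | p.1 + p.2 ≤ 1} := by
    ext p
    simp only [mem_scanDomain_iff, mem_inter_iff, mem_ofPred_eq, and_assoc]
  rw [h]
  exact ((measurableSet_le measurable_const measurable_fst).inter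
    (measurableSet_le measurable_const measurable_snd)).inter
    (measurableSet_le (measurable_fst.add measurable_snd) measurable_const)

section Regions

variable (f₀ f₁ : ProbDensity) (π₀ c : ℝ)

/-- The states in which scanning stops. -/
def stopRegion : Set (ℝ × ℝ) :=
  {p ∈ scanDomain | scanStopCost f₀ f₁ c p = scanValue f₀ f₁ π₀ c p}

/-- The states in which the observer switches to a new pair. -/
def switchRegion : Set (ℝ × ℝ) :=
  {p ∈ scanDomain | ¬ continueCost f₀ f₁ π₀ c p ≤ switchCost f₀ f₁ π₀ c}

theorem measurable_scanValue : Measurable (scanValue f₀ f₁ π₀ c) := by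
  rw [scanValue_eq]
  exact BayesFilter.measurable_value (measurable_scanStopCost f₀ f₁ c) measurable_const

theorem measurableSet_stopRegion : MeasurableSet (stopRegion f₀ f₁ π₀ c) :=
  measurableSet_scanDomain.inter
    (measurableSet_eq_fun (measurable_scanStopCost f₀ f₁ c) (measurable_scanValue f₀ f₁ π₀ c))

theorem measurableSet_switchRegion : MeasurableSet (switchRegion f₀ f₁ π₀ c) :=
  measurableSet_scanDomain.inter
    (measurableSet_le ((scanFilter f₀ f₁).measurable_expect (measurable_scanValue f₀ f₁ π₀ c))
      measurable_const).compl

variable {π₀ c}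

/-- If the minimum in the optimality equation is not attained by stopping, it is attained by
observing. -/
theorem scanValue_of_notMem_stopRegion (hπ : π₀ ∈ Icc (0 : ℝ) 1) (hc : 0 < c) {p : ℝ × ℝ}
    (hp : p ∈ scanDomain) (h : p ∉ stopRegion f₀ f₁ π₀ c) : scanValue f₀ f₁ π₀ c p =
      c + min (continueCost f₀ f₁ π₀ c p) (switchCost f₀ f₁ π₀ c) := by
  have h1 : scanValue f₀ f₁ π₀ c p = min (scanStopCost f₀ f₁ c p)
      (c + min (continueCost f₀ f₁ π₀ c p) (switchCost f₀ f₁ π₀ c)) := by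
    change _ = min _ (c + min ((scanFilter f₀ f₁).expect (scanValue f₀ f₁ π₀ c) p)
      ((scanFilter f₀ f₁).expect (scanValue f₀ f₁ π₀ c) (scanPrior π₀)))
    rw [scanValue_eq]
    exact BayesFilter.value_eq (measurable_scanStopCost f₀ f₁ c) measurable_const hc.le
      (fun _ => scanStopCost_mem f₀ f₁ hc) (fun _ _ => scanPrior_mem hπ) hp
  rcases min_choice (scanStopCost f₀ f₁ c p)
    (c + min (continueCost f₀ f₁ π₀ c p) (switchCost f₀ f₁ π₀ c)) with h2 | h2
  · exact absurd ⟨hp, (h1.trans h2).symm⟩ h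
  · exact h1.trans h2

end Regions

namespace SearchModel

variable {f₀ f₁ : ProbDensity} {π₀ c : ℝ} {Ω : Type u} [mΩ : MeasurableSpace Ω] {P : Measure Ω}
  [IsProbabilityMeasure P] (M : SearchModel f₀ f₁ π₀ P) (φ : SwitchRule) {τ₀ : Ω → WithTop ℕ}
  (hτ₀ : IsStoppingTime (M.scanFiltration φ) τ₀) (hπ : π₀ ∈ Icc (0 : ℝ) 1) (hc : 0 < c)

/-! ### The scanning stage -/

include hπ in
theorem scanCost_eq : M.scanCost φ c τ₀ = ENNReal.ofReal c * ∫⁻ ω, ENat.toENNReal (τ₀ ω) ∂P +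
    ∫⁻ ω, ENNReal.ofReal (scanStopCost f₀ f₁ c (M.stat φ ((τ₀ ω).untopD 0) ω)) ∂P := by
  unfold scanCost
  congr 1
  refine lintegral_congr_ae ?_
  filter_upwards [M.posterior_ae_eq φ hπ] with ω hω
  rw [hω]

include hτ₀ hπ hc in
-- Under every switching rule the next state is either the current one or the prior, so the general
-- lower bound applies.
theorem scanValue_le_scanCost :
    ENNReal.ofReal (scanValue f₀ f₁ π₀ c (scanPrior π₀)) ≤ M.scanCost φ c τ₀ := by
  rw [M.scanCost_eq φ hπ]
  have h := (M.isControlled_stat φ hπ).value_le_stopped (measurable_scanStopCost f₀ f₁ c)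
    (s := fun _ => scanPrior π₀) measurable_const hc
    (fun _ => scanStopCost_mem f₀ f₁ hc) (fun _ _ => scanPrior_mem hπ) (M.stat_mem φ hπ)
    (M.nextStat_mem φ hπ) hτ₀ fun k ω => by
      unfold nextStat
      split_ifs
      exacts [Or.inr rfl, Or.inl rfl]
  rw [← scanValue_eq] at h
  refine le_trans (le_of_eq ?_) h
  simp [stat]

omit [IsProbabilityMeasure P] in
theorem measurable_posterior (k : ℕ) : Measurable[M.scanFiltration φ k] (M.posterior φ k) :=
  Measurable.prodMk stronglyMeasurable_condExp.measurable stronglyMeasurable_condExp.measurable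

omit [IsProbabilityMeasure P] in
theorem isStoppingTime_hittingAfter_posterior {R : Set (ℝ × ℝ)} (hR : MeasurableSet R) :
    IsStoppingTime (M.scanFiltration φ) (hittingAfter (M.posterior φ) R 0) :=
  Adapted.isStoppingTime_hittingAfter (M.measurable_posterior φ) hR

include hπ hc in
theorem scanCost_hittingAfter_le (hφ : M.SwitchesExactlyOn φ (switchRegion f₀ f₁ π₀ c)) :
    (∀ᵐ ω ∂P, hittingAfter (M.posterior φ) (stopRegion f₀ f₁ π₀ c) 0 ω ≠ ⊤) ∧
      M.scanCost φ c (hittingAfter (M.posterior φ) (stopRegion f₀ f₁ π₀ c) 0) ≤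
        ENNReal.ofReal (scanValue f₀ f₁ π₀ c (scanPrior π₀)) := by
  have h := (M.isControlled_stat φ hπ).stopped_le_value (measurable_scanStopCost f₀ f₁ c)
    (s := fun _ => scanPrior π₀) measurable_const hc
    (fun _ => scanStopCost_mem f₀ f₁ hc) (fun _ _ => scanPrior_mem hπ) (M.stat_mem φ hπ)
    (M.nextStat_mem φ hπ)
    (M.isStoppingTime_hittingAfter_posterior φ (measurableSet_stopRegion f₀ f₁ π₀ c))
  rw [← scanValue_eq] at h
  rw [M.scanCost_eq φ hπ]
  have h0 : ∫⁻ ω, ENNReal.ofReal (scanValue f₀ f₁ π₀ c (M.stat φ 0 ω)) ∂P =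
      ENNReal.ofReal (scanValue f₀ f₁ π₀ c (scanPrior π₀)) := by
    simp [stat]
  rw [← h0]
  refine h ?_ ?_
  · filter_upwards [M.posterior_ae_eq φ hπ, hφ] with ω h1 h2 k hk
    have h3 := notMem_of_lt_hittingAfter (k := k) hk (Nat.zero_le k)
    specialize h2 k
    rw [h1] at h2 h3
    rw [scanValue_of_notMem_stopRegion f₀ f₁ hπ hc (M.stat_mem φ hπ k ω) h3]
    unfold nextStat
    -- Switching happens exactly where Φ_c > Φ_s, so the action taken attains the minimum; in a tie
    -- the pair is kept.
    split_ifs with h4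
    · rw [min_eq_right (not_le.1 (h2.1 h4).2).le]
      rfl
    · rw [min_eq_left]
      · rfl
      · by_contra h5
        exact h4 (h2.2 ⟨M.stat_mem φ hπ k ω, h5⟩)
  · filter_upwards [M.posterior_ae_eq φ hπ] with ω h1 k hk
    have h2 := mem_of_hittingAfter_eq hk
    rw [h1] at h2
    exact h2.2

/-! ### The refinement stage -/

include hπ hc in
theorem scanCost_le_totalCost (ρ : M.Refinement φ hτ₀) :
    M.scanCost φ c τ₀ ≤ M.totalCost φ c hτ₀ ρ := by
  have hc0 : ENNReal.ofReal c ≠ 0 := by simpa using hc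
  unfold totalCost
  -- With infinite expected duration the bound is trivial; otherwise both stopping times are almost
  -- surely finite, as the posterior identities require.
  by_cases htop : ∫⁻ ω, ENat.toENNReal (τ₀ ω + ρ.τ₁ ω) ∂P = ∞
  · rw [htop, ENNReal.mul_top hc0, top_add]
    exact le_top
  rw [lintegral_toENNReal_add hτ₀] at htop ⊢
  rw [ENNReal.add_eq_top, not_or] at htop
  have hfin := ae_ne_top_of_isStoppingTime hτ₀ htop.1
  have hfin₁ := ae_ne_top_of_isStoppingTime ρ.isStoppingTime htop.2
  rw [M.scanCost_eq φ hπ, M.measure_error_eq φ hτ₀ hfin hπ ρ hfin₁, mul_add, add_assoc]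
  gcongr
  -- The refinement value at the initial state is `scanStopCost` of the stopped scanning state.
  have h := (M.isControlled_refineStat φ hτ₀ hfin hπ).value_le_stopped measurable_refineStopCost
    measurable_id hc (fun _ => refineStopCost_mem) (fun _ h => h) (M.refineStat_mem φ hπ)
    (M.refineStat_mem φ hπ) ρ.isStoppingTime fun _ _ => Or.inl rfl
  rw [← refineValue_eq] at h
  refine h.trans ?_
  gcongr with ω
  exact refineStopCost_le_claim _ _

section OptimalRefinement

variable (c)

/-- The optimal refinement strategy. -/
def optimalRefinement : M.Refinement φ hτ₀ where
  τ₁ := hittingAfter (M.refineStat φ τ₀) {r | refineStopCost r = refineValue f₀ f₁ c r} 0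
  isStoppingTime := Adapted.isStoppingTime_hittingAfter (M.measurable_refineStat φ hτ₀)
    (measurableSet_eq_fun measurable_refineStopCost (measurable_refineValue f₀ f₁ c))
  δ ω :=
    let r := M.refineStat φ τ₀ ((hittingAfter (M.refineStat φ τ₀)
      {r | refineStopCost r = refineValue f₀ f₁ c r} 0 ω).untopD 0) ω
    decide (r.2.2 ≤ r.2.1)
  measurable_δ := by
    have h : Measurable fun r : ℝ × ℝ × ℝ => decide (r.2.2 ≤ r.2.1) := by
      refine measurable_to_bool ?_
      have h1 : (fun r : ℝ × ℝ × ℝ => decide (r.2.2 ≤ r.2.1)) ⁻¹' {true} =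
          {r | r.2.2 ≤ r.2.1} := by
        ext r
        simp
      rw [h1]
      exact measurableSet_le measurable_snd.snd measurable_snd.fst
    exact h.comp (measurable_stopped _ (M.measurable_refineStat φ hτ₀))

end OptimalRefinement

include hπ hc in
-- Refining until V₀ = V attains the refinement value, and claiming the more probable sequence turns
-- the error probability into V₀.
theorem totalCost_optimalRefinement_le (hfin : ∀ᵐ ω ∂P, τ₀ ω ≠ ⊤) :
    M.totalCost φ c hτ₀ (M.optimalRefinement c φ hτ₀) ≤ M.scanCost φ c τ₀ := by
  obtain ⟨hfin₁, h⟩ := (M.isControlled_refineStat φ hτ₀ hfin hπ).stopped_le_value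
    measurable_refineStopCost measurable_id hc (fun _ => refineStopCost_mem) (fun _ h => h)
    (M.refineStat_mem φ hπ) (M.refineStat_mem φ hπ)
    (M.optimalRefinement c φ hτ₀).isStoppingTime (ae_of_all _ fun ω k hk => by
      have h1 := notMem_of_lt_hittingAfter (u := M.refineStat φ τ₀)
        (s := {r | refineStopCost r = refineValue f₀ f₁ c r}) (k := k) hk (Nat.zero_le k)
      have h2 := BayesFilter.value_eq (B := refineFilter f₀ f₁) measurable_refineStopCost
        measurable_id hc.le (fun _ => refineStopCost_mem) (fun _ h => h)
        (M.refineStat_mem φ (τ₀ := τ₀) hπ k ω)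
      rw [mem_ofPred_eq, refineValue_eq] at h1
      rw [id, min_self] at h2
      rcases min_choice (refineStopCost (M.refineStat φ τ₀ k ω)) (c +
        (refineFilter f₀ f₁).expect ((refineFilter f₀ f₁).value refineStopCost id c)
          (M.refineStat φ τ₀ k ω)) with h3 | h3
      · exact absurd (h2.trans h3).symm h1
      · exact h2.trans h3) (ae_of_all _ fun ω k hk => by
      have h1 := mem_of_hittingAfter_eq (u := M.refineStat φ τ₀)
        (s := {r | refineStopCost r = refineValue f₀ f₁ c r}) hk
      rwa [mem_ofPred_eq, refineValue_eq] at h1)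
  unfold totalCost
  rw [lintegral_toENNReal_add hτ₀, M.scanCost_eq φ hπ,
    M.measure_error_eq φ hτ₀ hfin hπ _ hfin₁, mul_add, add_assoc]
  gcongr
  rw [← refineValue_eq] at h
  refine le_trans (le_of_eq ?_) h
  congr 1
  exact lintegral_congr fun ω => congrArg ENNReal.ofReal (refineStopCost_eq_claim _).symm

end SearchModel
end

/-! ### Optimality of the two-stage strategy -/

theorem mainTheorem7 (f₀ f₁ : ProbDensity) (hne : f₀.law ≠ f₁.law)
    (h₀₁ : f₀.law ≪ f₁.law) (h₁₀ : f₁.law ≪ f₀.law)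
    (π₀ : ℝ) (hπ₀ : π₀ ∈ Set.Icc (0 : ℝ) 1) (c : ℝ) (hc : 0 < c) :
    ∃ Rτ Rφ : Set (ℝ × ℝ),
      Rτ ⊆ scanDomain ∧ Rφ ⊆ scanDomain ∧ MeasurableSet Rτ ∧ MeasurableSet Rφ ∧
      (∀ p ∈ scanDomain, p ∈ Rτ ↔ scanStopCost f₀ f₁ c p = scanValue f₀ f₁ π₀ c p) ∧
      (∀ p ∈ scanDomain, p ∈ Rφ ↔ ¬ continueCost f₀ f₁ π₀ c p ≤ switchCost f₀ f₁ π₀ c) ∧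
      ∀ (Ω : Type u) [MeasurableSpace Ω] (P : Measure Ω) [IsProbabilityMeasure P]
        (M : SearchModel f₀ f₁ π₀ P),
        (∃ φ : SwitchRule, M.SwitchesExactlyOn φ Rφ) ∧
        ∀ φ : SwitchRule, M.SwitchesExactlyOn φ Rφ →
          (∀ᵐ ω ∂P, hittingAfter (M.posterior φ) Rτ 0 ω ≠ ⊤) ∧
          ∃ hτ : IsStoppingTime (M.scanFiltration φ) (hittingAfter (M.posterior φ) Rτ 0),
            (∀ (φ' : SwitchRule) (τ' : Ω → WithTop ℕ), IsStoppingTime (M.scanFiltration φ') τ' →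
              M.scanCost φ c (hittingAfter (M.posterior φ) Rτ 0) ≤ M.scanCost φ' c τ') ∧
            ∃ ρ : M.Refinement φ hτ,
              ∀ (φ' : SwitchRule) (τ' : Ω → WithTop ℕ)
                (hτ' : IsStoppingTime (M.scanFiltration φ') τ') (ρ' : M.Refinement φ' hτ'),
                M.totalCost φ c hτ ρ ≤ M.totalCost φ' c hτ' ρ' := by
  refine ⟨stopRegion f₀ f₁ π₀ c, switchRegion f₀ f₁ π₀ c, fun _ hp => hp.1, fun _ hp => hp.1,
    measurableSet_stopRegion f₀ f₁ π₀ c, measurableSet_switchRegion f₀ f₁ π₀ c,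
    fun p hp => ⟨fun h => h.2, fun h => ⟨hp, h⟩⟩, fun p hp => ⟨fun h => h.2, fun h => ⟨hp, h⟩⟩,
    fun Ω _ P _ M => ⟨⟨_, M.switchesExactlyOn_feedbackRule hπ₀
      (measurableSet_switchRegion f₀ f₁ π₀ c)⟩, fun φ hφ => ?_⟩⟩
  obtain ⟨hfin, hle⟩ := M.scanCost_hittingAfter_le φ hπ₀ hc hφ
  have hτ := M.isStoppingTime_hittingAfter_posterior φ (measurableSet_stopRegion f₀ f₁ π₀ c)
  have hscan : ∀ (φ' : SwitchRule) (τ' : Ω → WithTop ℕ), IsStoppingTime (M.scanFiltration φ') τ' →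
      M.scanCost φ c (hittingAfter (M.posterior φ) (stopRegion f₀ f₁ π₀ c) 0) ≤
        M.scanCost φ' c τ' := fun φ' τ' hτ' =>
    hle.trans (M.scanValue_le_scanCost φ' hτ' hπ₀ hc)
  -- The chain: the candidate's total cost is at most its scanning cost, this is at most any
  -- scanning cost, and that is at most the corresponding total cost.
  exact ⟨hfin, hτ, hscan, M.optimalRefinement c φ hτ, fun φ' τ' hτ' ρ' =>
    ((M.totalCost_optimalRefinement_le φ hτ hπ₀ hc hfin).trans (hscan φ' τ' hτ')).trans
      (M.scanCost_le_totalCost φ' hτ' hπ₀ hc ρ')⟩
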